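/- For $n\ge 3$, a ball $B=B_R(x_0)\subset\mathbb R^n$ with $R>0$, and reals $m,c$, consider the following estimate $(E_{m,c})$ on $B$: for all $0<\nu\le\Lambda<\infty$, all $a\in L^\infty(B;\mathbb R^{n\times n})$ such that $a(x)$ is symmetric for almost every $x\in B$ and $$\nu|z|^2\le a(x)z\cdot z\le\Lambda|z|^2\qquad\text{for every } z\in\mathbb R^n \text{ and almost every } x\in B,$$ and all $v\in W^{1,2}(B)$ that are subsolutions, i.e. satisfy $$\int_B a\nabla v\cdot\nabla\varphi\,dx\le 0\qquad\text{for all }\varphi\in C_c^1(B)\text{ with }\varphi\ge 0,$$ one has $$\sup_{\frac12 B}v\le c\Big(\frac{\Lambda}{\nu}\Big)^m\Big(\frac1{|B|}\int_B (v_+)^2\,dx\Big)^{1/2},$$ where $\sup$ is the essential supremum, $\frac12B=B_{R/2}(x_0)$ and $v_+=\max\{v,0\}$. Then: (1) If $n\ge4$, there is a constant $c=c(n)<\infty$ such that $(E_{m,c})$ holds with $m=\frac{n-1}{4}$ on every ball $B=B_R(x_0)\subset\mathbb R^n$. (2) If $n=3$, then for every $\kappa\in(0,\frac12)$ there is a constant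 $c=c(\kappa)<\infty$ such that $(E_{m,c})$ holds with $m=\frac{1+\kappa}{2}$ on every ball $B=B_R(x_0)\subset\mathbb R^3$. (3) For $n\ge4$ the exponent in (1) is optimal: for every $m<\frac{n-1}{4}$, every ball $B\subset\mathbb R^n$ and every real $c$, the estimate $(E_{m,c})$ on $B$ is false. (4) For $n=3$ the exponent in (2) is essentially optimal: for every $m<\frac12$, every ball $B\subset\mathbb R^3$ and every real $c$, the estimate $(E_{m,c})$ on $B$ is false. -/

import Mathlib

open MeasureTheory
open scoped ContDiff

/-- `v` belongs to `W^{1,2}(U)` and `Dv` is (a representative of) its weak gradient: both are square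
integrable on `U`, and `∫_U v ∂ᵢφ = - ∫_U (Dv)ᵢ φ` for all smooth `φ` with compact support in `U`. -/
structure HasW12Gradient {n : ℕ} (U : Set (EuclideanSpace ℝ (Fin n)))
    (v : EuclideanSpace ℝ (Fin n) → ℝ)
    (Dv : EuclideanSpace ℝ (Fin n) → EuclideanSpace ℝ (Fin n)) : Prop where
  memLp : MemLp v 2 (volume.restrict U)
  memLp_grad : MemLp Dv 2 (volume.restrict U)
  integral_eq : ∀ φ : EuclideanSpace ℝ (Fin n) → ℝ,
    ContDiff ℝ ∞ φ → HasCompactSupport φ → tsupport φ ⊆ U →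
    ∀ i : Fin n, ∫ x in U, v x * fderiv ℝ φ x (EuclideanSpace.single i 1)
      = - ∫ x in U, Dv x i * φ x

/-- `a ∈ L^∞(U; ℝ^{n×n})`, `a(x)` is symmetric for almost every `x ∈ U`, and
`ν |z|² ≤ a(x) z · z ≤ Λ |z|²` for all `z ∈ ℝⁿ` and almost every `x ∈ U`. -/
structure IsEllipticCoefficient {n : ℕ} (U : Set (EuclideanSpace ℝ (Fin n))) (ν Λ : ℝ)
    (a : EuclideanSpace ℝ (Fin n) → Matrix (Fin n) (Fin n) ℝ) : Prop where
  memLp : ∀ i j : Fin n, MemLp (fun x => a x i j) ⊤ (volume.restrict U)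
  symm : ∀ᵐ x ∂(volume.restrict U), (a x).IsSymm
  elliptic : ∀ᵐ x ∂(volume.restrict U), ∀ z : EuclideanSpace ℝ (Fin n),
    ν * ‖z‖ ^ 2 ≤ inner ℝ (Matrix.toEuclideanLin (a x) z) z ∧
      inner ℝ (Matrix.toEuclideanLin (a x) z) z ≤ Λ * ‖z‖ ^ 2

/-- `v ∈ W^{1,2}(U)` is a (weak) subsolution of `div (a ∇v) ≥ 0` in `U`: `∫_U a ∇v · ∇φ ≤ 0` for all
nonnegative `φ ∈ C_c^1(U)`. -/
def IsSubsolution {n : ℕ} (U : Set (EuclideanSpace ℝ (Fin n)))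
    (a : EuclideanSpace ℝ (Fin n) → Matrix (Fin n) (Fin n) ℝ)
    (v : EuclideanSpace ℝ (Fin n) → ℝ) : Prop :=
  ∃ Dv : EuclideanSpace ℝ (Fin n) → EuclideanSpace ℝ (Fin n), HasW12Gradient U v Dv ∧
    ∀ φ : EuclideanSpace ℝ (Fin n) → ℝ,
      ContDiff ℝ 1 φ → HasCompactSupport φ → tsupport φ ⊆ U → (∀ x, 0 ≤ φ x) →
      ∫ x in U, inner ℝ (Matrix.toEuclideanLin (a x) (Dv x)) (gradient φ x) ≤ 0

/-- The estimate `sup_{B/2} v ≤ c (Λ/ν)^m (⨍_B (v_+)²)^{1/2}` on the ball `B = B_R(x₀)`, for all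
ellipticity bounds, all admissible coefficients and all subsolutions. The supremum of the Sobolev
function `v` is the essential supremum, taken in the extended reals. -/
def SupEstimate (n : ℕ) (x₀ : EuclideanSpace ℝ (Fin n)) (R m c : ℝ) : Prop :=
  ∀ (ν Λ : ℝ) (a : EuclideanSpace ℝ (Fin n) → Matrix (Fin n) (Fin n) ℝ)
    (v : EuclideanSpace ℝ (Fin n) → ℝ), 0 < ν → ν ≤ Λ →
    IsEllipticCoefficient (Metric.ball x₀ R) ν Λ a →
    IsSubsolution (Metric.ball x₀ R) a v →
    essSup (fun x => (v x : EReal)) (volume.restrict (Metric.ball x₀ (R / 2))) ≤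
      ((c * (Λ / ν) ^ m * Real.sqrt (⨍ x in Metric.ball x₀ R, (max (v x) 0) ^ 2) : ℝ) : EReal)

/-!
The upper bound is a De Giorgi iteration in which the cutoff functions are optimized. Write
`n = d + 1`. Two facts are available for a truncation `(v - k)₊` of a subsolution: the Caccioppoli
inequality `∫ |∇(η (v - k)₊)|² ≤ 10 (Λ/ν) ∫ (v - k)₊² |∇η|²` (`caccioppoli`), which costs one
power of `Λ/ν` at each step, and the Sobolev inequality. The classical combination of the two on
balls gives the exponent `n / 4`. The gain comes from using the Sobolev inequality only on
hyperplanes `xᵢ = t`, whose dimension is `d` instead of `n`.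

Cutoffs are products `∏ ζᵢ(xᵢ)`, so that `∫ (v - l)₊² |∇η'|²` is at most a sum of one-dimensional
integrals `∫ ζᵢ'(t)² fᵢ(t) dt`, where `fᵢ(t)` is the integral of `(v - l)₊²` over the hyperplane
`xᵢ = t`. By Chebyshev's inequality in `L^{2χ}` and the Sobolev inequality `W^{1,2} ⊆ L^{2χ}` on
this hyperplane (`exists_lintegral_sliceMap_le`), `fᵢ(t) ≤ M hᵢ(t)^χ`, where `hᵢ(t)` is the energy
of the preceding truncation on it, and `∫ hᵢ` is the full energy. Choosing `ζᵢ` to decrease mostly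
where `hᵢ` is at most twice its mean, one can bound the one-dimensional integral by the power
`χ > 1` of the energy (`exists_cutoff`). The energies `Eⱼ` of the successive truncations then
satisfy `Eⱼ₊₁ ≤ C (Λ/ν) bʲ Eⱼ^χ` (`exists_cutoff_energy_le`), and they tend to zero if the final
level `K` is a multiple of `(Λ/ν)^{χ / (2 (χ - 1))}` times the root of the mean square of `v₊` on
a cube (`ae_le_of_energy_of_sobolev`, `exists_level_constant`). In dimension `d ≥ 3` the critical
choice `χ = d / (d - 2)` gives the exponent `d / 4`; for `d = 2` every `χ < ∞` is allowed, and
`χ = 1 + 1/κ` gives `(1 + κ) / 2`.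

Truncations of Sobolev functions, and the enlargement of the class of test functions from `C¹` to
these truncations, are obtained by mollification (`isW12Limit_mul_posPart`).

For optimality, take the coefficient `diag (Λ, 1, …, 1)` and, with `x = (x₀, x')`, the function
`e^{k (x₀ - c₀) / R} (1 - Λ |x' - c'|² / R²)₊³`, which is a subsolution for a suitable `k`
depending only on `n` (`isSubsolution_expBump`). It equals `1` at the centre `c`, but is supported
within distance `R Λ^{-1/2}` of a line, so that the root of its mean square is of order `Λ^{-d/4}`
(`not_supEstimate`).
-/

open Filter Topology
open scoped ENNReal

/-! ### Mollification and representatives of Sobolev functions -/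

section Mollification

variable {n : ℕ} {F : Type*} [NormedAddCommGroup F]

/-- Translations act continuously on `L²`. -/
lemma exists_forall_eLpNorm_translate_sub_le {f : EuclideanSpace ℝ (Fin n) → F}
    (hf : MemLp f 2 volume) {ε : ℝ≥0∞} (hε : 0 < ε) :
    ∃ δ > 0, ∀ t : EuclideanSpace ℝ (Fin n), ‖t‖ < δ →
      eLpNorm (fun x => f (x - t) - f x) 2 volume ≤ ε := by
  have : Fact ((2 : ℝ≥0∞) ≠ ⊤) := ⟨by norm_num⟩
  have hc : Continuous fun t : EuclideanSpace ℝ (Fin n) =>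
      (DomAddAct.mk (-t)) +ᵥ hf.toLp f := by
    have h1 : Continuous fun c : (EuclideanSpace ℝ (Fin n))ᵈᵃᵃ => c +ᵥ hf.toLp f :=
      continuous_id.vadd continuous_const
    exact h1.comp (DomAddAct.continuous_mk.comp continuous_neg)
  have h0 : (DomAddAct.mk (-(0 : EuclideanSpace ℝ (Fin n)))) +ᵥ hf.toLp f = hf.toLp f := by
    rw [neg_zero]
    exact zero_vadd _ _
  have ht := hc.tendsto 0
  rw [h0] at ht
  have := (EMetric.tendsto_nhds.1 ht) ε hε
  obtain ⟨δ, hδ, h⟩ := Metric.eventually_nhds_iff.1 this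
  refine ⟨δ, hδ, fun t ht => ?_⟩
  have h2 := (h (by simpa using ht)).le
  rw [DomAddAct.mk_vadd_toLp, Lp.edist_toLp_toLp] at h2
  refine le_trans (le_of_eq ?_) h2
  congr 1
  ext x
  simp [sub_eq_neg_add]

/-- Mollification converges in `L²`: the error is a weighted mean of translation errors. -/
lemma eLpNorm_normed_convolution_sub_le [NormedSpace ℝ F] [CompleteSpace F] [MeasurableSpace F]
    [BorelSpace F]
    {f : EuclideanSpace ℝ (Fin n) → F}
    (hfm : StronglyMeasurable f) (hf : MemLp f 2 volume)
    (ρ : ContDiffBump (0 : EuclideanSpace ℝ (Fin n))) {ε : ℝ≥0∞}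
    (h : ∀ t : EuclideanSpace ℝ (Fin n), ‖t‖ < ρ.rOut →
      eLpNorm (fun x => f (x - t) - f x) 2 volume ≤ ε) :
    eLpNorm (fun x => convolution (ρ.normed volume) f (ContinuousLinearMap.lsmul ℝ ℝ) volume x
      - f x) 2 volume ≤ ε := by
  set w : EuclideanSpace ℝ (Fin n) → ℝ≥0∞ := fun t => ENNReal.ofReal (ρ.normed volume t) with hw
  have hwm : Measurable w := ρ.continuous_normed.measurable.ennreal_ofReal
  have hw1 : ∫⁻ t, w t = 1 := by
    rw [← ofReal_integral_eq_lintegral_ofReal ρ.integrable_normed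
      (Eventually.of_forall ρ.nonneg_normed), ρ.integral_normed, ENNReal.ofReal_one]
  have hdm : StronglyMeasurable fun p : EuclideanSpace ℝ (Fin n) × EuclideanSpace ℝ (Fin n) =>
      f (p.1 - p.2) - f p.1 :=
    (hfm.comp_measurable (measurable_fst.sub measurable_snd)).sub
      (hfm.comp_measurable measurable_fst)
  -- pointwise Jensen inequality
  have hpt : ∀ x, ‖convolution (ρ.normed volume) f (ContinuousLinearMap.lsmul ℝ ℝ) volume x
      - f x‖ₑ ^ (2 : ℝ) ≤ ∫⁻ t, w t * ‖f (x - t) - f x‖ₑ ^ (2 : ℝ) := by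
    intro x
    have hdx : Measurable fun t => ‖f (x - t) - f x‖ₑ :=
      (hdm.comp_measurable (measurable_const.prodMk measurable_id)).enorm
    have hex : ConvolutionExistsAt (ρ.normed volume) f x (ContinuousLinearMap.lsmul ℝ ℝ) volume :=
      ρ.hasCompactSupport_normed.convolutionExists_left _ ρ.continuous_normed
        (hf.locallyIntegrable (by norm_num)) x
    have hex' : Integrable (fun t => ρ.normed volume t • f (x - t)) volume := hex
    have h1 : convolution (ρ.normed volume) f (ContinuousLinearMap.lsmul ℝ ℝ) volume x - f x
        = ∫ t, ρ.normed volume t • (f (x - t) - f x) := by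
      simp_rw [smul_sub]
      rw [integral_sub hex', ρ.integral_normed_smul, convolution_def]
      · rfl
      · exact ρ.integrable_normed.smul_const _
    have h2 : ‖convolution (ρ.normed volume) f (ContinuousLinearMap.lsmul ℝ ℝ) volume x - f x‖ₑ
        ≤ ∫⁻ t, w t * ‖f (x - t) - f x‖ₑ := by
      rw [h1]
      refine (enorm_integral_le_lintegral_enorm _).trans (le_of_eq ?_)
      refine lintegral_congr fun t => ?_
      rw [enorm_smul, Real.enorm_eq_ofReal (ρ.nonneg_normed t)]
    have h3 := ENNReal.lintegral_mul_le_Lp_mul_Lq volume Real.HolderConjugate.two_two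
      (f := fun t => w t ^ (1 / 2 : ℝ)) (g := fun t => w t ^ (1 / 2 : ℝ) * ‖f (x - t) - f x‖ₑ)
      (hwm.pow_const _).aemeasurable ((hwm.pow_const _).mul hdx).aemeasurable
    have h4 : ∀ t, ((fun t => w t ^ (1 / 2 : ℝ)) *
        fun t => w t ^ (1 / 2 : ℝ) * ‖f (x - t) - f x‖ₑ) t = w t * ‖f (x - t) - f x‖ₑ := by
      intro t
      simp only [Pi.mul_apply]
      rw [← mul_assoc, ← ENNReal.rpow_add_of_nonneg _ _ (by norm_num) (by norm_num)]
      norm_num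
    have h5 : ∀ t, (w t ^ (1 / 2 : ℝ)) ^ (2 : ℝ) = w t := by
      intro t
      rw [← ENNReal.rpow_mul]; norm_num
    simp_rw [h4, ENNReal.mul_rpow_of_nonneg _ _ (zero_le_two : (0 : ℝ) ≤ 2), h5, hw1] at h3
    calc _ ≤ (∫⁻ t, w t * ‖f (x - t) - f x‖ₑ) ^ (2 : ℝ) :=
          ENNReal.rpow_le_rpow h2 (by norm_num)
      _ ≤ _ := by
          refine (ENNReal.rpow_le_rpow h3 (by norm_num)).trans (le_of_eq ?_)
          rw [ENNReal.one_rpow, one_mul, ← ENNReal.rpow_mul]; norm_num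
  have hE : ∀ g : EuclideanSpace ℝ (Fin n) → F,
      eLpNorm g 2 volume = (∫⁻ x, ‖g x‖ₑ ^ (2 : ℝ)) ^ (1 / 2 : ℝ) := by
    intro g
    rw [eLpNorm_eq_lintegral_rpow_enorm_toReal (by norm_num) (by norm_num)]
    norm_num
  rw [hE]
  have hsq : ∀ t, ‖t‖ < ρ.rOut → ∫⁻ x, ‖f (x - t) - f x‖ₑ ^ (2 : ℝ) ≤ ε ^ (2 : ℝ) := by
    intro t ht
    have := ENNReal.rpow_le_rpow (h t ht) (zero_le_two : (0 : ℝ) ≤ 2)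
    rw [hE, ← ENNReal.rpow_mul] at this
    norm_num at this ⊢
    exact this
  calc _ ≤ (∫⁻ x, ∫⁻ t, w t * ‖f (x - t) - f x‖ₑ ^ (2 : ℝ)) ^ (1 / 2 : ℝ) := by
        gcongr with x; exact hpt x
    _ = (∫⁻ t, ∫⁻ x, w t * ‖f (x - t) - f x‖ₑ ^ (2 : ℝ)) ^ (1 / 2 : ℝ) := by
        rw [lintegral_lintegral_swap]
        exact ((hwm.comp measurable_snd).mul (hdm.enorm.pow_const _)).aemeasurable
    _ ≤ (∫⁻ t, w t * ε ^ (2 : ℝ)) ^ (1 / 2 : ℝ) := by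
        gcongr with t
        rw [lintegral_const_mul]
        · by_cases ht : ‖t‖ < ρ.rOut
          · gcongr
            exact hsq t ht
          · have : w t = 0 := by
              have : t ∉ Function.support (ρ.normed volume) := by
                rw [ρ.support_normed_eq]; simpa using ht
              simp only [Function.mem_support, not_not] at this
              simp [hw, this]
            simp [this]
        · exact (hdm.comp_measurable (measurable_id.prodMk measurable_const)).enorm.pow_const _
    _ = ε := by
        rw [lintegral_mul_const _ hwm, hw1, one_mul, ← ENNReal.rpow_mul]; norm_num

end Mollification

section WeakGradient

variable {n : ℕ}

/-- The weak gradient commutes with mollification at points far from the boundary. -/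
lemma gradient_normed_convolution {U : Set (EuclideanSpace ℝ (Fin n))}
    {V : EuclideanSpace ℝ (Fin n) → ℝ}
    {DV : EuclideanSpace ℝ (Fin n) → EuclideanSpace ℝ (Fin n)}
    (hV : HasW12Gradient U V DV)
    (hVm : MemLp V 2 volume) (hDVm : MemLp DV 2 volume)
    (hV0 : ∀ x ∉ U, V x = 0) (hDV0 : ∀ x ∉ U, DV x = 0)
    (ρ : ContDiffBump (0 : EuclideanSpace ℝ (Fin n))) {x : EuclideanSpace ℝ (Fin n)}
    (hx : Metric.closedBall x ρ.rOut ⊆ U) :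
    gradient (convolution (ρ.normed volume) V (ContinuousLinearMap.lsmul ℝ ℝ) volume) x
      = convolution (ρ.normed volume) DV (ContinuousLinearMap.lsmul ℝ ℝ) volume x := by
  have hloc : LocallyIntegrable V volume := hVm.locallyIntegrable (by norm_num)
  have hlocD : LocallyIntegrable DV volume := hDVm.locallyIntegrable (by norm_num)
  have hcsρ : HasCompactSupport (ρ.normed volume) := ρ.hasCompactSupport_normed
  have hd := hcsρ.hasFDerivAt_convolution_left (μ := volume) (𝕜 := ℝ)
    (ContinuousLinearMap.lsmul ℝ ℝ) (ρ.contDiff_normed (n := 1)) hloc x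
  have hexD : ConvolutionExistsAt (ρ.normed volume) DV x (ContinuousLinearMap.lsmul ℝ ℝ) volume :=
    ρ.hasCompactSupport_normed.convolutionExists_left _ ρ.continuous_normed hlocD x
  have hcs : HasCompactSupport (fderiv ℝ (ρ.normed volume)) :=
    ρ.hasCompactSupport_normed.fderiv ℝ
  have hex : ConvolutionExistsAt (fderiv ℝ (ρ.normed volume)) V x
      (ContinuousLinearMap.precompL (EuclideanSpace ℝ (Fin n))
        (ContinuousLinearMap.lsmul ℝ ℝ)) volume :=
    hcs.convolutionExists_left _
      ((ρ.contDiff_normed (n := 1)).continuous_fderiv (by norm_num)) hloc x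
  -- the test function
  set φ : EuclideanSpace ℝ (Fin n) → ℝ := fun y => ρ.normed volume (x - y) with hφ
  have hφs : ContDiff ℝ ∞ φ := (ρ.contDiff_normed (n := ⊤)).comp (contDiff_const.sub contDiff_id)
  have hφt : tsupport φ ⊆ Metric.closedBall x ρ.rOut := by
    refine closure_minimal (fun y hy => ?_) Metric.isClosed_closedBall
    have : x - y ∈ Function.support (ρ.normed volume) := hy
    rw [ρ.support_normed_eq] at this
    simp only [Metric.mem_ball, dist_zero_right] at this
    rw [Metric.mem_closedBall, dist_comm, dist_eq_norm]; exact this.le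
  have hφc : HasCompactSupport φ :=
    HasCompactSupport.of_support_subset_isCompact (isCompact_closedBall x ρ.rOut)
      (subset_closure.trans hφt)
  have hφd : ∀ y e, fderiv ℝ φ y e = - fderiv ℝ (ρ.normed volume) (x - y) e := by
    intro y e
    have h1 : HasFDerivAt (ρ.normed volume) (fderiv ℝ (ρ.normed volume) (x - y)) (x - y) :=
      ((ρ.contDiff_normed (n := 1)).differentiable (by norm_num) _).hasFDerivAt
    have h2 : HasFDerivAt (fun y => x - y)
        (-ContinuousLinearMap.id ℝ (EuclideanSpace ℝ (Fin n))) y :=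
      (hasFDerivAt_id y).const_sub x
    have h3 : HasFDerivAt φ _ y := h1.comp y h2
    rw [h3.fderiv]
    simp
  refine hasFDerivAt_iff_hasGradientAt.1 hd |>.gradient.trans ?_
  ext i
  have hi : ∀ z : EuclideanSpace ℝ (Fin n), z i = inner ℝ (EuclideanSpace.single i (1 : ℝ)) z := by
    intro z; simp [EuclideanSpace.inner_single_left]
  rw [hi, real_inner_comm, InnerProductSpace.toDual_symm_apply]
  have hw := hV.integral_eq φ hφs hφc (hφt.trans hx) i
  have e1 : ∫ y in U, V y * fderiv ℝ φ y (EuclideanSpace.single i 1)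
      = ∫ y, V y * fderiv ℝ φ y (EuclideanSpace.single i 1) :=
    setIntegral_eq_integral_of_forall_compl_eq_zero fun y hy => by rw [hV0 y hy, zero_mul]
  have e2 : ∫ y in U, DV y i * φ y = ∫ y, DV y i * φ y :=
    setIntegral_eq_integral_of_forall_compl_eq_zero fun y hy => by rw [hDV0 y hy]; simp
  rw [e1, e2] at hw
  have e3 : (convolution (fderiv ℝ (ρ.normed volume)) V
      (ContinuousLinearMap.precompL (EuclideanSpace ℝ (Fin n))
        (ContinuousLinearMap.lsmul ℝ ℝ)) volume x) (EuclideanSpace.single i 1)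
      = - ∫ y, V y * fderiv ℝ φ y (EuclideanSpace.single i 1) := by
    rw [convolution_def, ContinuousLinearMap.integral_apply hex, ← integral_neg,
      ← integral_sub_left_eq_self _ volume x]
    refine integral_congr_ae (Eventually.of_forall fun y => ?_)
    simp only [hφd, ContinuousLinearMap.precompL_apply, ContinuousLinearMap.lsmul_apply,
      sub_sub_cancel, smul_eq_mul]
    ring
  rw [e3, hw, neg_neg]
  have e4 : (convolution (ρ.normed volume) DV (ContinuousLinearMap.lsmul ℝ ℝ) volume x) i
      = ∫ t, ρ.normed volume t * DV (x - t) i := by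
    rw [convolution_def]
    have := ContinuousLinearMap.integral_comp_comm
      (EuclideanSpace.proj i : EuclideanSpace ℝ (Fin n) →L[ℝ] ℝ) hexD
    simpa using this.symm
  rw [e4, ← integral_sub_left_eq_self _ volume x]
  refine integral_congr_ae (Eventually.of_forall fun y => ?_)
  simp [hφ, mul_comm]

/-- A Sobolev function and its weak gradient may be changed on a null set and outside `U` so that
both become measurable and square integrable on the whole space. -/
lemma HasW12Gradient.exists_stronglyMeasurable {U : Set (EuclideanSpace ℝ (Fin n))}
    {v : EuclideanSpace ℝ (Fin n) → ℝ}
    {Dv : EuclideanSpace ℝ (Fin n) → EuclideanSpace ℝ (Fin n)}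
    (h : HasW12Gradient U v Dv) (hU : MeasurableSet U) :
    ∃ V DV, StronglyMeasurable V ∧ StronglyMeasurable DV ∧ MemLp V 2 volume ∧
      MemLp DV 2 volume ∧ (∀ x ∉ U, V x = 0) ∧ (∀ x ∉ U, DV x = 0) ∧
      v =ᵐ[volume.restrict U] V ∧ Dv =ᵐ[volume.restrict U] DV ∧ HasW12Gradient U V DV := by
  have hv := h.memLp.1
  have hD := h.memLp_grad.1
  have e1 : v =ᵐ[volume.restrict U] U.indicator (hv.mk v) := by
    filter_upwards [hv.ae_eq_mk, ae_restrict_mem hU] with x hx hxU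
    rw [Set.indicator_of_mem hxU, hx]
  have e2 : Dv =ᵐ[volume.restrict U] U.indicator (hD.mk Dv) := by
    filter_upwards [hD.ae_eq_mk, ae_restrict_mem hU] with x hx hxU
    rw [Set.indicator_of_mem hxU, hx]
  refine ⟨U.indicator (hv.mk v), U.indicator (hD.mk Dv),
    hv.stronglyMeasurable_mk.indicator hU, hD.stronglyMeasurable_mk.indicator hU, ?_, ?_,
    fun x hx => Set.indicator_of_notMem hx _, fun x hx => Set.indicator_of_notMem hx _, e1, e2,
    ⟨(memLp_congr_ae e1).1 h.memLp, (memLp_congr_ae e2).1 h.memLp_grad, ?_⟩⟩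
  · rw [memLp_indicator_iff_restrict hU]
    exact (memLp_congr_ae hv.ae_eq_mk).1 h.memLp
  · rw [memLp_indicator_iff_restrict hU]
    exact (memLp_congr_ae hD.ae_eq_mk).1 h.memLp_grad
  · intro φ h1 h2 h3 i
    have := h.integral_eq φ h1 h2 h3 i
    rw [integral_congr_ae (g := fun x => U.indicator (hv.mk v) x *
      fderiv ℝ φ x (EuclideanSpace.single i 1)), integral_congr_ae (f := fun x => Dv x i * φ x)
      (g := fun x => U.indicator (hD.mk Dv) x i * φ x)] at this
    · exact this
    · filter_upwards [e2] with x hx; rw [hx]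
    · filter_upwards [e1] with x hx; rw [hx]

end WeakGradient

/-! ### Truncations of Sobolev functions as limits of test functions -/

section

/-- Dominated convergence in `L²`. -/
lemma tendsto_eLpNorm_two_zero_of_dominated {α F F' : Type*} [MeasurableSpace α] {μ : Measure α}
    [NormedAddCommGroup F] [NormedAddCommGroup F'] {f : ℕ → α → F} {b : α → F'}
    (hb : MemLp b 2 μ) (hf : ∀ j, AEStronglyMeasurable (f j) μ)
    (hfb : ∀ j, ∀ᵐ x ∂μ, ‖f j x‖ ≤ ‖b x‖)
    (hlim : ∀ᵐ x ∂μ, Tendsto (fun j => f j x) atTop (𝓝 0)) :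
    Tendsto (fun j => eLpNorm (f j) 2 μ) atTop (𝓝 0) := by
  have hE : ∀ j, eLpNorm (f j) 2 μ = (∫⁻ x, ‖f j x‖ₑ ^ (2 : ℝ) ∂μ) ^ (1 / 2 : ℝ) := by
    intro j
    rw [eLpNorm_eq_lintegral_rpow_enorm_toReal (by norm_num) (by norm_num)]
    norm_num
  simp_rw [hE]
  have h0 : Tendsto (fun j => ∫⁻ x, ‖f j x‖ₑ ^ (2 : ℝ) ∂μ) atTop (𝓝 (∫⁻ x, 0 ∂μ)) := by
    refine tendsto_lintegral_of_dominated_convergence' (fun x => ‖b x‖ₑ ^ (2 : ℝ))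
      (fun j => (hf j).enorm.pow_const _) (fun j => ?_) ?_ ?_
    · filter_upwards [hfb j] with x hx
      exact ENNReal.rpow_le_rpow (enorm_le_iff_norm_le.2 hx) (by norm_num)
    · have := lintegral_rpow_enorm_lt_top_of_eLpNorm_lt_top (by norm_num) (by norm_num) hb.2
      simpa using this.ne
    · filter_upwards [hlim] with x hx
      have h1 : Tendsto (fun j => ‖f j x‖ₑ) atTop (𝓝 0) := by
        simpa using hx.enorm
      have := (ENNReal.continuous_rpow_const (y := (2 : ℝ))).tendsto 0 |>.comp h1
      simpa [Function.comp_def] using this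
  have := (ENNReal.continuous_rpow_const (y := (1 / 2 : ℝ))).tendsto _ |>.comp h0
  simpa [Function.comp_def] using this

variable {n : ℕ}

/-- `(u, Du)` is a limit in `L² × L²` of pairs `(φ, ∇φ)` with `φ ≥ 0` of class `C¹` and compactly
supported in `U`. These are the nonnegative members of `W₀^{1,2}(U)`, extended by zero. -/
def IsW12Limit (U : Set (EuclideanSpace ℝ (Fin n))) (u : EuclideanSpace ℝ (Fin n) → ℝ)
    (Du : EuclideanSpace ℝ (Fin n) → EuclideanSpace ℝ (Fin n)) : Prop :=
  ∀ ε : ℝ≥0∞, 0 < ε → ∃ φ : EuclideanSpace ℝ (Fin n) → ℝ,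
    ContDiff ℝ 1 φ ∧ HasCompactSupport φ ∧ tsupport φ ⊆ U ∧ (∀ x, 0 ≤ φ x) ∧
      eLpNorm (fun x => φ x - u x) 2 volume ≤ ε ∧
      eLpNorm (fun x => gradient φ x - Du x) 2 volume ≤ ε

lemma continuous_gradient {φ : EuclideanSpace ℝ (Fin n) → ℝ} (hφ : ContDiff ℝ 1 φ) :
    Continuous (gradient φ) :=
  (InnerProductSpace.toDual ℝ _).symm.continuous.comp (hφ.continuous_fderiv (by norm_num))

lemma norm_gradient_eq (φ : EuclideanSpace ℝ (Fin n) → ℝ) (x : EuclideanSpace ℝ (Fin n)) :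
    ‖gradient φ x‖ = ‖fderiv ℝ φ x‖ := by
  simp [gradient]

lemma hasCompactSupport_gradient {φ : EuclideanSpace ℝ (Fin n) → ℝ} (hφ : HasCompactSupport φ) :
    HasCompactSupport (gradient φ) :=
  (hφ.fderiv ℝ).comp_left (g := (InnerProductSpace.toDual ℝ _).symm) (map_zero _)

lemma isW12Limit_of_contDiff {U : Set (EuclideanSpace ℝ (Fin n))}
    {φ : EuclideanSpace ℝ (Fin n) → ℝ} (h1 : ContDiff ℝ 1 φ) (h2 : HasCompactSupport φ)
    (h3 : tsupport φ ⊆ U) (h4 : ∀ x, 0 ≤ φ x) : IsW12Limit U φ (gradient φ) :=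
  fun ε _ => ⟨φ, h1, h2, h3, h4, by simp, by simp⟩

lemma IsW12Limit.of_tendsto {U : Set (EuclideanSpace ℝ (Fin n))}
    {uj : ℕ → EuclideanSpace ℝ (Fin n) → ℝ}
    {Dj : ℕ → EuclideanSpace ℝ (Fin n) → EuclideanSpace ℝ (Fin n)}
    {u : EuclideanSpace ℝ (Fin n) → ℝ}
    {Du : EuclideanSpace ℝ (Fin n) → EuclideanSpace ℝ (Fin n)}
    (h : ∀ᶠ j in atTop, IsW12Limit U (uj j) (Dj j))
    (hum : AEStronglyMeasurable u volume) (hDm : AEStronglyMeasurable Du volume)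
    (hujm : ∀ j, AEStronglyMeasurable (uj j) volume)
    (hDjm : ∀ j, AEStronglyMeasurable (Dj j) volume)
    (hu : Tendsto (fun j => eLpNorm (fun x => uj j x - u x) 2 volume) atTop (𝓝 0))
    (hD : Tendsto (fun j => eLpNorm (fun x => Dj j x - Du x) 2 volume) atTop (𝓝 0)) :
    IsW12Limit U u Du := by
  intro ε hε
  have hε2 : 0 < ε / 2 := ENNReal.half_pos hε.ne'
  obtain ⟨j, hj, hj1, hj2⟩ := (h.and ((hu.eventually_le_const hε2).and
    (hD.eventually_le_const hε2))).exists
  obtain ⟨φ, h1, h2, h3, h4, h5, h6⟩ := hj (ε / 2) hε2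
  refine ⟨φ, h1, h2, h3, h4, ?_, ?_⟩
  · have : (fun x => φ x - u x) = (fun x => φ x - uj j x) + fun x => uj j x - u x := by
      ext x; simp
    rw [this]
    refine (eLpNorm_add_le (h1.continuous.aestronglyMeasurable.sub (hujm j))
      ((hujm j).sub hum) (by norm_num)).trans ?_
    exact (add_le_add h5 hj1).trans (ENNReal.add_halves ε).le
  · have : (fun x => gradient φ x - Du x)
        = (fun x => gradient φ x - Dj j x) + fun x => Dj j x - Du x := by
      ext x; simp
    rw [this]
    refine (eLpNorm_add_le ((continuous_gradient h1).aestronglyMeasurable.sub (hDjm j))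
      ((hDjm j).sub hDm) (by norm_num)).trans ?_
    exact (add_le_add h6 hj2).trans (ENNReal.add_halves ε).le

/-- A sequence of mollifiers whose supports shrink to the origin. -/
noncomputable def mollifier (n j : ℕ) : ContDiffBump (0 : EuclideanSpace ℝ (Fin n)) where
  rIn := ((j : ℝ) + 1)⁻¹ / 2
  rOut := ((j : ℝ) + 1)⁻¹
  rIn_pos := by positivity
  rIn_lt_rOut := by
    have : (0 : ℝ) < ((j : ℝ) + 1)⁻¹ := by positivity
    linarith

lemma tendsto_mollifier_rOut : Tendsto (fun j => (mollifier n j).rOut) atTop (𝓝 0) := by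
  simpa [mollifier, one_div] using tendsto_one_div_add_atTop_nhds_zero_nat (𝕜 := ℝ)

/-- The convolution of `f` with the `j`-th mollifier. -/
noncomputable def mollify {F : Type*} [NormedAddCommGroup F] [NormedSpace ℝ F] (j : ℕ)
    (f : EuclideanSpace ℝ (Fin n) → F) : EuclideanSpace ℝ (Fin n) → F :=
  convolution ((mollifier n j).normed volume) f (ContinuousLinearMap.lsmul ℝ ℝ) volume

section

variable {F : Type*} [NormedAddCommGroup F] [NormedSpace ℝ F]
  {f : EuclideanSpace ℝ (Fin n) → F}

lemma contDiff_mollify (hf : MemLp f 2 volume) (j : ℕ) : ContDiff ℝ 1 (mollify j f) := by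
  have hcs : HasCompactSupport ((mollifier n j).normed volume) :=
    (mollifier n j).hasCompactSupport_normed
  exact hcs.contDiff_convolution_left (n := 1) _ ((mollifier n j).contDiff_normed (n := 1))
    (hf.locallyIntegrable (by norm_num))

variable [CompleteSpace F]

lemma tendsto_eLpNorm_mollify_sub [MeasurableSpace F] [BorelSpace F]
    (hfm : StronglyMeasurable f) (hf : MemLp f 2 volume) :
    Tendsto (fun j => eLpNorm (fun x => mollify j f x - f x) 2 volume) atTop (𝓝 0) := by
  rw [ENNReal.tendsto_nhds_zero]
  intro ε hε
  obtain ⟨δ, hδ, h⟩ := exists_forall_eLpNorm_translate_sub_le hf hε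
  filter_upwards [tendsto_mollifier_rOut.eventually_lt_const hδ] with j hj
  exact eLpNorm_normed_convolution_sub_le hfm hf _ fun t ht => h t (ht.trans hj)

lemma ae_tendsto_mollify (hf : MemLp f 2 volume) :
    ∀ᵐ x, Tendsto (fun j => mollify j f x) atTop (𝓝 (f x)) := by
  refine ContDiffBump.ae_convolution_tendsto_right_of_locallyIntegrable (K := 2)
    tendsto_mollifier_rOut (Eventually.of_forall fun j => ?_) (hf.locallyIntegrable (by norm_num))
  simp only [mollifier]
  linarith

end

/-- The gradient of `η · (G ∘ w)`. -/
lemma gradient_mul_comp {η w : EuclideanSpace ℝ (Fin n) → ℝ} {G g : ℝ → ℝ}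
    (hη : ContDiff ℝ 1 η) (hw : ContDiff ℝ 1 w) (hG : ∀ s, HasDerivAt G (g s) s)
    (x : EuclideanSpace ℝ (Fin n)) :
    gradient (fun x => η x * G (w x)) x
      = G (w x) • gradient η x + (η x * g (w x)) • gradient w x := by
  have h1 : HasFDerivAt η (fderiv ℝ η x) x :=
    (hη.differentiable (by norm_num) x).hasFDerivAt
  have h2 : HasFDerivAt w (fderiv ℝ w x) x :=
    (hw.differentiable (by norm_num) x).hasFDerivAt
  have h3 := h1.mul ((hG (w x)).comp_hasFDerivAt x h2)
  have h4 : HasFDerivAt (fun x => η x * G (w x))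
    (η x • g (w x) • fderiv ℝ w x + G (w x) • fderiv ℝ η x) x := h3
  rw [gradient, h4.fderiv]
  simp [gradient, smul_smul, add_comm]

lemma abs_sub_le_of_hasDerivAt {G g : ℝ → ℝ} (hG : ∀ s, HasDerivAt G (g s) s)
    (hg : ∀ s, |g s| ≤ 1) (a b : ℝ) : |G a - G b| ≤ |a - b| := by
  have := Convex.norm_image_sub_le_of_norm_hasDerivWithin_le (s := Set.univ) (C := 1)
    (fun s _ => (hG s).hasDerivWithinAt) (fun s _ => by simpa using hg s) convex_univ
    (Set.mem_univ b) (Set.mem_univ a)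
  simpa using this

/-- Chain rule: `η · G(V)` belongs to `W₀^{1,2}(U)` when `G` is `C¹` with bounded derivative. -/
lemma isW12Limit_mul_comp {U : Set (EuclideanSpace ℝ (Fin n))} (hU : IsOpen U)
    {V : EuclideanSpace ℝ (Fin n) → ℝ}
    {DV : EuclideanSpace ℝ (Fin n) → EuclideanSpace ℝ (Fin n)}
    (hV : HasW12Gradient U V DV)
    (hVs : StronglyMeasurable V) (hDVs : StronglyMeasurable DV)
    (hVm : MemLp V 2 volume) (hDVm : MemLp DV 2 volume)
    (hV0 : ∀ x ∉ U, V x = 0) (hDV0 : ∀ x ∉ U, DV x = 0)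
    {η : EuclideanSpace ℝ (Fin n) → ℝ} (hη : ContDiff ℝ 1 η) (hηc : HasCompactSupport η)
    (hηU : tsupport η ⊆ U) (hη0 : ∀ x, 0 ≤ η x)
    {G g : ℝ → ℝ} (hG : ∀ s, HasDerivAt G (g s) s) (hgc : Continuous g) (hg : ∀ s, |g s| ≤ 1)
    (hG0 : ∀ s, 0 ≤ G s) :
    IsW12Limit U (fun x => η x * G (V x))
      (fun x => G (V x) • gradient η x + (η x * g (V x)) • DV x) := by
  obtain ⟨C, hC⟩ : ∃ C, ∀ x, ‖η x‖ ≤ C := hηc.exists_bound_of_continuous hη.continuous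
  obtain ⟨C', hC'⟩ : ∃ C, ∀ x, ‖gradient η x‖ ≤ C :=
    (hasCompactSupport_gradient hηc).exists_bound_of_continuous (continuous_gradient hη)
  have hC0 : 0 ≤ C := (norm_nonneg _).trans (hC 0)
  have hC'0 : 0 ≤ C' := (norm_nonneg _).trans (hC' 0)
  have hGd : ContDiff ℝ 1 G := by
    rw [contDiff_one_iff_deriv]
    refine ⟨fun s => (hG s).differentiableAt, ?_⟩
    rwa [show deriv G = g from funext fun s => (hG s).deriv]
  have hηs : AEStronglyMeasurable η volume := hη.continuous.aestronglyMeasurable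
  have hgηs : AEStronglyMeasurable (gradient η) volume :=
    (continuous_gradient hη).aestronglyMeasurable
  have hmV : ∀ j, Continuous (mollify j V) := fun j => (contDiff_mollify hVm j).continuous
  have hmD : ∀ j, Continuous (mollify j DV) := fun j => (contDiff_mollify hDVm j).continuous
  have hVt := tendsto_eLpNorm_mollify_sub hVs hVm
  have hDt := tendsto_eLpNorm_mollify_sub hDVs hDVm
  -- near the support of `η` the gradient of the mollification is the mollified gradient
  have hgrad : ∀ᶠ j in atTop, ∀ x ∈ tsupport η, gradient (mollify j V) x = mollify j DV x := by
    obtain ⟨δ, hδ, h⟩ := hηc.isCompact.exists_cthickening_subset_open hU hηU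
    filter_upwards [tendsto_mollifier_rOut.eventually_lt_const hδ] with j hj x hx
    refine gradient_normed_convolution hV hVm hDVm hV0 hDV0 _ fun y hy => h ?_
    exact Metric.closedBall_subset_cthickening hx δ
      (Metric.closedBall_subset_closedBall hj.le hy)
  refine IsW12Limit.of_tendsto (uj := fun j x => η x * G (mollify j V x))
    (Dj := fun j x => G (mollify j V x) • gradient η x + (η x * g (mollify j V x)) • mollify j DV x)
    ?_ ?_ ?_ ?_ ?_ ?_ ?_
  · filter_upwards [hgrad] with j hj
    have hc1 : ContDiff ℝ 1 (fun x => η x * G (mollify j V x)) :=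
      hη.mul (hGd.comp (contDiff_mollify hVm j))
    have hsup : tsupport (fun x => η x * G (mollify j V x)) ⊆ tsupport η :=
      tsupport_mul_subset_left
    have := isW12Limit_of_contDiff (U := U) hc1 hηc.mul_right (hsup.trans hηU)
      fun x => mul_nonneg (hη0 x) (hG0 _)
    convert this using 2 with x
    rw [gradient_mul_comp hη (contDiff_mollify hVm j) hG]
    by_cases hx : x ∈ tsupport η
    · rw [hj x hx]
    · rw [image_eq_zero_of_notMem_tsupport hx]; simp
  · exact hηs.mul (hGd.continuous.comp_aestronglyMeasurable hVs.aestronglyMeasurable)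
  · exact ((hGd.continuous.comp_aestronglyMeasurable hVs.aestronglyMeasurable).smul hgηs).add
      ((hηs.mul (hgc.comp_aestronglyMeasurable hVs.aestronglyMeasurable)).smul
        hDVs.aestronglyMeasurable)
  · exact fun j => (hη.continuous.mul (hGd.continuous.comp (hmV j))).aestronglyMeasurable
  · exact fun j => (((hGd.continuous.comp (hmV j)).smul (continuous_gradient hη)).add
      ((hη.continuous.mul (hgc.comp (hmV j))).smul (hmD j))).aestronglyMeasurable
  · have hle : ∀ j, eLpNorm (fun x => η x * G (mollify j V x) - η x * G (V x)) 2 volume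
        ≤ ENNReal.ofReal C * eLpNorm (fun x => mollify j V x - V x) 2 volume := by
      intro j
      refine eLpNorm_le_mul_eLpNorm_of_ae_le_mul (Eventually.of_forall fun x => ?_) _
      rw [← mul_sub, norm_mul]
      exact mul_le_mul (hC x) (abs_sub_le_of_hasDerivAt hG hg _ _) (norm_nonneg _) hC0
    refine tendsto_of_tendsto_of_tendsto_of_le_of_le tendsto_const_nhds ?_ (fun _ => zero_le) hle
    simpa using ENNReal.Tendsto.const_mul hVt (Or.inr ENNReal.ofReal_ne_top)
  · set T : ℕ → EuclideanSpace ℝ (Fin n) → EuclideanSpace ℝ (Fin n) := fun j x =>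
      (η x * (g (mollify j V x) - g (V x))) • DV x with hT
    have hTm : ∀ j, AEStronglyMeasurable (T j) volume := fun j =>
      ((hηs.mul ((hgc.comp (hmV j)).aestronglyMeasurable.sub
        (hgc.comp_aestronglyMeasurable hVs.aestronglyMeasurable))).smul
        hDVs.aestronglyMeasurable)
    have hT0 : Tendsto (fun j => eLpNorm (T j) 2 volume) atTop (𝓝 0) := by
      refine tendsto_eLpNorm_two_zero_of_dominated (b := fun x => (C * 2) • DV x)
        (hDVm.const_smul (C * 2)) hTm (fun j => Eventually.of_forall fun x => ?_) ?_
      · simp only [hT, norm_smul, norm_mul]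
        gcongr
        · exact (hC x).trans (le_abs_self C)
        · refine (norm_sub_le _ _).trans ?_
          have h1 := hg (mollify j V x)
          have h2 := hg (V x)
          simp only [Real.norm_eq_abs] at *
          rw [abs_two]; linarith
      · filter_upwards [ae_tendsto_mollify hVm] with x hx
        have h1 : Tendsto (fun j => g (mollify j V x) - g (V x)) atTop (𝓝 (g (V x) - g (V x))) :=
          ((hgc.tendsto _).comp hx).sub tendsto_const_nhds
        rw [sub_self] at h1
        have h2 := (h1.const_mul (η x)).smul_const (DV x)
        simpa using h2
    have hle : ∀ j, eLpNorm (fun x => G (mollify j V x) • gradient η x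
          + (η x * g (mollify j V x)) • mollify j DV x
          - (G (V x) • gradient η x + (η x * g (V x)) • DV x)) 2 volume
        ≤ (ENNReal.ofReal C' * eLpNorm (fun x => mollify j V x - V x) 2 volume
          + ENNReal.ofReal C * eLpNorm (fun x => mollify j DV x - DV x) 2 volume)
          + eLpNorm (T j) 2 volume := by
      intro j
      have hsplit : (fun x => G (mollify j V x) • gradient η x
          + (η x * g (mollify j V x)) • mollify j DV x
          - (G (V x) • gradient η x + (η x * g (V x)) • DV x))
          = ((fun x => (G (mollify j V x) - G (V x)) • gradient η x)
            + fun x => (η x * g (mollify j V x)) • (mollify j DV x - DV x)) + T j := by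
        ext1 x
        simp only [hT, Pi.add_apply]
        module
      have m1 : AEStronglyMeasurable
          (fun x => (G (mollify j V x) - G (V x)) • gradient η x) volume :=
        (((hGd.continuous.comp (hmV j)).aestronglyMeasurable.sub
          (hGd.continuous.comp_aestronglyMeasurable hVs.aestronglyMeasurable)).smul hgηs)
      have m2 : AEStronglyMeasurable
          (fun x => (η x * g (mollify j V x)) • (mollify j DV x - DV x)) volume :=
        ((hηs.mul (hgc.comp (hmV j)).aestronglyMeasurable).smul
          ((hmD j).aestronglyMeasurable.sub hDVs.aestronglyMeasurable))
      rw [hsplit]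
      refine (eLpNorm_add_le (m1.add m2) (hTm j) (by norm_num)).trans ?_
      gcongr
      refine (eLpNorm_add_le m1 m2 (by norm_num)).trans ?_
      gcongr
      · refine eLpNorm_le_mul_eLpNorm_of_ae_le_mul (Eventually.of_forall fun x => ?_) _
        rw [norm_smul, mul_comm]
        exact mul_le_mul (hC' x) (abs_sub_le_of_hasDerivAt hG hg _ _) (norm_nonneg _) hC'0
      · refine eLpNorm_le_mul_eLpNorm_of_ae_le_mul (Eventually.of_forall fun x => ?_) _
        rw [norm_smul, norm_mul]
        refine mul_le_mul_of_nonneg_right ?_ (norm_nonneg _)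
        calc ‖η x‖ * ‖g (mollify j V x)‖ ≤ C * 1 :=
              mul_le_mul (hC x) (hg _) (norm_nonneg _) hC0
          _ = C := mul_one C
    refine tendsto_of_tendsto_of_tendsto_of_le_of_le tendsto_const_nhds ?_ (fun _ => zero_le) hle
    have := ((ENNReal.Tendsto.const_mul (a := ENNReal.ofReal C') hVt
      (Or.inr ENNReal.ofReal_ne_top)).add
      (ENNReal.Tendsto.const_mul (a := ENNReal.ofReal C) hDt
      (Or.inr ENNReal.ofReal_ne_top))).add hT0
    simpa using this

/-- Composing a function that vanishes to first order at `0` with the positive part is harmless. -/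
lemma hasDerivAt_comp_posPart {F F' : ℝ → ℝ} (hF : ∀ s, HasDerivAt F (F' s) s) (hF0 : F 0 = 0)
    (hF'0 : F' 0 = 0) (k s : ℝ) :
    HasDerivAt (fun s => F (max (s - k) 0)) (F' (max (s - k) 0)) s := by
  rcases lt_trichotomy s k with h | h | h
  · have he : (fun s => F (max (s - k) 0)) =ᶠ[𝓝 s] fun _ => 0 := by
      filter_upwards [eventually_lt_nhds h] with t ht
      rw [max_eq_right (by linarith), hF0]
    rw [max_eq_right (by linarith), hF'0]
    exact (hasDerivAt_const s (0 : ℝ)).congr_of_eventuallyEq he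
  · subst h
    have h0 := hF 0
    rw [hF'0, hasDerivAt_iff_isLittleO_nhds_zero] at h0
    simp only [hF0, zero_add, sub_zero, smul_zero] at h0
    simp only [sub_self, max_self, hF'0]
    rw [hasDerivAt_iff_isLittleO_nhds_zero]
    simp only [add_sub_cancel_left, sub_self, max_self, hF0, sub_zero, smul_zero]
    have hc : Tendsto (fun t : ℝ => max t 0) (𝓝 0) (𝓝 0) := by
      have : Continuous fun t : ℝ => max t 0 := by fun_prop
      simpa using this.tendsto 0
    refine (h0.comp_tendsto hc).trans_isBigO ?_
    refine Asymptotics.IsBigO.of_bound 1 (Eventually.of_forall fun t => ?_)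
    simp only [Function.comp_apply, Real.norm_eq_abs, one_mul]
    rw [abs_of_nonneg (le_max_right t 0)]
    exact max_le (le_abs_self t) (abs_nonneg t)
  · have he : (fun s => F (max (s - k) 0)) =ᶠ[𝓝 s] fun s => F (s - k) := by
      filter_upwards [eventually_gt_nhds h] with t ht
      rw [max_eq_left (by linarith)]
    rw [max_eq_left (by linarith)]
    exact ((hF (s - k)).comp_sub_const s k).congr_of_eventuallyEq he

lemma hasDerivAt_sqrt_sq_add_sub {ε : ℝ} (hε : 0 < ε) (s : ℝ) :
    HasDerivAt (fun s => √(s ^ 2 + ε ^ 2) - ε) (s / √(s ^ 2 + ε ^ 2)) s := by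
  have h1 : HasDerivAt (fun s : ℝ => s ^ 2 + ε ^ 2) (2 * s) s := by
    simpa using (hasDerivAt_pow 2 s).add_const (ε ^ 2)
  have h2 := (h1.sqrt (by positivity)).sub_const ε
  rwa [mul_div_mul_left _ _ two_ne_zero] at h2

/-- Chain rule for truncations: `η · (V - k)₊` belongs to `W₀^{1,2}(U)`, with gradient
`(V - k)₊ ∇η + η 1_{V > k} DV`. -/
lemma isW12Limit_mul_posPart {U : Set (EuclideanSpace ℝ (Fin n))} (hU : IsOpen U)
    {V : EuclideanSpace ℝ (Fin n) → ℝ}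
    {DV : EuclideanSpace ℝ (Fin n) → EuclideanSpace ℝ (Fin n)}
    (hV : HasW12Gradient U V DV)
    (hVs : StronglyMeasurable V) (hDVs : StronglyMeasurable DV)
    (hVm : MemLp V 2 volume) (hDVm : MemLp DV 2 volume)
    (hV0 : ∀ x ∉ U, V x = 0) (hDV0 : ∀ x ∉ U, DV x = 0)
    {η : EuclideanSpace ℝ (Fin n) → ℝ} (hη : ContDiff ℝ 1 η) (hηc : HasCompactSupport η)
    (hηU : tsupport η ⊆ U) (hη0 : ∀ x, 0 ≤ η x) {k : ℝ} (hk : 0 ≤ k) :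
    IsW12Limit U (fun x => η x * max (V x - k) 0)
      (fun x => max (V x - k) 0 • gradient η x + η x • {x | k < V x}.indicator DV x) := by
  obtain ⟨C, hC⟩ : ∃ C, ∀ x, ‖η x‖ ≤ C := hηc.exists_bound_of_continuous hη.continuous
  obtain ⟨C', hC'⟩ : ∃ C, ∀ x, ‖gradient η x‖ ≤ C :=
    (hasCompactSupport_gradient hηc).exists_bound_of_continuous (continuous_gradient hη)
  have hC0 : 0 ≤ C := (norm_nonneg _).trans (hC 0)
  have hC'0 : 0 ≤ C' := (norm_nonneg _).trans (hC' 0)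
  -- smooth approximations of the positive part
  set e : ℕ → ℝ := fun j => 1 / ((j : ℝ) + 1) with he
  have hepos : ∀ j, 0 < e j := fun j => by positivity
  have het : Tendsto e atTop (𝓝 0) := tendsto_one_div_add_atTop_nhds_zero_nat
  set F : ℕ → ℝ → ℝ := fun j s => √(s ^ 2 + e j ^ 2) - e j with hF
  set F' : ℕ → ℝ → ℝ := fun j s => s / √(s ^ 2 + e j ^ 2) with hF'
  set G : ℕ → ℝ → ℝ := fun j s => F j (max (s - k) 0) with hG
  set g : ℕ → ℝ → ℝ := fun j s => F' j (max (s - k) 0) with hg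
  have hGd : ∀ j s, HasDerivAt (G j) (g j s) s := fun j s =>
    hasDerivAt_comp_posPart (hasDerivAt_sqrt_sq_add_sub (hepos j))
      (by simp [Real.sqrt_sq (hepos j).le]) (by simp) k s
  have hpos : ∀ (j : ℕ) (s : ℝ), 0 < √(s ^ 2 + e j ^ 2) := fun j s =>
    Real.sqrt_pos.2 (by have := hepos j; positivity)
  have hgc : ∀ j, Continuous (g j) := by
    intro j
    refine Continuous.div (by fun_prop) (by fun_prop) fun s => (hpos j _).ne'
  have hF'b : ∀ j s, |F' j s| ≤ 1 := by
    intro j s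
    rw [hF', abs_div, abs_of_pos (hpos j s), div_le_one (hpos j s)]
    exact Real.abs_le_sqrt (by nlinarith [sq_nonneg (e j)])
  have hgb : ∀ j s, |g j s| ≤ 1 := fun j s => hF'b j _
  have hF'0 : ∀ j s, 0 ≤ s → 0 ≤ F' j s := fun j s hs => div_nonneg hs (hpos j s).le
  have hG0 : ∀ j s, 0 ≤ G j s := by
    intro j s
    have : e j ≤ √((max (s - k) 0) ^ 2 + e j ^ 2) :=
      Real.le_sqrt_of_sq_le (by nlinarith [sq_nonneg (max (s - k) 0)])
    simpa [hG, hF] using this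
  have hGle : ∀ j s, G j s ≤ max (s - k) 0 := by
    intro j s
    have h0 : 0 ≤ max (s - k) 0 := le_max_right _ _
    have : √((max (s - k) 0) ^ 2 + e j ^ 2) ≤ max (s - k) 0 + e j := by
      rw [Real.sqrt_le_left (add_nonneg h0 (hepos j).le)]
      nlinarith [mul_nonneg h0 (hepos j).le]
    simp only [hG, hF]
    linarith
  have hmaxle : ∀ s, max (s - k) 0 ≤ |s| := fun s =>
    max_le ((sub_le_self s hk).trans (le_abs_self s)) (abs_nonneg s)
  have hGb : ∀ j s, |G j s - max (s - k) 0| ≤ |s| := by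
    intro j s
    rw [abs_le]
    have h1 := hG0 j s
    have h2 := hGle j s
    have h3 := hmaxle s
    have h4 := abs_nonneg s
    constructor <;> linarith
  have hsq : ∀ t : ℝ, Tendsto (fun j => √(t ^ 2 + e j ^ 2)) atTop (𝓝 |t|) := by
    intro t
    have : Continuous fun ε : ℝ => √(t ^ 2 + ε ^ 2) := by fun_prop
    have h := (this.tendsto 0).comp het
    simpa [Function.comp_def, Real.sqrt_sq_eq_abs] using h
  have hGt : ∀ s, Tendsto (fun j => G j s - max (s - k) 0) atTop (𝓝 0) := by
    intro s
    have h := ((hsq (max (s - k) 0)).sub het).sub_const (max (s - k) 0)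
    simpa [abs_of_nonneg (le_max_right (s - k) 0)] using h
  have hgt : ∀ s, k < s → Tendsto (fun j => g j s) atTop (𝓝 1) := by
    intro s hs
    have hp : 0 < s - k := sub_pos.2 hs
    have hm : max (s - k) 0 = s - k := max_eq_left hp.le
    have h := (tendsto_const_nhds (x := s - k)).div (hsq (s - k)) (abs_pos.2 hp.ne').ne'
    rw [abs_of_pos hp, div_self hp.ne'] at h
    simp only [hg, hF', hm]
    exact h
  have hg0 : ∀ j s, s ≤ k → g j s = 0 := by
    intro j s hs
    simp [hg, hF', max_eq_right (sub_nonpos.2 hs)]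
  have hηs : AEStronglyMeasurable η volume := hη.continuous.aestronglyMeasurable
  have hgηs : AEStronglyMeasurable (gradient η) volume :=
    (continuous_gradient hη).aestronglyMeasurable
  have hVa := hVs.aestronglyMeasurable (μ := volume)
  have hDVa := hDVs.aestronglyMeasurable (μ := volume)
  have hpm : AEStronglyMeasurable (fun x => max (V x - k) 0) volume :=
    ((hVs.measurable.sub_const k).max measurable_const).aestronglyMeasurable
  have hIm : AEStronglyMeasurable ({x | k < V x}.indicator DV) volume :=
    (hDVs.indicator (measurableSet_lt measurable_const hVs.measurable)).aestronglyMeasurable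
  have hGc : ∀ j, Continuous (G j) := fun j =>
    continuous_iff_continuousAt.2 fun s => (hGd j s).continuousAt
  have hGm : ∀ j, AEStronglyMeasurable (fun x => G j (V x)) volume := fun j =>
    (hGc j).comp_aestronglyMeasurable hVa
  have hgm : ∀ j, AEStronglyMeasurable (fun x => g j (V x)) volume := fun j =>
    (hgc j).comp_aestronglyMeasurable hVa
  refine IsW12Limit.of_tendsto (Eventually.of_forall fun j => isW12Limit_mul_comp hU hV hVs hDVs
    hVm hDVm hV0 hDV0 hη hηc hηU hη0 (hGd j) (hgc j) (hgb j) (hG0 j)) (hηs.mul hpm)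
    ((hpm.smul hgηs).add (hηs.smul hIm)) (fun j => hηs.mul (hGm j))
    (fun j => ((hGm j).smul hgηs).add ((hηs.mul (hgm j)).smul hDVa)) ?_ ?_
  · refine tendsto_eLpNorm_two_zero_of_dominated (b := fun x => C • V x) (hVm.const_smul C)
      (fun j => (hηs.mul (hGm j)).sub (hηs.mul hpm)) (fun j => Eventually.of_forall fun x => ?_)
      (Eventually.of_forall fun x => ?_)
    · rw [← mul_sub, norm_mul, norm_smul]
      exact mul_le_mul ((hC x).trans (le_abs_self C)) (hGb j _) (norm_nonneg _) (norm_nonneg _)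
    · simp_rw [← mul_sub]
      simpa using (hGt (V x)).const_mul (η x)
  · have e1 : ∀ j, (fun x => G j (V x) • gradient η x + (η x * g j (V x)) • DV x
        - (max (V x - k) 0 • gradient η x + η x • {x | k < V x}.indicator DV x))
        = fun x => (G j (V x) - max (V x - k) 0) • gradient η x
          + η x • (g j (V x) • DV x - {x | k < V x}.indicator DV x) := by
      intro j
      ext1 x
      module
    simp_rw [e1]
    refine tendsto_eLpNorm_two_zero_of_dominated
      (b := fun x => C' * ‖V x‖ + C * ‖DV x‖)
      ((hVm.norm.const_mul C').add (hDVm.norm.const_mul C))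
      (fun j => (((hGm j).sub hpm).smul hgηs).add (hηs.smul (((hgm j).smul hDVa).sub hIm)))
      (fun j => Eventually.of_forall fun x => ?_) (Eventually.of_forall fun x => ?_)
    · rw [Real.norm_of_nonneg (by positivity)]
      refine (norm_add_le _ _).trans (add_le_add ?_ ?_)
      · rw [norm_smul, mul_comm]
        exact mul_le_mul (hC' x) (hGb j _) (norm_nonneg _) hC'0
      · rw [norm_smul]
        refine mul_le_mul (hC x) ?_ (norm_nonneg _) hC0
        by_cases hx : k < V x
        · rw [Set.indicator_of_mem (show x ∈ {x | k < V x} from hx)]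
          have : g j (V x) • DV x - DV x = (g j (V x) - 1) • DV x := by module
          rw [this, norm_smul]
          refine mul_le_of_le_one_left (norm_nonneg _) ?_
          have h1 := hF'0 j (max (V x - k) 0) (le_max_right _ _)
          have h2 := (le_abs_self _).trans (hF'b j (max (V x - k) 0))
          rw [Real.norm_eq_abs, abs_le]
          simp only [hg]
          constructor <;> linarith
        · rw [Set.indicator_of_notMem (show x ∉ {x | k < V x} from hx), hg0 j _ (not_lt.1 hx)]
          simp
    · have h1 := (hGt (V x)).smul_const (gradient η x)
      have h2 : Tendsto (fun j => g j (V x) • DV x - {x | k < V x}.indicator DV x) atTop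
          (𝓝 0) := by
        by_cases hx : k < V x
        · rw [Set.indicator_of_mem (show x ∈ {x | k < V x} from hx)]
          have := ((hgt _ hx).smul_const (DV x)).sub_const (DV x)
          simpa using this
        · rw [Set.indicator_of_notMem (show x ∉ {x | k < V x} from hx)]
          simp_rw [hg0 _ _ (not_lt.1 hx)]
          simp
      simpa using h1.add (h2.const_smul (η x))

end

/-! ### The Caccioppoli inequality -/

section

variable {n : ℕ}

lemma IsEllipticCoefficient.memLp_toEuclideanLin {U : Set (EuclideanSpace ℝ (Fin n))} {ν Λ : ℝ}
    {a : EuclideanSpace ℝ (Fin n) → Matrix (Fin n) (Fin n) ℝ} (ha : IsEllipticCoefficient U ν Λ a)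
    {f : EuclideanSpace ℝ (Fin n) → EuclideanSpace ℝ (Fin n)}
    (hf : MemLp f 2 (volume.restrict U)) :
    MemLp (fun x => Matrix.toEuclideanLin (a x) (f x)) 2 (volume.restrict U) := by
  refine MemLp.of_eval_piLp fun i => ?_
  have : (fun x => (Matrix.toEuclideanLin (a x) (f x)) i)
      = fun x => ∑ j, a x i j * f x j := by
    ext x
    simp [Matrix.toLpLin_apply, Matrix.mulVec, dotProduct]
  rw [this]
  refine memLp_finsetSum _ fun j _ => ?_
  exact (hf.eval_piLp j).mul' (ha.memLp i j)

/-- Cauchy–Schwarz for the pairing of two vector fields. -/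
lemma enorm_integral_inner_le {α : Type*} [MeasurableSpace α] {μ : Measure α}
    {f g : α → EuclideanSpace ℝ (Fin n)} (hf : AEStronglyMeasurable f μ)
    (hg : AEStronglyMeasurable g μ) :
    ‖∫ x, inner ℝ (f x) (g x) ∂μ‖ₑ ≤ eLpNorm f 2 μ * eLpNorm g 2 μ := by
  refine (enorm_integral_le_lintegral_enorm _).trans ?_
  rw [← eLpNorm_one_eq_lintegral_enorm]
  have := eLpNorm_le_eLpNorm_mul_eLpNorm'_of_norm (p := 2) (q := 2) (r := 1) hf hg
    (fun x y => (inner ℝ x y : ℝ)) 1 (Eventually.of_forall fun x => by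
      simpa using norm_inner_le_norm (𝕜 := ℝ) (f x) (g x))
  simpa using this

lemma integrable_inner_of_memLp {α : Type*} [MeasurableSpace α] {μ : Measure α}
    {f g : α → EuclideanSpace ℝ (Fin n)} (hf : MemLp f 2 μ) (hg : MemLp g 2 μ) :
    Integrable (fun x => (inner ℝ (f x) (g x) : ℝ)) μ := by
  rw [← memLp_one_iff_integrable]
  exact MemLp.of_bilin (p := 2) (q := 2) (fun x y => (inner ℝ x y : ℝ)) 1 hf hg
    (hf.1.inner hg.1) (Eventually.of_forall fun x => by
      simpa using nnnorm_inner_le_nnnorm (𝕜 := ℝ) (f x) (g x))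

lemma memLp_gradient {φ : EuclideanSpace ℝ (Fin n) → ℝ} (h1 : ContDiff ℝ 1 φ)
    (h2 : HasCompactSupport φ) : MemLp (gradient φ) 2 volume :=
  (continuous_gradient h1).memLp_of_hasCompactSupport (hasCompactSupport_gradient h2)

/-- The subsolution inequality extends from `C¹` test functions to their limits in `W^{1,2}`. -/
lemma IsW12Limit.integral_inner_nonpos {U : Set (EuclideanSpace ℝ (Fin n))}
    {f : EuclideanSpace ℝ (Fin n) → EuclideanSpace ℝ (Fin n)}
    (hf : MemLp f 2 (volume.restrict U))
    (hsub : ∀ φ : EuclideanSpace ℝ (Fin n) → ℝ,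
      ContDiff ℝ 1 φ → HasCompactSupport φ → tsupport φ ⊆ U → (∀ x, 0 ≤ φ x) →
      ∫ x in U, inner ℝ (f x) (gradient φ x) ≤ 0)
    {u : EuclideanSpace ℝ (Fin n) → ℝ}
    {Du : EuclideanSpace ℝ (Fin n) → EuclideanSpace ℝ (Fin n)}
    (hu : IsW12Limit U u Du) (hDu : MemLp Du 2 volume) :
    ∫ x in U, inner ℝ (f x) (Du x) ≤ 0 := by
  by_contra! hpos
  set I := ∫ x in U, inner ℝ (f x) (Du x) with hI
  have hN : eLpNorm f 2 (volume.restrict U) ≠ ⊤ := hf.2.ne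
  -- a test function whose pairing with `f` is still positive
  obtain ⟨ε, hε0, hε⟩ : ∃ ε : ℝ≥0∞, 0 < ε ∧
      eLpNorm f 2 (volume.restrict U) * ε < ENNReal.ofReal I := by
    have ht : Tendsto (fun ε => eLpNorm f 2 (volume.restrict U) * ε) (𝓝[>] 0) (𝓝 0) := by
      have := ENNReal.Tendsto.const_mul (a := eLpNorm f 2 (volume.restrict U))
        (tendsto_id (α := ℝ≥0∞) (x := 𝓝 0)) (Or.inr hN)
      rw [mul_zero] at this
      exact this.mono_left nhdsWithin_le_nhds
    have h1 := ht.eventually_lt_const (ENNReal.ofReal_pos.2 hpos)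
    obtain ⟨ε, h2, h3⟩ := (h1.and self_mem_nhdsWithin).exists
    exact ⟨ε, h3, h2⟩
  obtain ⟨φ, h1, h2, h3, h4, -, h6⟩ := hu ε hε0
  have hφ := hsub φ h1 h2 h3 h4
  have hg := (memLp_gradient h1 h2).restrict U
  have hD := hDu.restrict U
  have hdiff : ∫ x in U, inner ℝ (f x) (gradient φ x - Du x)
      = (∫ x in U, inner ℝ (f x) (gradient φ x)) - I := by
    simp_rw [inner_sub_right]
    exact integral_sub (integrable_inner_of_memLp hf hg) (integrable_inner_of_memLp hf hD)
  have hle := enorm_integral_inner_le (μ := volume.restrict U) hf.1 (hg.sub hD).1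
  have hle2 : eLpNorm (gradient φ - Du) 2 (volume.restrict U) ≤ ε :=
    (eLpNorm_mono_measure _ Measure.restrict_le_self).trans h6
  have hlt : ‖∫ x in U, inner ℝ (f x) (gradient φ x - Du x)‖ₑ < ENNReal.ofReal I :=
    (hle.trans (mul_le_mul_right hle2 _)).trans_lt hε
  rw [hdiff, Real.enorm_eq_ofReal_abs] at hlt
  have := (ENNReal.ofReal_lt_ofReal_iff hpos).1 hlt
  rw [abs_of_nonpos (by linarith)] at this
  linarith

/-- Young's inequality for the quadratic form of an elliptic symmetric matrix. -/
lemma inner_toEuclideanLin_young {A : Matrix (Fin n) (Fin n) ℝ} {ν Λ : ℝ} (hν : 0 < ν)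
    (hA : A.IsSymm) (hell : ∀ z : EuclideanSpace ℝ (Fin n),
      ν * ‖z‖ ^ 2 ≤ inner ℝ (Matrix.toEuclideanLin A z) z ∧
        inner ℝ (Matrix.toEuclideanLin A z) z ≤ Λ * ‖z‖ ^ 2)
    (η w : ℝ) (p q : EuclideanSpace ℝ (Fin n)) :
    ν / 2 * (η ^ 2 * ‖p‖ ^ 2) - 2 * Λ * (w ^ 2 * ‖q‖ ^ 2)
      ≤ inner ℝ (Matrix.toEuclideanLin A p) (w • (2 * η) • q + η ^ 2 • p) := by
  have hsymm : inner ℝ (Matrix.toEuclideanLin A q) p = inner ℝ (Matrix.toEuclideanLin A p) q := by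
    have h := Matrix.isSymmetric_toEuclideanLin_iff.2
      (show A.IsHermitian by
        rw [Matrix.IsHermitian, Matrix.conjTranspose_eq_transpose_of_trivial, hA])
    rw [h q p, real_inner_comm]
  have h0 : 0 ≤ inner ℝ (Matrix.toEuclideanLin A (η • p + (2 * w) • q))
      (η • p + (2 * w) • q) :=
    le_trans (by positivity) (hell _).1
  simp only [map_add, map_smul, inner_add_left, inner_add_right, real_inner_smul_left,
    real_inner_smul_right, hsymm] at h0 ⊢
  have h1 := mul_le_mul_of_nonneg_left (hell p).1 (sq_nonneg η)
  have h2 := mul_le_mul_of_nonneg_left (hell q).2 (sq_nonneg w)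
  nlinarith

/-- Caccioppoli's inequality for the truncation `(V - k)₊` of a subsolution, stated for the
gradient of the localized truncation `η (V - k)₊`. -/
lemma caccioppoli {U : Set (EuclideanSpace ℝ (Fin n))} (hU : IsOpen U)
    {ν Λ : ℝ} (hν : 0 < ν) (hνΛ : ν ≤ Λ)
    {a : EuclideanSpace ℝ (Fin n) → Matrix (Fin n) (Fin n) ℝ} (ha : IsEllipticCoefficient U ν Λ a)
    {V : EuclideanSpace ℝ (Fin n) → ℝ}
    {DV : EuclideanSpace ℝ (Fin n) → EuclideanSpace ℝ (Fin n)}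
    (hV : HasW12Gradient U V DV)
    (hVs : StronglyMeasurable V) (hDVs : StronglyMeasurable DV)
    (hVm : MemLp V 2 volume) (hDVm : MemLp DV 2 volume)
    (hV0 : ∀ x ∉ U, V x = 0) (hDV0 : ∀ x ∉ U, DV x = 0)
    (hsub : ∀ φ : EuclideanSpace ℝ (Fin n) → ℝ,
      ContDiff ℝ 1 φ → HasCompactSupport φ → tsupport φ ⊆ U → (∀ x, 0 ≤ φ x) →
      ∫ x in U, inner ℝ (Matrix.toEuclideanLin (a x) (DV x)) (gradient φ x) ≤ 0)
    {η : EuclideanSpace ℝ (Fin n) → ℝ} (hη : ContDiff ℝ 1 η) (hηc : HasCompactSupport η)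
    (hηU : tsupport η ⊆ U) {k : ℝ} (hk : 0 ≤ k) :
    ∫⁻ x, ‖max (V x - k) 0 • gradient η x + η x • {x | k < V x}.indicator DV x‖ₑ ^ 2
      ≤ ENNReal.ofReal (10 * (Λ / ν)) *
        ∫⁻ x, ENNReal.ofReal (max (V x - k) 0 ^ 2 * ‖gradient η x‖ ^ 2) := by
  obtain ⟨C, hC⟩ : ∃ C, ∀ x, ‖η x‖ ≤ C := hηc.exists_bound_of_continuous hη.continuous
  obtain ⟨C', hC'⟩ : ∃ C, ∀ x, ‖gradient η x‖ ≤ C :=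
    (hasCompactSupport_gradient hηc).exists_bound_of_continuous (continuous_gradient hη)
  set w : EuclideanSpace ℝ (Fin n) → ℝ := fun x => max (V x - k) 0 with hw
  set D : EuclideanSpace ℝ (Fin n) → EuclideanSpace ℝ (Fin n) := {x | k < V x}.indicator DV with hD
  have hwm : MemLp w 2 volume := by
    refine hVm.mono ((hVs.measurable.sub_const k).max measurable_const).aestronglyMeasurable
      (Eventually.of_forall fun x => ?_)
    rw [Real.norm_of_nonneg (le_max_right _ _), Real.norm_eq_abs]
    exact max_le ((sub_le_self _ hk).trans (le_abs_self _)) (abs_nonneg _)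
  have hDm : MemLp D 2 volume :=
    hDVm.indicator (measurableSet_lt measurable_const hVs.measurable)
  have hηtop : MemLp η ⊤ volume := memLp_top_of_bound hη.continuous.aestronglyMeasurable C
    (Eventually.of_forall hC)
  have hgtop : MemLp (gradient η) ⊤ volume :=
    memLp_top_of_bound (continuous_gradient hη).aestronglyMeasurable C' (Eventually.of_forall hC')
  have hwg : MemLp (fun x => w x • gradient η x) 2 volume := hgtop.smul hwm
  have hηD : MemLp (fun x => η x • D x) 2 volume := hDm.smul hηtop
  -- the test function `η² (V - k)₊`
  have hη2 : ContDiff ℝ 1 (fun x => η x ^ 2) := hη.pow 2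
  have hη2c : HasCompactSupport (fun x => η x ^ 2) := by
    simp_rw [pow_two]; exact hηc.mul_right
  have hη2s : tsupport (fun x => η x ^ 2) ⊆ U := by
    simp_rw [pow_two]; exact (tsupport_mul_subset_left).trans hηU
  have hη2g : ∀ x, gradient (fun x => η x ^ 2) x = (2 * η x) • gradient η x := by
    intro x
    have h1 : HasFDerivAt η (fderiv ℝ η x) x := (hη.differentiable (by norm_num) x).hasFDerivAt
    rw [gradient, (h1.pow 2).fderiv]
    simp [gradient]
  have hlim := isW12Limit_mul_posPart hU hV hVs hDVs hVm hDVm hV0 hDV0 hη2 hη2c hη2s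
    (fun x => sq_nonneg (η x)) hk
  simp_rw [hη2g] at hlim
  change IsW12Limit U _ (fun x => w x • (2 * η x) • gradient η x + η x ^ 2 • D x) at hlim
  have htest : MemLp (fun x => w x • (2 * η x) • gradient η x + η x ^ 2 • D x) 2 volume := by
    have h1 : MemLp (fun x => (2 : ℝ) • η x • w x • gradient η x) 2 volume :=
      (MemLp.smul (p := ⊤) (q := 2) (r := 2) hwg hηtop).const_smul (2 : ℝ)
    have h2 : MemLp (fun x => η x • η x • D x) 2 volume :=
      MemLp.smul (p := ⊤) (q := 2) (r := 2) hηD hηtop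
    convert h1.add h2 using 1
    ext1 x
    simp only [Pi.add_apply]
    module
  have hweak := hlim.integral_inner_nonpos (ha.memLp_toEuclideanLin (hDVm.restrict U)) hsub htest
  have hint1 : Integrable (fun x => η x ^ 2 * ‖D x‖ ^ 2) volume := by
    have := hηD.integrable_norm_pow (p := 2) (by norm_num)
    simpa [norm_smul, mul_pow] using this
  have hint2 : Integrable (fun x => w x ^ 2 * ‖gradient η x‖ ^ 2) volume := by
    have := hwg.integrable_norm_pow (p := 2) (by norm_num)
    simpa [norm_smul, mul_pow] using this
  have hmain : ∫ x in U, (ν / 2 * (η x ^ 2 * ‖D x‖ ^ 2)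
      - 2 * Λ * (w x ^ 2 * ‖gradient η x‖ ^ 2)) ≤ 0 := by
    refine le_trans (integral_mono_ae ?_ ?_ ?_) hweak
    · exact ((hint1.const_mul _).sub (hint2.const_mul _)).restrict
    · exact integrable_inner_of_memLp (ha.memLp_toEuclideanLin (hDVm.restrict U))
        (htest.restrict U)
    · filter_upwards [ha.symm, ha.elliptic] with x hx1 hx2
      by_cases hx : k < V x
      · have hDx : D x = DV x := Set.indicator_of_mem (show x ∈ {x | k < V x} from hx) _
        rw [hDx]
        exact inner_toEuclideanLin_young hν hx1 hx2 _ _ _ _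
      · have hDx : D x = 0 := Set.indicator_of_notMem (show x ∉ {x | k < V x} from hx) _
        have hwx : w x = 0 := max_eq_right (by linarith [not_lt.1 hx])
        simp [hDx, hwx]
  have hη0 : ∀ x ∉ U, η x = 0 := fun x hx => image_eq_zero_of_notMem_tsupport fun h => hx (hηU h)
  have hg0 : ∀ x ∉ U, gradient η x = 0 := fun x hx => by
    have : fderiv ℝ η x = 0 := fderiv_of_notMem_tsupport (𝕜 := ℝ) fun h => hx (hηU h)
    simp [gradient, this]
  rw [setIntegral_eq_integral_of_forall_compl_eq_zero (fun x hx => by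
    simp [hη0 x hx, hg0 x hx]), integral_sub (hint1.const_mul _) (hint2.const_mul _),
    integral_const_mul, integral_const_mul] at hmain
  have hI2 : 0 ≤ ∫ x, w x ^ 2 * ‖gradient η x‖ ^ 2 := integral_nonneg fun x => by positivity
  have hI1 : ∫ x, η x ^ 2 * ‖D x‖ ^ 2 ≤ 4 * (Λ / ν) * ∫ x, w x ^ 2 * ‖gradient η x‖ ^ 2 := by
    rw [show 4 * (Λ / ν) * ∫ x, w x ^ 2 * ‖gradient η x‖ ^ 2
      = (4 * Λ * ∫ x, w x ^ 2 * ‖gradient η x‖ ^ 2) / ν by ring, le_div_iff₀ hν]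
    linarith
  have hL : 1 ≤ Λ / ν := (one_le_div hν).2 hνΛ
  have hsumm : MemLp (fun x => w x • gradient η x + η x • D x) 2 volume := hwg.add hηD
  have hint3 : Integrable (fun x => ‖w x • gradient η x + η x • D x‖ ^ 2) volume :=
    hsumm.integrable_norm_pow (p := 2) (by norm_num)
  have hI3 : ∫ x, ‖w x • gradient η x + η x • D x‖ ^ 2
      ≤ 10 * (Λ / ν) * ∫ x, w x ^ 2 * ‖gradient η x‖ ^ 2 := by
    have h1 : ∫ x, ‖w x • gradient η x + η x • D x‖ ^ 2
        ≤ ∫ x, (2 * (w x ^ 2 * ‖gradient η x‖ ^ 2) + 2 * (η x ^ 2 * ‖D x‖ ^ 2)) := by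
      refine integral_mono hint3 ((hint2.const_mul 2).add (hint1.const_mul 2)) fun x => ?_
      have h2 := norm_add_le (w x • gradient η x) (η x • D x)
      have h3 : ‖w x • gradient η x‖ ^ 2 = w x ^ 2 * ‖gradient η x‖ ^ 2 := by
        rw [norm_smul, mul_pow, Real.norm_eq_abs, sq_abs]
      have h4 : ‖η x • D x‖ ^ 2 = η x ^ 2 * ‖D x‖ ^ 2 := by
        rw [norm_smul, mul_pow, Real.norm_eq_abs, sq_abs]
      simp only
      rw [← h3, ← h4]
      nlinarith [norm_nonneg (w x • gradient η x + η x • D x),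
        sq_nonneg (‖w x • gradient η x‖ - ‖η x • D x‖)]
    rw [integral_add (hint2.const_mul 2) (hint1.const_mul 2), integral_const_mul,
      integral_const_mul] at h1
    nlinarith
  change ∫⁻ x, ‖w x • gradient η x + η x • D x‖ₑ ^ 2 ≤ ENNReal.ofReal (10 * (Λ / ν)) *
    ∫⁻ x, ENNReal.ofReal (w x ^ 2 * ‖gradient η x‖ ^ 2)
  have e1 : ∀ x, ‖w x • gradient η x + η x • D x‖ₑ ^ 2
      = ENNReal.ofReal (‖w x • gradient η x + η x • D x‖ ^ 2) := by
    intro x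
    rw [ENNReal.ofReal_pow (norm_nonneg _), ofReal_norm]
  simp_rw [e1]
  rw [← ofReal_integral_eq_lintegral_ofReal hint3 (Eventually.of_forall fun x => by positivity),
    ← ofReal_integral_eq_lintegral_ofReal hint2 (Eventually.of_forall fun x => by positivity),
    ← ENNReal.ofReal_mul (by positivity)]
  exact ENNReal.ofReal_le_ofReal hI3

end

/-! ### The Sobolev inequality on hyperplanes -/

lemma ae_tendsto_zero_of_tsum_lintegral_ne_top {α : Type*} [MeasurableSpace α] {μ : Measure α}
    {h : ℕ → α → ℝ≥0∞} (hm : ∀ j, Measurable (h j)) (hs : ∑' j, ∫⁻ x, h j x ∂μ ≠ ⊤) :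
    ∀ᵐ x ∂μ, Tendsto (fun j => h j x) atTop (𝓝 0) := by
  rw [← lintegral_tsum fun j => (hm j).aemeasurable] at hs
  filter_upwards [ae_lt_top (Measurable.tsum hm) hs] with x hx
  exact ENNReal.tendsto_atTop_zero_of_tsum_ne_top hx.ne

lemma eLpNorm_two_sq {α F : Type*} [MeasurableSpace α] {μ : Measure α} [NormedAddCommGroup F]
    (f : α → F) : eLpNorm f 2 μ ^ 2 = ∫⁻ x, ‖f x‖ₑ ^ 2 ∂μ := by
  rw [eLpNorm_eq_lintegral_rpow_enorm_toReal (by norm_num) (by norm_num), ← ENNReal.rpow_natCast,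
    ← ENNReal.rpow_mul]
  norm_num

/-- Hölder's inequality for a function supported in `S`. -/
lemma eLpNorm_le_mul_of_support_subset {α F : Type*} [MeasurableSpace α] {μ : Measure α}
    [NormedAddCommGroup F] {f : α → F} {S : Set α} {p : ℝ≥0∞} (hp : p ≤ 2)
    (hf : AEStronglyMeasurable f μ) (hS : ∀ x ∉ S, f x = 0) :
    eLpNorm f p μ ≤ eLpNorm f 2 μ * μ S ^ (1 / p.toReal - 1 / 2) := by
  have hs : Function.support f ⊆ S := fun x hx => by_contra fun h => hx (hS x h)
  have h5 := eLpNorm_le_eLpNorm_mul_rpow_measure_univ hp (hf.restrict (s := S))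
  rwa [eLpNorm_restrict_eq_of_support_subset hs, eLpNorm_restrict_eq_of_support_subset hs,
    Measure.restrict_apply_univ, ENNReal.toReal_ofNat] at h5

section Slices

variable {d : ℕ}

/-- The point with `i`-th coordinate `t` and remaining coordinates `y`. For fixed `t` this
parametrizes the hyperplane `xᵢ = t`. -/
def sliceMap (i : Fin (d + 1)) (t : ℝ) (y : Fin d → ℝ) : EuclideanSpace ℝ (Fin (d + 1)) :=
  WithLp.toLp 2 (i.insertNth t y)

@[simp] lemma sliceMap_self (i : Fin (d + 1)) (t : ℝ) (y : Fin d → ℝ) : sliceMap i t y i = t := by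
  simp [sliceMap]

@[simp] lemma sliceMap_succAbove (i : Fin (d + 1)) (t : ℝ) (y : Fin d → ℝ) (j : Fin d) :
    sliceMap i t y (i.succAbove j) = y j := by
  simp [sliceMap]

lemma measurePreserving_sliceMap (i : Fin (d + 1)) :
    MeasurePreserving (fun p : ℝ × (Fin d → ℝ) => sliceMap i p.1 p.2) volume volume :=
  (PiLp.volume_preserving_toLp (Fin (d + 1))).comp
    (volume_preserving_piFinSuccAbove (fun _ : Fin (d + 1) => ℝ) i).symm

lemma measurable_sliceMap (i : Fin (d + 1)) (t : ℝ) : Measurable (sliceMap i t) :=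
  (measurePreserving_sliceMap i).measurable.comp (measurable_const.prodMk measurable_id)

lemma lintegral_eq_lintegral_sliceMap (i : Fin (d + 1))
    {f : EuclideanSpace ℝ (Fin (d + 1)) → ℝ≥0∞} (hf : Measurable f) :
    ∫⁻ x, f x = ∫⁻ t, ∫⁻ y, f (sliceMap i t y) := by
  rw [← (measurePreserving_sliceMap i).lintegral_comp hf, Measure.volume_eq_prod,
    lintegral_prod (fun p : ℝ × (Fin d → ℝ) => f (sliceMap i p.1 p.2))
      (hf.comp (measurePreserving_sliceMap i).measurable).aemeasurable]

lemma measurable_lintegral_sliceMap (i : Fin (d + 1))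
    {f : EuclideanSpace ℝ (Fin (d + 1)) → ℝ≥0∞} (hf : Measurable f) :
    Measurable fun t => ∫⁻ y, f (sliceMap i t y) :=
  (hf.comp (measurePreserving_sliceMap i).measurable).lintegral_prod_right'

lemma ae_ae_sliceMap (i : Fin (d + 1)) {p : EuclideanSpace ℝ (Fin (d + 1)) → Prop}
    (h : ∀ᵐ x, p x) : ∀ᵐ t : ℝ, ∀ᵐ y : Fin d → ℝ, p (sliceMap i t y) :=
  Measure.ae_ae_of_ae_prod ((measurePreserving_sliceMap i).quasiMeasurePreserving.ae h)

/-- The linear part of `sliceMap`. -/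
noncomputable def sliceLinear (i : Fin (d + 1)) :
    (Fin d → ℝ) →L[ℝ] EuclideanSpace ℝ (Fin (d + 1)) :=
  LinearMap.toContinuousLinearMap
    { toFun := sliceMap i 0
      map_add' := fun x y => by
        ext j
        refine Fin.succAboveCases i ?_ (fun k => ?_) j <;> simp
      map_smul' := fun c x => by
        ext j
        refine Fin.succAboveCases i ?_ (fun k => ?_) j <;> simp }

lemma hasFDerivAt_sliceMap (i : Fin (d + 1)) (t : ℝ) (y : Fin d → ℝ) :
    HasFDerivAt (sliceMap i t) (sliceLinear i) y := by
  have h : sliceMap i t = fun y => sliceLinear i y + sliceMap i t 0 := by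
    ext y j
    change _ = (sliceMap i 0 y + sliceMap i t 0) j
    refine Fin.succAboveCases i ?_ (fun k => ?_) j <;> simp
  rw [h]
  exact (sliceLinear i).hasFDerivAt.add_const _

lemma contDiff_sliceMap (i : Fin (d + 1)) (t : ℝ) : ContDiff ℝ 1 (sliceMap i t) := by
  have h : sliceMap i t = fun y => sliceLinear i y + sliceMap i t 0 := by
    ext y j
    change _ = (sliceMap i 0 y + sliceMap i t 0) j
    refine Fin.succAboveCases i ?_ (fun k => ?_) j <;> simp
  rw [h]
  exact (sliceLinear i).contDiff.add contDiff_const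

/-- The Gagliardo–Nirenberg–Sobolev inequality on the hyperplanes `xᵢ = t`, with the dependence of
the constant on the size of the support made explicit. -/
lemma exists_eLpNorm_sliceMap_le {χ : ℝ} (hd : 2 ≤ d) (hχ : 1 < χ)
    (hdχ : 1 / 2 ≤ 1 / (d : ℝ) + 1 / (2 * χ)) :
    ∃ C : ℝ, 0 < C ∧ ∀ (x₀ : EuclideanSpace ℝ (Fin (d + 1))) (R : ℝ), 0 < R →
      ∀ φ : EuclideanSpace ℝ (Fin (d + 1)) → ℝ, ContDiff ℝ 1 φ → HasCompactSupport φ →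
      tsupport φ ⊆ Metric.ball x₀ R → ∀ (i : Fin (d + 1)) (t : ℝ),
      eLpNorm (fun y => φ (sliceMap i t y)) (ENNReal.ofReal (2 * χ)) volume
        ≤ ENNReal.ofReal (C * R ^ (1 + d / (2 * χ) - d / 2)) *
          eLpNorm (fun y => gradient φ (sliceMap i t y)) 2 volume := by
  have hd0 : (2 : ℝ) ≤ d := by exact_mod_cast hd
  have hχ0 : 0 < χ := by linarith
  -- the exponent `p ∈ [1, 2]` whose Sobolev exponent in dimension `d` is `2χ`
  set P : ℝ := (1 / (d : ℝ) + 1 / (2 * χ))⁻¹ with hP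
  have hPpos : 0 < P := by positivity
  have hP1 : 1 ≤ P := by
    rw [hP, one_le_inv₀ (by positivity)]
    have h1 : 1 / (d : ℝ) ≤ 1 / 2 := one_div_le_one_div_of_le (by norm_num) hd0
    have h2 : 1 / (2 * χ) ≤ 1 / 2 := one_div_le_one_div_of_le (by norm_num) (by linarith)
    linarith
  have hP2 : P ≤ 2 := by
    rw [hP, inv_le_comm₀ (by positivity) (by norm_num)]
    simpa using hdχ
  set p : NNReal := P.toNNReal with hp
  have hpP : (p : ℝ) = P := Real.coe_toNNReal _ hPpos.le
  have hfin : Module.finrank ℝ (Fin d → ℝ) = d := by simp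
  set K := eLpNormLESNormFDerivOfEqInnerConst (volume : Measure (Fin d → ℝ)) p with hK
  set N : ℝ := ∑ i : Fin (d + 1), ‖sliceLinear i‖ with hN
  have hN0 : 0 ≤ N := Finset.sum_nonneg fun i _ => norm_nonneg _
  set β : ℝ := 1 + d / (2 * χ) - d / 2 with hβ
  have hβe : (d : ℝ) * (1 / P - 1 / 2) = β := by
    rw [hP, hβ, one_div, inv_inv]; field_simp
  refine ⟨K * N * 2 ^ β + 1, by positivity, fun x₀ R hR φ h1 h2 h3 i t => ?_⟩
  set f : (Fin d → ℝ) → ℝ := fun y => φ (sliceMap i t y) with hf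
  have hfd : ContDiff ℝ 1 f := h1.comp (contDiff_sliceMap i t)
  set S : Set (Fin d → ℝ) := Metric.ball (fun j => x₀ (i.succAbove j)) R with hS
  have hsub : ∀ y, sliceMap i t y ∈ Metric.ball x₀ R → y ∈ S := by
    intro y hy
    rw [hS, Metric.mem_ball, dist_pi_lt_iff hR]
    intro j
    rw [Metric.mem_ball, dist_eq_norm] at hy
    have := (PiLp.norm_apply_le (sliceMap i t y - x₀) (i.succAbove j)).trans_lt hy
    simpa [Real.dist_eq] using this
  have hts : tsupport f ⊆ sliceMap i t ⁻¹' tsupport φ :=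
    closure_minimal (fun y hy => subset_tsupport φ hy)
      ((isClosed_tsupport φ).preimage (contDiff_sliceMap i t).continuous)
  have hfc : HasCompactSupport f := by
    refine HasCompactSupport.of_support_subset_isCompact (isCompact_closedBall
      (fun j => x₀ (i.succAbove j)) R) fun y hy => ?_
    exact Metric.ball_subset_closedBall (hsub y (h3 (subset_tsupport φ hy)))
  have hfin' : 0 < Module.finrank ℝ (Fin d → ℝ) := by rw [hfin]; omega
  have hGNS := eLpNorm_le_eLpNorm_fderiv_of_eq_inner (μ := (volume : Measure (Fin d → ℝ)))
    (u := f) hfd hfc (p := p) (p' := (2 * χ).toNNReal)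
    (by rw [← NNReal.coe_le_coe, hpP]; exact hP1) hfin'
    (by
      rw [Real.coe_toNNReal _ (by positivity), NNReal.coe_inv, hpP, hfin, hP, inv_inv]
      simp)
  have hfderiv : ∀ y, ‖fderiv ℝ f y‖ ≤ N * ‖gradient φ (sliceMap i t y)‖ := by
    intro y
    have h4 : HasFDerivAt f ((fderiv ℝ φ (sliceMap i t y)).comp (sliceLinear i)) y :=
      ((h1.differentiable (by norm_num) _).hasFDerivAt).comp y (hasFDerivAt_sliceMap i t y)
    rw [h4.fderiv, norm_gradient_eq, mul_comm]
    refine (ContinuousLinearMap.opNorm_comp_le _ _).trans ?_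
    gcongr
    exact Finset.single_le_sum (f := fun i => ‖sliceLinear i‖) (fun i _ => norm_nonneg _)
      (Finset.mem_univ i)
  have hsupp : ∀ y ∉ S, gradient φ (sliceMap i t y) = 0 := fun y hy => by
    have : fderiv ℝ φ (sliceMap i t y) = 0 :=
      fderiv_of_notMem_tsupport (𝕜 := ℝ) fun h => hy (hsub y (h3 h))
    simp [gradient, this]
  have hcont : Continuous fun y => gradient φ (sliceMap i t y) :=
    (continuous_gradient h1).comp (contDiff_sliceMap i t).continuous
  have hvol : volume S = ENNReal.ofReal ((2 * R) ^ d) := by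
    rw [hS, Real.volume_pi_ball _ hR, Fintype.card_fin]
  have hHolder : eLpNorm (fun y => gradient φ (sliceMap i t y)) p volume
      ≤ eLpNorm (fun y => gradient φ (sliceMap i t y)) 2 volume * ENNReal.ofReal ((2 * R) ^ β) := by
    have h5 := eLpNorm_le_mul_of_support_subset (μ := volume) (S := S) (p := (p : ℝ≥0∞))
      (by
        rw [show (2 : ℝ≥0∞) = ((2 : NNReal) : ℝ≥0∞) by norm_num, ENNReal.coe_le_coe,
          ← NNReal.coe_le_coe, hpP]
        exact hP2) hcont.aestronglyMeasurable hsupp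
    rwa [hvol, ENNReal.coe_toReal, hpP,
      ENNReal.ofReal_rpow_of_pos (by positivity), ← Real.rpow_natCast,
      ← Real.rpow_mul (by positivity), hβe] at h5
  have hgr : eLpNorm (fderiv ℝ f) p volume
      ≤ ENNReal.ofReal N * eLpNorm (fun y => gradient φ (sliceMap i t y)) p volume :=
    eLpNorm_le_mul_eLpNorm_of_ae_le_mul (Eventually.of_forall hfderiv) _
  calc eLpNorm f (ENNReal.ofReal (2 * χ)) volume
      ≤ K * (ENNReal.ofReal N * (eLpNorm (fun y => gradient φ (sliceMap i t y)) 2 volume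
          * ENNReal.ofReal ((2 * R) ^ β))) := by
        refine hGNS.trans (mul_le_mul_right (hgr.trans (mul_le_mul_right hHolder _)) _)
    _ = ENNReal.ofReal (K * N * 2 ^ β * R ^ β) *
          eLpNorm (fun y => gradient φ (sliceMap i t y)) 2 volume := by
        rw [show (K : ℝ) * N * 2 ^ β * R ^ β = K * (N * (2 * R) ^ β) by
          rw [Real.mul_rpow (by norm_num) hR.le]; ring,
          ENNReal.ofReal_mul (by positivity), ENNReal.ofReal_mul hN0, ENNReal.ofReal_coe_nnreal]
        ring
    _ ≤ _ := by
        gcongr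
        linarith

/-- The slice Sobolev inequality for limits of `C¹` functions, on almost every hyperplane. -/
lemma exists_lintegral_sliceMap_le {χ : ℝ} (hd : 2 ≤ d) (hχ : 1 < χ)
    (hdχ : 1 / 2 ≤ 1 / (d : ℝ) + 1 / (2 * χ)) :
    ∃ C : ℝ, 0 < C ∧ ∀ (x₀ : EuclideanSpace ℝ (Fin (d + 1))) (R : ℝ), 0 < R →
      ∀ (u : EuclideanSpace ℝ (Fin (d + 1)) → ℝ)
        (Du : EuclideanSpace ℝ (Fin (d + 1)) → EuclideanSpace ℝ (Fin (d + 1))),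
      StronglyMeasurable u → StronglyMeasurable Du → IsW12Limit (Metric.ball x₀ R) u Du →
      ∀ i : Fin (d + 1), ∀ᵐ t : ℝ,
      ∫⁻ y, ‖u (sliceMap i t y)‖ₑ ^ (2 * χ)
        ≤ ENNReal.ofReal (C * R ^ (2 * χ + d - d * χ)) *
          (∫⁻ y, ‖Du (sliceMap i t y)‖ₑ ^ 2) ^ χ := by
  obtain ⟨C, hC, h⟩ := exists_eLpNorm_sliceMap_le hd hχ hdχ
  have hχ0 : 0 < χ := by linarith
  refine ⟨C ^ (2 * χ), by positivity, fun x₀ R hR u Du hu hDu hlim i => ?_⟩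
  choose φ h1 h2 h3 _ h5 h6 using fun j : ℕ => hlim ((2⁻¹ : ℝ≥0∞) ^ j)
    (ENNReal.pow_pos (by simp) j)
  have hsum : ∀ q : ℕ → ℝ≥0∞, (∀ j, q j ≤ ((2⁻¹ : ℝ≥0∞) ^ j) ^ 2) → ∑' j, q j ≠ ⊤ := by
    intro q hq
    refine ne_top_of_le_ne_top (b := ∑' j : ℕ, (2⁻¹ : ℝ≥0∞) ^ j) ?_
      (ENNReal.tsum_le_tsum fun j => (hq j).trans ?_)
    · rw [ENNReal.tsum_geometric]; simp
    · exact pow_le_of_le_one (by simp) (pow_le_one₀ (by simp) (by simp)) (by norm_num)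
  have hm1 : ∀ j, Measurable fun x => ‖φ j x - u x‖ₑ ^ 2 := fun j =>
    ((h1 j).continuous.stronglyMeasurable.sub hu).enorm.pow_const _
  have hm2 : ∀ j, Measurable fun x => ‖gradient (φ j) x - Du x‖ₑ ^ 2 := fun j =>
    ((continuous_gradient (h1 j)).stronglyMeasurable.sub hDu).enorm.pow_const _
  have hae : ∀ᵐ x, Tendsto (fun j => ‖φ j x - u x‖ₑ ^ 2) atTop (𝓝 0) := by
    refine ae_tendsto_zero_of_tsum_lintegral_ne_top hm1 (hsum _ fun j => ?_)
    rw [← eLpNorm_two_sq]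
    exact pow_le_pow_left' (h5 j) 2
  have hae2 : ∀ᵐ t : ℝ, Tendsto
      (fun j => ∫⁻ y, ‖gradient (φ j) (sliceMap i t y) - Du (sliceMap i t y)‖ₑ ^ 2)
      atTop (𝓝 0) := by
    refine ae_tendsto_zero_of_tsum_lintegral_ne_top
      (fun j => measurable_lintegral_sliceMap i (hm2 j)) (hsum _ fun j => ?_)
    rw [← lintegral_eq_lintegral_sliceMap i (hm2 j), ← eLpNorm_two_sq]
    exact pow_le_pow_left' (h6 j) 2
  filter_upwards [ae_ae_sliceMap i hae, hae2] with t ht1 ht2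
  set M : ℝ≥0∞ := ENNReal.ofReal (C * R ^ (1 + d / (2 * χ) - d / 2)) with hM
  have hMtop : M ≠ ⊤ := ENNReal.ofReal_ne_top
  have hDs : AEStronglyMeasurable (fun y => Du (sliceMap i t y)) volume :=
    (hDu.comp_measurable (measurable_sliceMap i t)).aestronglyMeasurable
  have hcs : ∀ j, Continuous fun y => gradient (φ j) (sliceMap i t y) := fun j =>
    (continuous_gradient (h1 j)).comp (contDiff_sliceMap i t).continuous
  set e : ℕ → ℝ≥0∞ := fun j =>
    eLpNorm (fun y => gradient (φ j) (sliceMap i t y) - Du (sliceMap i t y)) 2 volume with he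
  have het : Tendsto e atTop (𝓝 0) := by
    have h7 : ∀ j, e j = (∫⁻ y, ‖gradient (φ j) (sliceMap i t y) - Du (sliceMap i t y)‖ₑ ^ 2)
        ^ (1 / 2 : ℝ) := by
      intro j
      rw [← eLpNorm_two_sq, ← ENNReal.rpow_natCast, ← ENNReal.rpow_mul]
      norm_num [he]
    rw [show e = fun j => _ from funext h7]
    have := (ENNReal.continuous_rpow_const (y := (1 / 2 : ℝ))).tendsto 0 |>.comp ht2
    simpa [Function.comp_def] using this
  have hle : eLpNorm (fun y => u (sliceMap i t y)) (ENNReal.ofReal (2 * χ)) volume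
      ≤ M * eLpNorm (fun y => Du (sliceMap i t y)) 2 volume := by
    refine (Lp.eLpNorm_lim_le_liminf_eLpNorm (f := fun j y => φ j (sliceMap i t y))
      (fun j => ((h1 j).continuous.comp (contDiff_sliceMap i t).continuous).aestronglyMeasurable)
      _ ?_).trans ?_
    · filter_upwards [ht1] with y hy
      rw [tendsto_iff_edist_tendsto_0]
      have := (ENNReal.continuous_rpow_const (y := (1 / 2 : ℝ))).tendsto 0 |>.comp hy
      have h8 : ∀ z : ℝ, (‖z‖ₑ ^ 2) ^ (1 / 2 : ℝ) = ‖z‖ₑ := by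
        intro z
        rw [← ENNReal.rpow_natCast, ← ENNReal.rpow_mul]
        norm_num
      simp only [Function.comp_def, h8] at this
      simpa [edist_eq_enorm_sub] using this
    · have h9 : ∀ j, eLpNorm (fun y => φ j (sliceMap i t y)) (ENNReal.ofReal (2 * χ)) volume
          ≤ M * (e j + eLpNorm (fun y => Du (sliceMap i t y)) 2 volume) := by
        intro j
        refine (h x₀ R hR (φ j) (h1 j) (h2 j) (h3 j) i t).trans ?_
        gcongr
        have : (fun y => gradient (φ j) (sliceMap i t y))
            = (fun y => gradient (φ j) (sliceMap i t y) - Du (sliceMap i t y))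
              + fun y => Du (sliceMap i t y) := by
          ext1 y; simp
        rw [this]
        exact eLpNorm_add_le ((hcs j).aestronglyMeasurable.sub hDs) hDs (by norm_num)
      have h10 : Tendsto (fun j => M * (e j + eLpNorm (fun y => Du (sliceMap i t y)) 2 volume))
          atTop (𝓝 (M * eLpNorm (fun y => Du (sliceMap i t y)) 2 volume)) := by
        have := ENNReal.Tendsto.const_mul (a := M)
          (het.add_const (eLpNorm (fun y => Du (sliceMap i t y)) 2 volume)) (Or.inr hMtop)
        simpa using this
      rw [← h10.liminf_eq]
      exact liminf_le_liminf (Eventually.of_forall h9)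
  have hfin := ENNReal.rpow_le_rpow hle (by positivity : 0 ≤ 2 * χ)
  rw [eLpNorm_eq_lintegral_rpow_enorm_toReal (by simpa using hχ0) ENNReal.ofReal_ne_top,
    ENNReal.toReal_ofReal (by positivity), ← ENNReal.rpow_mul, one_div_mul_cancel (by positivity),
    ENNReal.rpow_one, ENNReal.mul_rpow_of_nonneg _ _ (by positivity)] at hfin
  refine hfin.trans (le_of_eq ?_)
  congr 1
  · rw [hM, ENNReal.ofReal_rpow_of_pos (by positivity), Real.mul_rpow hC.le (by positivity),
      ← Real.rpow_mul hR.le]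
    congr 3
    field_simp
  · rw [← eLpNorm_two_sq, ← ENNReal.rpow_natCast, ← ENNReal.rpow_mul]
    norm_num

end Slices

/-! ### One-dimensional optimal cutoffs -/

/-- A one-dimensional cutoff adapted to a weight `g ≤ M h^χ`: since `h` is small, up to a constant,
on at least half of `(ρ, σ)`, letting the cutoff decrease essentially only there makes `∫ g ψ'²` as
small as if `g` were bounded by `M (2H/δ)^χ` throughout, where `H` bounds `∫ h` and `δ = σ - ρ`. -/
lemma exists_cutoff_right {χ ρ σ M H : ℝ} (hχ : 0 < χ) (hρσ : ρ < σ) (hM : 0 < M) (hH : 0 < H)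
    {g h : ℝ → ℝ≥0∞} (hgm : Measurable g) (hhm : Measurable h)
    (hgh : ∀ᵐ t, g t ≤ ENNReal.ofReal M * h t ^ χ) (hhH : ∫⁻ t, h t ≤ ENNReal.ofReal H)
    (hg : ∫⁻ t, g t ≠ ⊤) :
    ∃ ψ : ℝ → ℝ, ContDiff ℝ 1 ψ ∧ (∀ t, 0 ≤ ψ t) ∧ (∀ t, ψ t ≤ 1) ∧ (∀ t ≤ ρ, ψ t = 1) ∧
      (∀ t, σ ≤ t → ψ t = 0) ∧
      ∫⁻ t, g t * ENNReal.ofReal (deriv ψ t ^ 2)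
        ≤ ENNReal.ofReal (32 * M * (2 * H / (σ - ρ)) ^ χ / (σ - ρ)) := by
  set δ := σ - ρ with hδ
  have hδ0 : 0 < δ := sub_pos.2 hρσ
  set B : ℝ := M * (2 * H / δ) ^ χ with hB
  have hB0 : 0 < B := by positivity
  -- the set where `h` is small
  set A : Set ℝ := Set.Ioo ρ σ ∩ ({t | ENNReal.ofReal (2 * H / δ) ≤ h t}ᶜ ∩
    {t | g t ≤ ENNReal.ofReal M * h t ^ χ}) with hA
  have hmark : volume {t | ENNReal.ofReal (2 * H / δ) ≤ h t} ≤ ENNReal.ofReal (δ / 2) := by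
    have h1 := (mul_meas_ge_le_lintegral hhm (ENNReal.ofReal (2 * H / δ))).trans hhH
    have h2 : ENNReal.ofReal H = ENNReal.ofReal (2 * H / δ) * ENNReal.ofReal (δ / 2) := by
      rw [← ENNReal.ofReal_mul (by positivity)]
      congr 1
      field_simp
    rw [h2] at h1
    exact (ENNReal.mul_le_mul_iff_right (by simp; positivity) ENNReal.ofReal_ne_top).1 h1
  have hAm : MeasurableSet A := measurableSet_Ioo.inter
    (((measurableSet_le measurable_const hhm).compl).inter
      (measurableSet_le hgm (measurable_const.mul (hhm.pow_const _))))
  have hAvol : ENNReal.ofReal (δ / 4) < volume A := by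
    have h1 : Set.Ioo ρ σ ⊆ A ∪ ({t | ENNReal.ofReal (2 * H / δ) ≤ h t} ∪
        {t | g t ≤ ENNReal.ofReal M * h t ^ χ}ᶜ) := by
      intro t ht
      by_cases h2 : t ∈ {t | ENNReal.ofReal (2 * H / δ) ≤ h t}
      · exact Or.inr (Or.inl h2)
      · by_cases h3 : t ∈ {t | g t ≤ ENNReal.ofReal M * h t ^ χ}
        · exact Or.inl ⟨ht, h2, h3⟩
        · exact Or.inr (Or.inr h3)
    have h0 : volume {t | g t ≤ ENNReal.ofReal M * h t ^ χ}ᶜ = 0 := hgh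
    have h2 : ENNReal.ofReal δ ≤ volume A + ENNReal.ofReal (δ / 2) := by
      calc ENNReal.ofReal δ = volume (Set.Ioo ρ σ) := by rw [Real.volume_Ioo]
        _ ≤ volume A + (volume {t | ENNReal.ofReal (2 * H / δ) ≤ h t} +
            volume {t | g t ≤ ENNReal.ofReal M * h t ^ χ}ᶜ) :=
          (measure_mono h1).trans ((measure_union_le _ _).trans
            (add_le_add le_rfl (measure_union_le _ _)))
        _ ≤ _ := by
          rw [h0, add_zero]
          gcongr
    by_contra! h3
    have h4 := h2.trans (add_le_add h3 le_rfl)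
    rw [← ENNReal.ofReal_add (by positivity) (by positivity),
      ENNReal.ofReal_le_ofReal_iff (by positivity)] at h4
    linarith
  obtain ⟨K, hKA, hKc, hKvol⟩ := hAm.exists_lt_isCompact hAvol
  have hKB : ∀ t ∈ K, g t ≤ ENNReal.ofReal B := by
    intro t ht
    obtain ⟨-, h2, h3⟩ := hKA ht
    have h4 : h t ≤ ENNReal.ofReal (2 * H / δ) :=
      (not_le.1 (show ¬ ENNReal.ofReal (2 * H / δ) ≤ h t from h2)).le
    refine (show g t ≤ _ from h3).trans ?_
    rw [hB, ENNReal.ofReal_mul hM.le, ← ENNReal.ofReal_rpow_of_pos (by positivity)]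
    gcongr
  set μ : Measure ℝ := volume.withDensity g with hμ
  have : IsFiniteMeasure μ := isFiniteMeasure_withDensity hg
  have hKvol' : volume K ≤ ENNReal.ofReal δ := by
    rw [hδ, ← Real.volume_Ioo]
    exact measure_mono fun t ht => (hKA ht).1
  have hμK : μ K ≤ ENNReal.ofReal (B * δ) := by
    rw [hμ, withDensity_apply _ hKc.measurableSet]
    calc ∫⁻ t in K, g t ≤ ∫⁻ _ in K, ENNReal.ofReal B :=
          setLIntegral_mono measurable_const hKB
      _ = ENNReal.ofReal B * volume K := by rw [setLIntegral_const]
      _ ≤ _ := by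
          rw [ENNReal.ofReal_mul hB0.le]
          gcongr
  obtain ⟨O, hKO, hOo, hO⟩ := hKc.exists_isOpen_lt_add (μ := μ) (ε := ENNReal.ofReal (B * δ))
    (by simp; positivity)
  have hμO : μ O ≤ ENNReal.ofReal (2 * B * δ) := by
    refine hO.le.trans ?_
    rw [show 2 * B * δ = B * δ + B * δ by ring, ENNReal.ofReal_add (by positivity) (by positivity)]
    gcongr
  set O' := O ∩ Set.Ioo ρ σ with hO'
  have hO'o : IsOpen O' := hOo.inter isOpen_Ioo
  have hKO' : K ⊆ O' := fun t ht => ⟨hKO ht, (hKA ht).1⟩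
  obtain ⟨f, hf0, hf1, hf01⟩ := exists_continuous_zero_one_of_isClosed hO'o.isClosed_compl
    hKc.isClosed (Set.disjoint_left.2 fun t ht hK => ht (hKO' hK))
  have hfI : ∀ a b : ℝ, IntervalIntegrable f volume a b := fun a b =>
    f.continuous.intervalIntegrable a b
  have hfz : ∀ t ∉ Set.Ioo ρ σ, f t = 0 := fun t ht => hf0 fun h => ht h.2
  set I : ℝ := ∫ t in ρ..σ, f t with hI
  have hI0 : δ / 4 ≤ I := by
    have hKle : (volume K).toReal ≤ I := by
      rw [hI, intervalIntegral.integral_of_le hρσ.le]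
      have hKI : K ⊆ Set.Ioc ρ σ := fun t ht => Set.Ioo_subset_Ioc_self (hKA ht).1
      calc (volume K).toReal = ∫ t in K, (1 : ℝ) := by simp [Measure.real]
        _ = ∫ t in K, f t := setIntegral_congr_fun hKc.measurableSet fun t ht => (hf1 ht).symm
        _ ≤ ∫ t in Set.Ioc ρ σ, f t := by
          refine setIntegral_mono_set ?_ (Eventually.of_forall fun t => (hf01 t).1)
            hKI.eventuallyLE
          exact (hfI ρ σ).1
    refine le_trans ?_ hKle
    exact (ENNReal.ofReal_le_iff_le_toReal
      (ne_top_of_le_ne_top ENNReal.ofReal_ne_top hKvol')).1 hKvol.le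
  have hIpos : 0 < I := lt_of_lt_of_le (by positivity) hI0
  set ψ : ℝ → ℝ := fun t => 1 - (∫ s in ρ..t, f s) / I with hψ
  have hder : ∀ t, HasDerivAt ψ (-(f t / I)) t := by
    intro t
    have := intervalIntegral.integral_hasDerivAt_right (hfI ρ t)
      (f.continuous.stronglyMeasurableAtFilter _ _) f.continuous.continuousAt
    simpa using (this.div_const I).const_sub 1
  have hderiv : deriv ψ = fun t => -(f t / I) := funext fun t => (hder t).deriv
  have hanti : Antitone ψ := antitone_of_deriv_nonpos (fun t => (hder t).differentiableAt)
    fun t => by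
      rw [hderiv]
      have := div_nonneg (hf01 t).1 hIpos.le
      simpa using this
  have hleft : ∀ t ≤ ρ, ψ t = 1 := by
    intro t ht
    have : ∫ s in ρ..t, f s = 0 := by
      rw [intervalIntegral.integral_congr (g := fun _ => 0), intervalIntegral.integral_zero]
      intro s hs
      rw [Set.uIcc_of_ge ht] at hs
      exact hfz s fun h => absurd h.1 (not_lt.2 hs.2)
    simp [hψ, this]
  have hright : ∀ t, σ ≤ t → ψ t = 0 := by
    intro t ht
    have h1 : ∫ s in σ..t, f s = 0 := by
      rw [intervalIntegral.integral_congr (g := fun _ => 0), intervalIntegral.integral_zero]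
      intro s hs
      rw [Set.uIcc_of_le ht] at hs
      exact hfz s fun h => absurd h.2 (not_lt.2 hs.1)
    have h2 : ∫ s in ρ..t, f s = I := by
      rw [← intervalIntegral.integral_add_adjacent_intervals (hfI ρ σ) (hfI σ t), h1, add_zero]
    simp [hψ, h2, div_self hIpos.ne']
  refine ⟨ψ, ?_, fun t => ?_, fun t => ?_, hleft, hright, ?_⟩
  · rw [contDiff_one_iff_deriv]
    refine ⟨fun t => (hder t).differentiableAt, ?_⟩
    rw [hderiv]
    exact (f.continuous.div_const I).neg
  · rcases le_total t σ with h | h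
    · exact (hright σ le_rfl).symm.le.trans (hanti h)
    · rw [hright t h]
  · rcases le_total t ρ with h | h
    · rw [hleft t h]
    · exact (hanti h).trans (hleft ρ le_rfl).le
  · have hpt : ∀ t, g t * ENNReal.ofReal (deriv ψ t ^ 2)
        ≤ ENNReal.ofReal (16 / δ ^ 2) * O.indicator g t := by
      intro t
      by_cases ht : t ∈ O
      · rw [Set.indicator_of_mem ht, mul_comm]
        gcongr
        rw [hderiv]
        have h1 : f t / I ≤ 1 / (δ / 4) := div_le_div₀ zero_le_one (hf01 t).2 (by positivity) hI0
        have h2 : 0 ≤ f t / I := div_nonneg (hf01 t).1 hIpos.le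
        calc (-(f t / I)) ^ 2 = (f t / I) ^ 2 := by ring
          _ ≤ (1 / (δ / 4)) ^ 2 := pow_le_pow_left₀ h2 h1 2
          _ = 16 / δ ^ 2 := by field_simp; norm_num
      · have : f t = 0 := hf0 fun h => ht h.1
        rw [hderiv]
        simp [this]
    calc ∫⁻ t, g t * ENNReal.ofReal (deriv ψ t ^ 2)
        ≤ ∫⁻ t, ENNReal.ofReal (16 / δ ^ 2) * O.indicator g t := lintegral_mono hpt
      _ = ENNReal.ofReal (16 / δ ^ 2) * μ O := by
          rw [lintegral_const_mul _ (hgm.indicator hOo.measurableSet),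
            lintegral_indicator hOo.measurableSet, hμ, withDensity_apply _ hOo.measurableSet]
      _ ≤ ENNReal.ofReal (16 / δ ^ 2) * ENNReal.ofReal (2 * B * δ) := by gcongr
      _ = _ := by
          rw [← ENNReal.ofReal_mul (by positivity)]
          congr 1
          rw [hB]
          field_simp
          norm_num

/-- The two-sided version of `exists_cutoff_right`, around a centre `c`. -/
lemma exists_cutoff {χ c ρ σ M H : ℝ} (hχ : 0 < χ) (hρσ : ρ < σ) (hM : 0 < M)
    (hH : 0 < H) {g h : ℝ → ℝ≥0∞} (hgm : Measurable g) (hhm : Measurable h)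
    (hgh : ∀ᵐ t, g t ≤ ENNReal.ofReal M * h t ^ χ) (hhH : ∫⁻ t, h t ≤ ENNReal.ofReal H)
    (hg : ∫⁻ t, g t ≠ ⊤) :
    ∃ ζ : ℝ → ℝ, ContDiff ℝ 1 ζ ∧ (∀ t, 0 ≤ ζ t) ∧ (∀ t, ζ t ≤ 1) ∧
      (∀ t, |t - c| ≤ ρ → ζ t = 1) ∧ (∀ t, σ ≤ |t - c| → ζ t = 0) ∧
      ∫⁻ t, g t * ENNReal.ofReal (deriv ζ t ^ 2)
        ≤ ENNReal.ofReal (128 * M * (2 * H / (σ - ρ)) ^ χ / (σ - ρ)) := by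
  have hδ0 : 0 < σ - ρ := sub_pos.2 hρσ
  obtain ⟨ψ₁, a1, a2, a3, a4, a5, a6⟩ := exists_cutoff_right hχ
    (add_lt_add_right hρσ c) hM hH hgm hhm hgh hhH hg
  have hneg : ∀ f : ℝ → ℝ≥0∞, ∫⁻ t, f (-t) = ∫⁻ t, f t := fun f => lintegral_neg_eq_self f
  obtain ⟨ψ₂, b1, b2, b3, b4, b5, b6⟩ := exists_cutoff_right hχ
    (add_lt_add_right hρσ (-c)) hM hH (g := fun t => g (-t)) (h := fun t => h (-t))
    (hgm.comp measurable_neg) (hhm.comp measurable_neg)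
    ((Measure.measurePreserving_neg (volume : Measure ℝ)).quasiMeasurePreserving.ae hgh)
    (by rw [hneg h]; exact hhH) (by rw [hneg g]; exact hg)
  have e1 : c + σ - (c + ρ) = σ - ρ := by ring
  have e2 : -c + σ - (-c + ρ) = σ - ρ := by ring
  rw [e1] at a6
  rw [e2] at b6
  have hψ₂d : ∀ t, HasDerivAt (fun t => ψ₂ (-t)) (-deriv ψ₂ (-t)) t := by
    intro t
    have h1 : HasDerivAt ψ₂ (deriv ψ₂ (-t)) (-t) :=
      (b1.differentiable (by norm_num) _).hasDerivAt
    have := h1.comp t (hasDerivAt_neg t)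
    simpa [Function.comp_def] using this
  refine ⟨fun t => ψ₁ t * ψ₂ (-t), a1.mul (b1.comp contDiff_neg),
    fun t => mul_nonneg (a2 t) (b2 _), fun t => mul_le_one₀ (a3 t) (b2 _) (b3 _), ?_, ?_, ?_⟩
  · intro t ht
    rw [abs_le] at ht
    beta_reduce
    rw [a4 t (by linarith), b4 (-t) (by linarith), one_mul]
  · intro t ht
    beta_reduce
    rcases le_abs.1 ht with h1 | h1
    · rw [a5 t (by linarith), zero_mul]
    · rw [b5 (-t) (by linarith), mul_zero]
  · have hd : ∀ t, deriv (fun t => ψ₁ t * ψ₂ (-t)) t ^ 2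
        ≤ 2 * deriv ψ₁ t ^ 2 + 2 * deriv ψ₂ (-t) ^ 2 := by
      intro t
      have h1 : HasDerivAt ψ₁ (deriv ψ₁ t) t := (a1.differentiable (by norm_num) _).hasDerivAt
      have h2 : HasDerivAt (fun t => ψ₁ t * ψ₂ (-t)) _ t := h1.mul (hψ₂d t)
      rw [h2.deriv]
      have p1 : (deriv ψ₁ t * ψ₂ (-t)) ^ 2 ≤ deriv ψ₁ t ^ 2 := by
        rw [mul_pow]
        exact mul_le_of_le_one_right (sq_nonneg _) (pow_le_one₀ (b2 _) (b3 _))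
      have p2 : (ψ₁ t * -deriv ψ₂ (-t)) ^ 2 ≤ deriv ψ₂ (-t) ^ 2 := by
        rw [mul_pow, neg_sq]
        exact mul_le_of_le_one_left (sq_nonneg _) (pow_le_one₀ (a2 _) (a3 _))
      nlinarith [sq_nonneg (deriv ψ₁ t * ψ₂ (-t) - ψ₁ t * -deriv ψ₂ (-t))]
    have m1 : Measurable fun t => g t * ENNReal.ofReal (deriv ψ₁ t ^ 2) :=
      hgm.mul ((measurable_deriv ψ₁).pow_const 2).ennreal_ofReal
    calc ∫⁻ t, g t * ENNReal.ofReal (deriv (fun t => ψ₁ t * ψ₂ (-t)) t ^ 2)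
        ≤ ∫⁻ t, (2 * (g t * ENNReal.ofReal (deriv ψ₁ t ^ 2))
            + 2 * (g t * ENNReal.ofReal (deriv ψ₂ (-t) ^ 2))) := by
          refine lintegral_mono fun t => ?_
          calc _ ≤ g t * ENNReal.ofReal (2 * deriv ψ₁ t ^ 2 + 2 * deriv ψ₂ (-t) ^ 2) := by
                gcongr; exact hd t
            _ = _ := by
                rw [ENNReal.ofReal_add (by positivity) (by positivity),
                  ENNReal.ofReal_mul (by norm_num), ENNReal.ofReal_mul (by norm_num),
                  ENNReal.ofReal_ofNat]
                ring
      _ = 2 * (∫⁻ t, g t * ENNReal.ofReal (deriv ψ₁ t ^ 2))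
            + 2 * ∫⁻ t, g t * ENNReal.ofReal (deriv ψ₂ (-t) ^ 2) := by
          rw [lintegral_add_left (m1.const_mul 2), lintegral_const_mul' _ _ (by norm_num),
            lintegral_const_mul' _ _ (by norm_num)]
      _ = 2 * (∫⁻ t, g t * ENNReal.ofReal (deriv ψ₁ t ^ 2))
            + 2 * ∫⁻ t, g (-t) * ENNReal.ofReal (deriv ψ₂ t ^ 2) := by
          rw [← hneg (fun t => g t * ENNReal.ofReal (deriv ψ₂ (-t) ^ 2))]
          simp
      _ ≤ 2 * ENNReal.ofReal (32 * M * (2 * H / (σ - ρ)) ^ χ / (σ - ρ))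
            + 2 * ENNReal.ofReal (32 * M * (2 * H / (σ - ρ)) ^ χ / (σ - ρ)) := by
          gcongr
      _ = _ := by
          rw [← ENNReal.ofReal_ofNat 2, ← ENNReal.ofReal_mul (by norm_num),
            ← ENNReal.ofReal_add (by positivity) (by positivity)]
          congr 1
          ring

/-! ### Product cutoffs and one step of the iteration -/

/-- The open cube `{x : |xᵢ - cᵢ| < r for all i}`. -/
def openCube {n : ℕ} (c : EuclideanSpace ℝ (Fin n)) (r : ℝ) : Set (EuclideanSpace ℝ (Fin n)) :=
  {x | ∀ i, |x i - c i| < r}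

lemma isOpen_openCube {n : ℕ} (c : EuclideanSpace ℝ (Fin n)) (r : ℝ) : IsOpen (openCube c r) := by
  have : openCube c r = ⋂ i, {x | |x i - c i| < r} := by
    ext x; simp [openCube]
  rw [this]
  refine isOpen_iInter_of_finite fun i => isOpen_lt ?_ continuous_const
  fun_prop

lemma openCube_mono {n : ℕ} (c : EuclideanSpace ℝ (Fin n)) {r s : ℝ} (h : r ≤ s) :
    openCube c r ⊆ openCube c s := fun _ hx i => (hx i).trans_le h

section ProductCutoff

variable {n : ℕ}

lemma contDiff_prod_apply {ζ : Fin n → ℝ → ℝ} (hζ : ∀ i, ContDiff ℝ 1 (ζ i)) :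
    ContDiff ℝ 1 fun x : EuclideanSpace ℝ (Fin n) => ∏ i, ζ i (x i) :=
  contDiff_prod fun i _ => (hζ i).comp (EuclideanSpace.proj (𝕜 := ℝ) i).contDiff

/-- The gradient of a product cutoff is controlled by the one-dimensional derivatives. -/
lemma norm_gradient_prod_sq_le {c : EuclideanSpace ℝ (Fin n)} {σ : ℝ} {ζ : Fin n → ℝ → ℝ}
    (hζ : ∀ i, ContDiff ℝ 1 (ζ i)) (h0 : ∀ i t, 0 ≤ ζ i t) (h1 : ∀ i t, ζ i t ≤ 1)
    (hσ : ∀ i t, σ ≤ |t - c i| → ζ i t = 0) (x : EuclideanSpace ℝ (Fin n)) :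
    ‖gradient (fun x : EuclideanSpace ℝ (Fin n) => ∏ i, ζ i (x i)) x‖ ^ 2
      ≤ (openCube c σ).indicator (fun x => ∑ i, deriv (ζ i) (x i) ^ 2) x := by
  have hi : ∀ i, HasFDerivAt (fun x : EuclideanSpace ℝ (Fin n) => ζ i (x i))
      (deriv (ζ i) (x i) • (EuclideanSpace.proj i : EuclideanSpace ℝ (Fin n) →L[ℝ] ℝ)) x :=
    fun i => (((hζ i).differentiable (by norm_num) _).hasDerivAt).comp_hasFDerivAt x
      (EuclideanSpace.proj (𝕜 := ℝ) i).hasFDerivAt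
  have hprod : HasFDerivAt (fun x : EuclideanSpace ℝ (Fin n) => ∏ i, ζ i (x i)) _ x :=
    HasFDerivAt.finsetProd (u := Finset.univ) fun i _ => hi i
  have hcomp : ∀ j, gradient (fun x : EuclideanSpace ℝ (Fin n) => ∏ i, ζ i (x i)) x j
      = (∏ i ∈ Finset.univ.erase j, ζ i (x i)) * deriv (ζ j) (x j) := by
    intro j
    have h2 : gradient (fun x : EuclideanSpace ℝ (Fin n) => ∏ i, ζ i (x i)) x j
        = inner ℝ (gradient (fun x : EuclideanSpace ℝ (Fin n) => ∏ i, ζ i (x i)) x)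
          (EuclideanSpace.single j (1 : ℝ)) := by
      rw [EuclideanSpace.inner_single_right]
      simp
    rw [h2, inner_gradient_left, hprod.fderiv]
    simp
  rw [EuclideanSpace.norm_sq_eq]
  simp_rw [hcomp]
  have hle : ∀ j, ‖(∏ i ∈ Finset.univ.erase j, ζ i (x i)) * deriv (ζ j) (x j)‖ ^ 2
      ≤ deriv (ζ j) (x j) ^ 2 := by
    intro j
    rw [Real.norm_eq_abs, sq_abs, mul_pow]
    refine mul_le_of_le_one_left (sq_nonneg _) (pow_le_one₀ ?_ ?_)
    · exact Finset.prod_nonneg fun i _ => h0 i _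
    · exact Finset.prod_le_one (fun i _ => h0 i _) fun i _ => h1 i _
  by_cases hx : x ∈ openCube c σ
  · rw [Set.indicator_of_mem hx]
    exact Finset.sum_le_sum fun j _ => hle j
  · rw [Set.indicator_of_notMem hx]
    obtain ⟨k, hk⟩ : ∃ k, σ ≤ |x k - c k| := by
      simpa [openCube] using hx
    refine (Finset.sum_eq_zero fun j _ => ?_).le
    by_cases hjk : j = k
    · subst hjk
      have hmin : IsLocalMin (ζ j) (x j) := Eventually.of_forall fun t => by
        rw [hσ j _ hk]; exact h0 j t
      simp [hmin.deriv_eq_zero]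
    · rw [Finset.prod_eq_zero (Finset.mem_erase.2 ⟨Ne.symm hjk, Finset.mem_univ k⟩) (hσ k _ hk)]
      simp

lemma tsupport_prod_subset {c : EuclideanSpace ℝ (Fin n)} {σ : ℝ} {ζ : Fin n → ℝ → ℝ}
    (hσ : ∀ i t, σ ≤ |t - c i| → ζ i t = 0) :
    tsupport (fun x : EuclideanSpace ℝ (Fin n) => ∏ i, ζ i (x i)) ⊆ {x | ∀ i, |x i - c i| ≤ σ} := by
  refine closure_minimal (fun x hx i => ?_) ?_
  · by_contra! h
    exact hx (Finset.prod_eq_zero (Finset.mem_univ i) (hσ i _ h.le))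
  · have : {x : EuclideanSpace ℝ (Fin n) | ∀ i, |x i - c i| ≤ σ} = ⋂ i, {x | |x i - c i| ≤ σ} := by
      ext x; simp
    rw [this]
    refine isClosed_iInter fun i => isClosed_le ?_ continuous_const
    fun_prop

end ProductCutoff

section Step

variable {d : ℕ}

/-- A product cutoff between two concentric cubes, optimized in each coordinate direction for the
weight `f`, whose integrals over the hyperplanes `xᵢ = t` are bounded by `M hᵢ(t)^χ`. -/
lemma exists_cutoff_lintegral_le {χ M H ρ σ : ℝ} (hχ : 0 < χ) (hM : 0 < M) (hH : 0 < H)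
    (hρσ : ρ < σ) (c : EuclideanSpace ℝ (Fin (d + 1)))
    {f : EuclideanSpace ℝ (Fin (d + 1)) → ℝ≥0∞} (hfm : Measurable f) (hfint : ∫⁻ x, f x ≠ ⊤)
    {h : Fin (d + 1) → ℝ → ℝ≥0∞} (hhm : ∀ i, Measurable (h i))
    (hfh : ∀ i, ∀ᵐ t : ℝ, ∫⁻ y, f (sliceMap i t y) ≤ ENNReal.ofReal M * h i t ^ χ)
    (hhH : ∀ i, ∫⁻ t, h i t ≤ ENNReal.ofReal H) :
    ∃ η : EuclideanSpace ℝ (Fin (d + 1)) → ℝ, ContDiff ℝ 1 η ∧ (∀ x, 0 ≤ η x) ∧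
      tsupport η ⊆ {x | ∀ i, |x i - c i| ≤ σ} ∧ (∀ x ∈ openCube c ρ, η x = 1) ∧
      (∀ x ∉ openCube c σ, gradient η x = 0) ∧
      ∫⁻ x, f x * ENNReal.ofReal (‖gradient η x‖ ^ 2)
        ≤ ENNReal.ofReal ((d + 1) * (128 * M * (2 * H / (σ - ρ)) ^ χ / (σ - ρ))) := by
  have hδ0 : 0 < σ - ρ := sub_pos.2 hρσ
  have hcut := fun i : Fin (d + 1) => exists_cutoff (c := c i) hχ hρσ hM hH
    (measurable_lintegral_sliceMap i hfm) (hhm i) (hfh i) (hhH i)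
    (by rwa [← lintegral_eq_lintegral_sliceMap i hfm])
  choose ζ z1 z2 z3 z4 z5 z6 using hcut
  have hgle := norm_gradient_prod_sq_le (c := c) z1 z2 z3 z5
  refine ⟨fun x => ∏ i, ζ i (x i), contDiff_prod_apply z1,
    fun x => Finset.prod_nonneg fun i _ => z2 i _, tsupport_prod_subset z5,
    fun x hx => Finset.prod_eq_one fun i _ => z4 i _ (hx i).le, fun x hx => ?_, ?_⟩
  · have h1 := hgle x
    rw [Set.indicator_of_notMem hx] at h1
    exact norm_eq_zero.1 (pow_eq_zero_iff two_ne_zero |>.1 (le_antisymm h1 (sq_nonneg _)))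
  have hpt : ∀ x, f x * ENNReal.ofReal
      (‖gradient (fun x : EuclideanSpace ℝ (Fin (d + 1)) => ∏ i, ζ i (x i)) x‖ ^ 2)
      ≤ ∑ i, f x * ENNReal.ofReal (deriv (ζ i) (x i) ^ 2) := by
    intro x
    rw [← Finset.mul_sum, ← ENNReal.ofReal_sum_of_nonneg fun i _ => sq_nonneg _]
    gcongr
    refine (hgle x).trans (Set.indicator_le_self' (fun x _ => ?_) x)
    exact Finset.sum_nonneg fun i _ => sq_nonneg _
  have hdm : ∀ i, Measurable fun x : EuclideanSpace ℝ (Fin (d + 1)) =>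
      ENNReal.ofReal (deriv (ζ i) (x i) ^ 2) := fun i =>
    (((measurable_deriv (ζ i)).comp
      (EuclideanSpace.proj (𝕜 := ℝ) i).continuous.measurable).pow_const 2).ennreal_ofReal
  calc _ ≤ ∫⁻ x, ∑ i, f x * ENNReal.ofReal (deriv (ζ i) (x i) ^ 2) := lintegral_mono hpt
    _ = ∑ i, ∫⁻ x, f x * ENNReal.ofReal (deriv (ζ i) (x i) ^ 2) :=
        lintegral_finsetSum _ fun i _ => hfm.mul (hdm i)
    _ ≤ ∑ _i : Fin (d + 1), ENNReal.ofReal (128 * M * (2 * H / (σ - ρ)) ^ χ / (σ - ρ)) := by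
        refine Finset.sum_le_sum fun i _ => ?_
        rw [lintegral_eq_lintegral_sliceMap i
          (f := fun x => f x * ENNReal.ofReal (deriv (ζ i) (x i) ^ 2)) (hfm.mul (hdm i))]
        refine le_trans (le_of_eq (lintegral_congr fun t => ?_)) (z6 i)
        simp only [sliceMap_self]
        rw [lintegral_mul_const' _ _ ENNReal.ofReal_ne_top]
    _ = _ := by
        rw [Finset.sum_const, Finset.card_univ, Fintype.card_fin, nsmul_eq_mul,
          ENNReal.ofReal_mul (by positivity)]
        congr 1
        rw [← Nat.cast_succ, ENNReal.ofReal_natCast]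

/-- `(V - l)₊²` restricted to a cube, as an extended nonnegative function. -/
noncomputable def truncSq (V : EuclideanSpace ℝ (Fin (d + 1)) → ℝ)
    (c : EuclideanSpace ℝ (Fin (d + 1))) (σ l : ℝ) : EuclideanSpace ℝ (Fin (d + 1)) → ℝ≥0∞ :=
  (openCube c σ).indicator fun x => ENNReal.ofReal (max (V x - l) 0 ^ 2)

lemma measurable_truncSq {V : EuclideanSpace ℝ (Fin (d + 1)) → ℝ} (hV : Measurable V)
    (c : EuclideanSpace ℝ (Fin (d + 1))) (σ l : ℝ) : Measurable (truncSq V c σ l) :=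
  ((((hV.sub_const l).max measurable_const).pow_const 2).ennreal_ofReal).indicator
    (isOpen_openCube c σ).measurableSet

lemma lintegral_truncSq_ne_top {V : EuclideanSpace ℝ (Fin (d + 1)) → ℝ} (hVm : MemLp V 2 volume)
    (c : EuclideanSpace ℝ (Fin (d + 1))) (σ : ℝ) {l : ℝ} (hl : 0 ≤ l) :
    ∫⁻ x, truncSq V c σ l x ≠ ⊤ := by
  refine ne_top_of_le_ne_top (b := ∫⁻ x, ‖V x‖ₑ ^ 2) ?_ (lintegral_mono fun x => ?_)
  · rw [← eLpNorm_two_sq]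
    exact ENNReal.pow_ne_top hVm.2.ne
  · refine (Set.indicator_le_self _ _ x).trans ?_
    rw [ENNReal.ofReal_pow (le_max_right _ _), ← Real.enorm_eq_ofReal (le_max_right _ _)]
    gcongr
    rw [enorm_le_iff_norm_le, Real.norm_of_nonneg (le_max_right _ _), Real.norm_eq_abs]
    exact max_le ((sub_le_self _ hl).trans (le_abs_self _)) (abs_nonneg _)

lemma lintegral_truncSq_mul_gradient {V η : EuclideanSpace ℝ (Fin (d + 1)) → ℝ}
    {c : EuclideanSpace ℝ (Fin (d + 1))} {σ l : ℝ} (hη : ∀ x ∉ openCube c σ, gradient η x = 0) :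
    ∫⁻ x, ENNReal.ofReal (max (V x - l) 0 ^ 2 * ‖gradient η x‖ ^ 2)
      = ∫⁻ x, truncSq V c σ l x * ENNReal.ofReal (‖gradient η x‖ ^ 2) := by
  refine lintegral_congr fun x => ?_
  by_cases hx : x ∈ openCube c σ
  · rw [truncSq, Set.indicator_of_mem hx, ENNReal.ofReal_mul (sq_nonneg _)]
  · simp [hη x hx]

/-- The gradient of the localized truncation `η (V - k)₊`. -/
noncomputable def truncGrad (V : EuclideanSpace ℝ (Fin (d + 1)) → ℝ)
    (DV : EuclideanSpace ℝ (Fin (d + 1)) → EuclideanSpace ℝ (Fin (d + 1))) (k : ℝ)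
    (η : EuclideanSpace ℝ (Fin (d + 1)) → ℝ) (x : EuclideanSpace ℝ (Fin (d + 1))) :
    EuclideanSpace ℝ (Fin (d + 1)) :=
  max (V x - k) 0 • gradient η x + η x • {x | k < V x}.indicator DV x

lemma stronglyMeasurable_truncGrad {V η : EuclideanSpace ℝ (Fin (d + 1)) → ℝ}
    {DV : EuclideanSpace ℝ (Fin (d + 1)) → EuclideanSpace ℝ (Fin (d + 1))}
    (hV : StronglyMeasurable V) (hDV : StronglyMeasurable DV) (k : ℝ) (hη : ContDiff ℝ 1 η) :
    StronglyMeasurable (truncGrad V DV k η) :=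
  (((hV.measurable.sub_const k).max measurable_const).stronglyMeasurable.smul
    (continuous_gradient hη).stronglyMeasurable).add
    (hη.continuous.stronglyMeasurable.smul
      (hDV.indicator (measurableSet_lt measurable_const hV.measurable)))

/-- One step of the De Giorgi iteration: if `η = 1` on a cube, the energy of `η (V - k)₊` controls
`∫ (V - l)₊² |∇η'|²` for a suitable cutoff `η'` inside that cube. The power `χ > 1` of the energy
comes from the Sobolev inequality on hyperplanes. -/
lemma exists_cutoff_energy_le {χ : ℝ} (hχ : 1 < χ) {C₁ : ℝ} (hC₁ : 0 < C₁)
    {V : EuclideanSpace ℝ (Fin (d + 1)) → ℝ}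
    (hVs : StronglyMeasurable V) (hVm : MemLp V 2 volume)
    {η : EuclideanSpace ℝ (Fin (d + 1)) → ℝ}
    {Du : EuclideanSpace ℝ (Fin (d + 1)) → EuclideanSpace ℝ (Fin (d + 1))}
    (hDu : StronglyMeasurable Du) {k l : ℝ} (hk : 0 ≤ k) (hkl : k < l)
    (hsob : ∀ i : Fin (d + 1), ∀ᵐ t : ℝ,
      ∫⁻ y, ‖η (sliceMap i t y) * max (V (sliceMap i t y) - k) 0‖ₑ ^ (2 * χ)
        ≤ ENNReal.ofReal C₁ * (∫⁻ y, ‖Du (sliceMap i t y)‖ₑ ^ 2) ^ χ)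
    {c : EuclideanSpace ℝ (Fin (d + 1))} {ρ σ : ℝ} (hρσ : ρ < σ)
    (hησ : ∀ x ∈ openCube c σ, η x = 1) {H : ℝ} (hH : 0 < H)
    (hDuH : ∫⁻ x, ‖Du x‖ₑ ^ 2 ≤ ENNReal.ofReal H) :
    ∃ η' : EuclideanSpace ℝ (Fin (d + 1)) → ℝ, ContDiff ℝ 1 η' ∧ (∀ x, 0 ≤ η' x) ∧
      tsupport η' ⊆ {x | ∀ i, |x i - c i| ≤ σ} ∧ (∀ x ∈ openCube c ρ, η' x = 1) ∧
      ∫⁻ x, ENNReal.ofReal (max (V x - l) 0 ^ 2 * ‖gradient η' x‖ ^ 2)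
        ≤ ENNReal.ofReal ((d + 1) * (128 * (C₁ * (l - k) ^ (2 - 2 * χ)) *
          (2 * H / (σ - ρ)) ^ χ / (σ - ρ))) := by
  have hlk : 0 < l - k := sub_pos.2 hkl
  -- on `{V > l}` one has `(V - l)² ≤ (l - k)^(2 - 2χ) (V - k)^(2χ)`
  have hfle : ∀ x, truncSq V c σ l x ≤ ENNReal.ofReal ((l - k) ^ (2 - 2 * χ)) *
      ‖η x * max (V x - k) 0‖ₑ ^ (2 * χ) := by
    intro x
    by_cases hx : x ∈ openCube c σ
    · rw [truncSq, Set.indicator_of_mem hx, hησ x hx, one_mul,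
        Real.enorm_eq_ofReal (le_max_right _ _),
        ENNReal.ofReal_rpow_of_nonneg (le_max_right _ _) (by linarith),
        ← ENNReal.ofReal_mul (by positivity)]
      refine ENNReal.ofReal_le_ofReal ?_
      rcases le_total (V x) l with hVl | hVl
      · rw [max_eq_right (by linarith)]
        exact (by simp : ((0 : ℝ) ^ 2) = 0).le.trans
          (mul_nonneg (by positivity) (Real.rpow_nonneg (le_max_right _ _) _))
      · rw [max_eq_left (by linarith), max_eq_left (by linarith)]
        have h1 : 0 < V x - k := by linarith
        calc (V x - l) ^ 2 ≤ (V x - k) ^ 2 := pow_le_pow_left₀ (by linarith) (by linarith) 2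
          _ = (V x - k) ^ (2 - 2 * χ) * (V x - k) ^ (2 * χ) := by
            rw [← Real.rpow_add h1, sub_add_cancel, Real.rpow_two]
          _ ≤ _ := by
            refine mul_le_mul_of_nonneg_right ?_ (by positivity)
            exact Real.rpow_le_rpow_of_nonpos hlk (by linarith) (by linarith)
    · rw [truncSq, Set.indicator_of_notMem hx]
      exact zero_le
  have hDm : Measurable fun x => ‖Du x‖ₑ ^ 2 := hDu.enorm.pow_const 2
  obtain ⟨η', e1, e2, e3, e4, e5, e6⟩ := exists_cutoff_lintegral_le (f := truncSq V c σ l)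
    (h := fun i t => ∫⁻ y, ‖Du (sliceMap i t y)‖ₑ ^ 2) (M := C₁ * (l - k) ^ (2 - 2 * χ))
    (lt_trans zero_lt_one hχ) (by positivity) hH hρσ c (measurable_truncSq hVs.measurable c σ l)
    (lintegral_truncSq_ne_top hVm c σ (hk.trans hkl.le))
    (fun i => measurable_lintegral_sliceMap i hDm)
    (fun i => by
      filter_upwards [hsob i] with t ht
      calc ∫⁻ y, truncSq V c σ l (sliceMap i t y)
          ≤ ∫⁻ y, ENNReal.ofReal ((l - k) ^ (2 - 2 * χ)) *
            ‖η (sliceMap i t y) * max (V (sliceMap i t y) - k) 0‖ₑ ^ (2 * χ) :=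
            lintegral_mono fun y => hfle _
        _ = ENNReal.ofReal ((l - k) ^ (2 - 2 * χ)) * ∫⁻ y,
            ‖η (sliceMap i t y) * max (V (sliceMap i t y) - k) 0‖ₑ ^ (2 * χ) :=
            lintegral_const_mul' _ _ ENNReal.ofReal_ne_top
        _ ≤ _ := by
            rw [mul_comm C₁, ENNReal.ofReal_mul (by positivity), mul_assoc]
            gcongr)
    (fun i => by rwa [← lintegral_eq_lintegral_sliceMap i hDm])
  refine ⟨η', e1, e2, e3, e4, ?_⟩
  rwa [lintegral_truncSq_mul_gradient e5]

/-- The initial cutoff: a smooth bump between two cubes, with the usual bound on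
`∫ V₊² |∇η|²`. -/
lemma exists_cutoff_initial_le {V : EuclideanSpace ℝ (Fin (d + 1)) → ℝ}
    (hVs : StronglyMeasurable V) (hVm : MemLp V 2 volume)
    (c : EuclideanSpace ℝ (Fin (d + 1))) {ρ σ : ℝ} (hρσ : ρ < σ) {S : ℝ} (hS : 0 < S)
    (hVS : ∫⁻ x, truncSq V c σ 0 x ≤ ENNReal.ofReal S) :
    ∃ η : EuclideanSpace ℝ (Fin (d + 1)) → ℝ, ContDiff ℝ 1 η ∧ (∀ x, 0 ≤ η x) ∧
      tsupport η ⊆ {x | ∀ i, |x i - c i| ≤ σ} ∧ (∀ x ∈ openCube c ρ, η x = 1) ∧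
      ∫⁻ x, ENNReal.ofReal (max (V x - 0) 0 ^ 2 * ‖gradient η x‖ ^ 2)
        ≤ ENNReal.ofReal ((d + 1) * (256 * S / (σ - ρ) ^ 2)) := by
  have hδ0 : 0 < σ - ρ := sub_pos.2 hρσ
  have hm := measurable_truncSq hVs.measurable c σ 0
  -- the weight itself serves as the dominating function, with exponent `1`
  obtain ⟨η, e1, e2, e3, e4, e5, e6⟩ := exists_cutoff_lintegral_le (f := truncSq V c σ 0)
    (h := fun i t => ∫⁻ y, truncSq V c σ 0 (sliceMap i t y)) (M := 1) (χ := 1)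
    zero_lt_one zero_lt_one hS hρσ c hm (lintegral_truncSq_ne_top hVm c σ le_rfl)
    (fun i => measurable_lintegral_sliceMap i hm)
    (fun i => Eventually.of_forall fun t => by simp)
    (fun i => by rwa [← lintegral_eq_lintegral_sliceMap i hm])
  refine ⟨η, e1, e2, e3, e4, ?_⟩
  rw [lintegral_truncSq_mul_gradient e5]
  convert e6 using 3
  rw [Real.rpow_one]
  field_simp
  norm_num

end Step

/-! ### The De Giorgi iteration -/

section

/-- The recursion of the De Giorgi iteration: with the decay rate `2^{-(3χ-1)/(χ-1)}` all powers of
`2^{-j}` cancel, so that the inequality for `j = 0` implies the others. -/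
lemma deGiorgi_recursion {χ A K H r : ℝ} (hχ : 1 < χ) (hK : 0 < K) (hH : 0 < H)
    (hr : 0 < r)
    (h : A * (K / 2) ^ (2 - 2 * χ) * (16 * H / r) ^ χ / (r / 8)
      ≤ H * (1 / 2 : ℝ) ^ ((3 * χ - 1) / (χ - 1))) (j : ℕ) :
    A * (K * (1 / 2) ^ (j + 1)) ^ (2 - 2 * χ) *
      (2 * (H * ((1 / 2 : ℝ) ^ ((3 * χ - 1) / (χ - 1))) ^ j) / (r * (1 / 2) ^ (j + 3))) ^ χ /
        (r * (1 / 2) ^ (j + 3))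
      ≤ H * ((1 / 2 : ℝ) ^ ((3 * χ - 1) / (χ - 1))) ^ (j + 1) := by
  set e := (3 * χ - 1) / (χ - 1) with he
  have hχ1 : χ - 1 ≠ 0 := (sub_pos.2 hχ).ne'
  have hee : e * (χ - 1) = 3 * χ - 1 := div_mul_cancel₀ _ hχ1
  set s : ℝ := (1 / 2) ^ j with hs
  have hs0 : 0 < s := by positivity
  have h1 : ((1 / 2 : ℝ) ^ e) ^ j = s ^ e := by
    rw [hs, ← Real.rpow_natCast, ← Real.rpow_natCast, ← Real.rpow_mul (by norm_num),
      ← Real.rpow_mul (by norm_num), mul_comm]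
  have h2 : K * (1 / 2) ^ (j + 1) = (K / 2) * s := by rw [pow_succ]; ring
  have h3 : r * (1 / 2 : ℝ) ^ (j + 3) = r / 8 * s := by rw [pow_add]; ring
  rw [h2, h3, pow_succ _ j, h1]
  have h4 : 2 * (H * s ^ e) / (r / 8 * s) = (16 * H / r) * s ^ (e - 1) := by
    rw [Real.rpow_sub_one hs0.ne']
    field_simp
    norm_num
  have h5 : (K / 2 * s) ^ (2 - 2 * χ) * ((16 * H / r) * s ^ (e - 1)) ^ χ / s
      = (K / 2) ^ (2 - 2 * χ) * (16 * H / r) ^ χ * s ^ e := by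
    rw [Real.mul_rpow (by positivity) hs0.le, Real.mul_rpow (by positivity) (by positivity),
      ← Real.rpow_mul hs0.le]
    have h6 : s ^ e = s ^ (2 - 2 * χ) * s ^ ((e - 1) * χ) / s := by
      rw [← Real.rpow_add hs0, ← Real.rpow_sub_one hs0.ne']
      congr 1
      linarith
    rw [h6]
    ring
  rw [h4]
  calc A * (K / 2 * s) ^ (2 - 2 * χ) * ((16 * H / r) * s ^ (e - 1)) ^ χ / (r / 8 * s)
      = A * ((K / 2 * s) ^ (2 - 2 * χ) * ((16 * H / r) * s ^ (e - 1)) ^ χ / s) / (r / 8) := by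
        field_simp
    _ = A * (K / 2) ^ (2 - 2 * χ) * (16 * H / r) ^ χ / (r / 8) * s ^ e := by
        rw [h5]; ring
    _ ≤ H * (1 / 2 : ℝ) ^ e * s ^ e := by gcongr
    _ = H * (s ^ e * (1 / 2) ^ e) := by ring

variable {d : ℕ}

/-- The De Giorgi iteration on a cube, from the energy estimate `hen` for truncations and the
Sobolev inequality `hsob` on hyperplanes. -/
lemma ae_le_of_energy_of_sobolev {χ C₁ L r K H S : ℝ} (hχ : 1 < χ) (hC₁ : 0 < C₁) (hL : 0 < L)
    (hr : 0 < r) (hK : 0 < K) (hS : 0 < S)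
    {V : EuclideanSpace ℝ (Fin (d + 1)) → ℝ}
    {DV : EuclideanSpace ℝ (Fin (d + 1)) → EuclideanSpace ℝ (Fin (d + 1))}
    (hVs : StronglyMeasurable V) (hDVs : StronglyMeasurable DV) (hVm : MemLp V 2 volume)
    (c : EuclideanSpace ℝ (Fin (d + 1)))
    (hen : ∀ (η : EuclideanSpace ℝ (Fin (d + 1)) → ℝ) (k : ℝ), ContDiff ℝ 1 η → (∀ x, 0 ≤ η x) →
      tsupport η ⊆ {x | ∀ i, |x i - c i| ≤ r} → 0 ≤ k →
      ∫⁻ x, ‖truncGrad V DV k η x‖ₑ ^ 2 ≤ ENNReal.ofReal (10 * L) *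
        ∫⁻ x, ENNReal.ofReal (max (V x - k) 0 ^ 2 * ‖gradient η x‖ ^ 2))
    (hsob : ∀ (η : EuclideanSpace ℝ (Fin (d + 1)) → ℝ) (k : ℝ), ContDiff ℝ 1 η → (∀ x, 0 ≤ η x) →
      tsupport η ⊆ {x | ∀ i, |x i - c i| ≤ r} → 0 ≤ k → ∀ i : Fin (d + 1), ∀ᵐ t : ℝ,
      ∫⁻ y, ‖η (sliceMap i t y) * max (V (sliceMap i t y) - k) 0‖ₑ ^ (2 * χ)
        ≤ ENNReal.ofReal C₁ * (∫⁻ y, ‖truncGrad V DV k η (sliceMap i t y)‖ₑ ^ 2) ^ χ)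
    (hVS : ∫⁻ x, truncSq V c r 0 x ≤ ENNReal.ofReal S)
    (hH : 10 * L * ((d + 1) * (256 * S / (r / 4) ^ 2)) ≤ H)
    (hKH : (10 * L * ((d + 1) * 128 * C₁)) * (K / 2) ^ (2 - 2 * χ) * (16 * H / r) ^ χ / (r / 8)
      ≤ H * (1 / 2 : ℝ) ^ ((3 * χ - 1) / (χ - 1))) :
    ∀ᵐ x, x ∈ openCube c (r / 2) → V x ≤ K := by
  have hH0 : 0 < H := lt_of_lt_of_le (by positivity) hH
  set θ : ℝ := (1 / 2 : ℝ) ^ ((3 * χ - 1) / (χ - 1)) with hθ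
  have hθ0 : 0 < θ := by positivity
  have hθ1 : θ < 1 := Real.rpow_lt_one (by norm_num) (by norm_num)
    (div_pos (by linarith) (by linarith))
  set R : ℕ → ℝ := fun j => r / 2 * (1 + (1 / 2) ^ j) with hR
  set k : ℕ → ℝ := fun j => K * (1 - (1 / 2) ^ j) with hk
  have hRgap : ∀ j, R j - R (j + 1) = r * (1 / 2) ^ (j + 2) := fun j => by
    simp only [hR, pow_succ]; ring
  have hRle : ∀ j, R j ≤ r := fun j => by
    have : (1 / 2 : ℝ) ^ j ≤ 1 := pow_le_one₀ (by norm_num) (by norm_num)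
    simp only [hR]
    nlinarith
  have hRge : ∀ j, r / 2 ≤ R j := fun j => by
    have : (0 : ℝ) < (1 / 2 : ℝ) ^ j := by positivity
    simp only [hR]
    nlinarith
  have hkgap : ∀ j, k (j + 1) - k j = K * (1 / 2) ^ (j + 1) := fun j => by
    simp only [hk, pow_succ]; ring
  have hk0 : ∀ j, 0 ≤ k j := fun j => by
    have : (1 / 2 : ℝ) ^ j ≤ 1 := pow_le_one₀ (by norm_num) (by norm_num)
    exact mul_nonneg hK.le (by linarith)
  have hkK : ∀ j, k j ≤ K := fun j => by
    have : (0 : ℝ) < (1 / 2 : ℝ) ^ j := by positivity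
    simp only [hk]
    nlinarith
  -- the energies of the successive truncations decay geometrically
  have hiter : ∀ j : ℕ, ∃ η : EuclideanSpace ℝ (Fin (d + 1)) → ℝ, ContDiff ℝ 1 η ∧
      (∀ x, 0 ≤ η x) ∧ tsupport η ⊆ {x | ∀ i, |x i - c i| ≤ r} ∧
      (∀ x ∈ openCube c (R (j + 1)), η x = 1) ∧
      ∫⁻ x, ‖truncGrad V DV (k j) η x‖ₑ ^ 2 ≤ ENNReal.ofReal (H * θ ^ j) := by
    intro j
    induction j with
    | zero =>
      have hR0 : R 0 = r := by simp only [hR, pow_zero]; ring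
      have hgap := hRgap 0
      have hlt : R 1 < R 0 := by
        have : (0 : ℝ) < r * (1 / 2) ^ (0 + 2) := by positivity
        rw [zero_add] at hgap
        linarith
      obtain ⟨η, e1, e2, e3, e4, e5⟩ := exists_cutoff_initial_le hVs hVm c hlt hS
        (by rwa [hR0])
      have hk00 : k 0 = 0 := by simp [hk]
      refine ⟨η, e1, e2, fun x hx i => (e3 hx i).trans (hRle 0), e4, ?_⟩
      refine (hen η (k 0) e1 e2 (fun x hx i => (e3 hx i).trans (hRle 0)) (hk0 0)).trans ?_
      rw [hk00]
      calc _ ≤ ENNReal.ofReal (10 * L) *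
            ENNReal.ofReal ((d + 1) * (256 * S / (R 0 - R 1) ^ 2)) := by gcongr
        _ ≤ _ := by
          rw [← ENNReal.ofReal_mul (by positivity), pow_zero, mul_one]
          refine ENNReal.ofReal_le_ofReal (le_trans (le_of_eq ?_) hH)
          rw [zero_add] at hgap
          rw [hgap, show r * (1 / 2 : ℝ) ^ (0 + 2) = r / 4 by ring]
    | succ j ih =>
      obtain ⟨η, e1, e2, e3, e4, e5⟩ := ih
      have hlt : R (j + 1 + 1) < R (j + 1) := by
        have := hRgap (j + 1)
        have : (0 : ℝ) < r * (1 / 2) ^ (j + 1 + 2) := by positivity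
        linarith
      have hkl : k j < k (j + 1) := by
        have := hkgap j
        have : (0 : ℝ) < K * (1 / 2) ^ (j + 1) := by positivity
        linarith
      obtain ⟨η', f1, f2, f3, f4, f5⟩ := exists_cutoff_energy_le hχ hC₁ hVs hVm
        (stronglyMeasurable_truncGrad hVs hDVs (k j) e1) (hk0 j) hkl (hsob η (k j) e1 e2 e3 (hk0 j))
        hlt e4 (by positivity) e5
      have f3' : tsupport η' ⊆ {x | ∀ i, |x i - c i| ≤ r} :=
        fun x hx i => (f3 hx i).trans (hRle _)
      refine ⟨η', f1, f2, f3', f4, ?_⟩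
      refine (hen η' (k (j + 1)) f1 f2 f3' (hk0 _)).trans ?_
      refine (mul_le_mul_right f5 _).trans ?_
      rw [← ENNReal.ofReal_mul (by positivity)]
      refine ENNReal.ofReal_le_ofReal (le_trans (le_of_eq ?_)
        (deGiorgi_recursion hχ hK hH0 hr hKH j))
      rw [hkgap, hRgap]
      ring
  -- the truncation at level `K` vanishes on the inner cube
  have hχ0 : 0 < χ := by linarith
  set F : EuclideanSpace ℝ (Fin (d + 1)) → ℝ≥0∞ :=
    (openCube c (r / 2)).indicator fun x => ‖max (V x - K) 0‖ₑ ^ (2 * χ) with hF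
  have hFm : Measurable F :=
    (((hVs.measurable.sub_const K).max measurable_const).enorm.pow_const _).indicator
      (isOpen_openCube _ _).measurableSet
  set G : ℝ → ℝ≥0∞ := fun t => ∫⁻ y, F (sliceMap 0 t y) with hG
  have hGm : Measurable G := measurable_lintegral_sliceMap 0 hFm
  have hGle : ∀ j, ∫⁻ t, G t ^ (1 / χ) ≤
      ENNReal.ofReal C₁ ^ (1 / χ) * ENNReal.ofReal (H * θ ^ j) := by
    intro j
    obtain ⟨η, e1, e2, e3, e4, e5⟩ := hiter j
    have hDm : Measurable fun x => ‖truncGrad V DV (k j) η x‖ₑ ^ 2 :=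
      (stronglyMeasurable_truncGrad hVs hDVs (k j) e1).enorm.pow_const 2
    have hFle : ∀ x, F x ≤ ‖η x * max (V x - k j) 0‖ₑ ^ (2 * χ) := by
      intro x
      by_cases hx : x ∈ openCube c (r / 2)
      · rw [hF, Set.indicator_of_mem hx, e4 x (openCube_mono c (hRge _) hx), one_mul]
        refine ENNReal.rpow_le_rpow (enorm_le_iff_norm_le.2 ?_) (by positivity)
        rw [Real.norm_of_nonneg (le_max_right _ _), Real.norm_of_nonneg (le_max_right _ _)]
        exact max_le_max (by linarith [hkK j]) le_rfl
      · rw [hF, Set.indicator_of_notMem hx]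
        exact zero_le
    calc ∫⁻ t, G t ^ (1 / χ)
        ≤ ∫⁻ t, ENNReal.ofReal C₁ ^ (1 / χ) *
          ∫⁻ y, ‖truncGrad V DV (k j) η (sliceMap 0 t y)‖ₑ ^ 2 := by
          refine lintegral_mono_ae ?_
          filter_upwards [hsob η (k j) e1 e2 e3 (hk0 j) 0] with t ht
          have h1 : G t ≤ _ := (lintegral_mono fun y => hFle _).trans ht
          refine (ENNReal.rpow_le_rpow h1 (by positivity)).trans (le_of_eq ?_)
          rw [ENNReal.mul_rpow_of_nonneg _ _ (by positivity), ← ENNReal.rpow_mul,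
            mul_one_div_cancel hχ0.ne', ENNReal.rpow_one]
      _ = ENNReal.ofReal C₁ ^ (1 / χ) * ∫⁻ x, ‖truncGrad V DV (k j) η x‖ₑ ^ 2 := by
          rw [lintegral_const_mul _ (measurable_lintegral_sliceMap 0 hDm),
            ← lintegral_eq_lintegral_sliceMap 0 hDm]
      _ ≤ _ := by gcongr
  have hlim : Tendsto (fun j : ℕ => ENNReal.ofReal C₁ ^ (1 / χ) * ENNReal.ofReal (H * θ ^ j)) atTop
      (𝓝 0) := by
    have h1 : Tendsto (fun j : ℕ => H * θ ^ j) atTop (𝓝 (H * 0)) :=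
      (tendsto_pow_atTop_nhds_zero_of_lt_one hθ0.le hθ1).const_mul H
    have h2 := ENNReal.tendsto_ofReal h1
    have h3 := ENNReal.Tendsto.const_mul (a := ENNReal.ofReal C₁ ^ (1 / χ)) h2
      (Or.inr (ENNReal.rpow_ne_top_of_nonneg (by positivity) ENNReal.ofReal_ne_top))
    simpa using h3
  have hG0 : ∫⁻ t, G t ^ (1 / χ) = 0 :=
    le_antisymm (ge_of_tendsto' hlim hGle) zero_le
  rw [lintegral_eq_zero_iff (hGm.pow_const _)] at hG0
  have hF0 : ∫⁻ x, F x = 0 := by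
    rw [lintegral_eq_lintegral_sliceMap 0 hFm]
    refine (lintegral_congr_ae ?_).trans lintegral_zero
    filter_upwards [hG0] with t ht
    simpa [hχ0, hχ0.le, not_lt.2 hχ0.le] using ht
  rw [lintegral_eq_zero_iff hFm] at hF0
  filter_upwards [hF0] with x hx hxc
  rw [hF, Set.indicator_of_mem hxc] at hx
  have h1 : max (V x - K) 0 = 0 := by
    have h2 : ‖max (V x - K) 0‖ₑ = 0 := by
      have h3 : 0 < 2 * χ := by positivity
      exact (ENNReal.rpow_eq_zero_iff_of_pos h3).1 hx
    simpa using h2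
  have := le_max_left (V x - K) 0
  linarith

end

/-! ### The upper bound -/

section

variable {d : ℕ}

/-- The size of the level `K` for which the De Giorgi iteration converges: all powers of `L`, `S`
and `r` balance. The number `40960 = 10 * 256 * 16` comes from the initial energy bound, obtained
from the Caccioppoli inequality with a cutoff on a layer of width `r / 4`. -/
lemma exists_level_constant {χ Cs q : ℝ} (d : ℕ) (hχ : 1 < χ) (hCs : 0 < Cs) (hq : 0 < q) :
    ∃ D : ℝ, 0 < D ∧ ∀ L S r : ℝ, 0 < L → 0 < S → 0 < r →
      (10 * L * ((d + 1) * 128 * (Cs * (q * r) ^ (2 * χ + d - d * χ)))) *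
        (D * L ^ (χ / (2 * (χ - 1))) * (S / r ^ (d + 1)) ^ (1 / 2 : ℝ) / 2) ^ (2 - 2 * χ) *
        (16 * (40960 * (d + 1) * L * S / r ^ 2) / r) ^ χ / (r / 8)
      ≤ 40960 * (d + 1) * L * S / r ^ 2 * (1 / 2 : ℝ) ^ ((3 * χ - 1) / (χ - 1)) := by
  have hχ1 : 0 < χ - 1 := sub_pos.2 hχ
  set γ : ℝ := 2 * χ + d - d * χ with hγ
  set θ : ℝ := (1 / 2 : ℝ) ^ ((3 * χ - 1) / (χ - 1)) with hθ
  have hθ0 : 0 < θ := by positivity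
  set B : ℝ := 40960 * (d + 1) with hB
  have hB0 : 0 < B := by positivity
  set A : ℝ := 10 * ((d + 1) * 128 * (Cs * q ^ γ)) * (16 * B) ^ χ * 8 with hA
  have hA0 : 0 < A := by positivity
  set Q : ℝ := (B * θ / A) ^ (1 / (2 - 2 * χ)) with hQ
  have hQ0 : 0 < Q := by positivity
  have hQA : A * Q ^ (2 - 2 * χ) = B * θ := by
    rw [hQ, ← Real.rpow_mul (by positivity), one_div_mul_cancel (by linarith), Real.rpow_one]
    field_simp
  refine ⟨2 * Q, by positivity, fun L S r hL hS hr => le_of_eq ?_⟩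
  have e1 : (2 * Q * L ^ (χ / (2 * (χ - 1))) * (S / r ^ (d + 1)) ^ (1 / 2 : ℝ) / 2) ^ (2 - 2 * χ)
      = Q ^ (2 - 2 * χ) * L ^ (-χ) * (S ^ (1 - χ) * r ^ ((d + 1) * (χ - 1))) := by
    have e0 : (S / r ^ (d + 1)) ^ (1 / 2 : ℝ) = S ^ (1 / 2 : ℝ) * r ^ (-(((d : ℝ) + 1) / 2)) := by
      rw [Real.div_rpow hS.le (by positivity), ← Real.rpow_natCast, ← Real.rpow_mul hr.le,
        Real.rpow_neg hr.le, div_eq_mul_inv]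
      push_cast
      congr 3
      ring
    rw [e0, show 2 * Q * L ^ (χ / (2 * (χ - 1))) *
        (S ^ (1 / 2 : ℝ) * r ^ (-(((d : ℝ) + 1) / 2))) / 2
        = Q * L ^ (χ / (2 * (χ - 1))) * (S ^ (1 / 2 : ℝ) * r ^ (-(((d : ℝ) + 1) / 2))) by ring,
      Real.mul_rpow (by positivity) (by positivity), Real.mul_rpow (by positivity) (by positivity),
      Real.mul_rpow (by positivity) (by positivity), ← Real.rpow_mul hL.le,
      ← Real.rpow_mul hS.le, ← Real.rpow_mul hr.le]
    congr 3
    · field_simp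
      ring
    · ring
    · ring
  have e2 : (16 * (B * L * S / r ^ 2) / r) ^ χ = (16 * B) ^ χ * L ^ χ * S ^ χ * r ^ (-(3 * χ)) := by
    rw [show 16 * (B * L * S / r ^ 2) / r = 16 * B * L * S * r ^ (-3 : ℝ) by
        rw [Real.rpow_neg hr.le, show (3 : ℝ) = ((3 : ℕ) : ℝ) by norm_num, Real.rpow_natCast]
        field_simp,
      Real.mul_rpow (by positivity) (by positivity), Real.mul_rpow (by positivity) (by positivity),
      Real.mul_rpow (by positivity) (by positivity), ← Real.rpow_mul hr.le]
    congr 2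
    ring
  have e3 : L ^ (-χ) * L ^ χ = 1 := by
    rw [← Real.rpow_add hL, neg_add_cancel, Real.rpow_zero]
  have e4 : S ^ (1 - χ) * S ^ χ = S := by
    rw [← Real.rpow_add hS, sub_add_cancel, Real.rpow_one]
  have e5 : r ^ γ * r ^ ((d + 1) * (χ - 1)) * r ^ (-(3 * χ)) = r⁻¹ := by
    rw [← Real.rpow_add hr, ← Real.rpow_add hr, ← Real.rpow_neg_one]
    congr 1
    rw [hγ]
    ring
  rw [e1, e2, Real.mul_rpow hq.le hr.le]
  calc _ = A * Q ^ (2 - 2 * χ) * L * (L ^ (-χ) * L ^ χ) * (S ^ (1 - χ) * S ^ χ) *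
        (r ^ γ * r ^ ((d + 1) * (χ - 1)) * r ^ (-(3 * χ))) * r⁻¹ := by
        rw [hA]
        field_simp
    _ = _ := by
        rw [e3, e4, e5, hQA]
        field_simp

/-- The estimate on a cube of half side `r` contained in a ball of radius comparable to `r`. -/
lemma exists_ae_le_openCube {χ q : ℝ} (hd : 2 ≤ d) (hχ : 1 < χ)
    (hdχ : 1 / 2 ≤ 1 / (d : ℝ) + 1 / (2 * χ)) (hq : 0 < q) :
    ∃ D : ℝ, 0 < D ∧ ∀ (x₀ c : EuclideanSpace ℝ (Fin (d + 1))) (r : ℝ), 0 < r →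
      {x | ∀ i, |x i - c i| ≤ r} ⊆ Metric.ball x₀ (q * r) →
      ∀ (ν Λ : ℝ) (a : EuclideanSpace ℝ (Fin (d + 1)) → Matrix (Fin (d + 1)) (Fin (d + 1)) ℝ),
      0 < ν → ν ≤ Λ → IsEllipticCoefficient (Metric.ball x₀ (q * r)) ν Λ a →
      ∀ (V : EuclideanSpace ℝ (Fin (d + 1)) → ℝ)
        (DV : EuclideanSpace ℝ (Fin (d + 1)) → EuclideanSpace ℝ (Fin (d + 1))),
      HasW12Gradient (Metric.ball x₀ (q * r)) V DV → StronglyMeasurable V →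
      StronglyMeasurable DV → MemLp V 2 volume → MemLp DV 2 volume →
      (∀ x ∉ Metric.ball x₀ (q * r), V x = 0) → (∀ x ∉ Metric.ball x₀ (q * r), DV x = 0) →
      (∀ φ : EuclideanSpace ℝ (Fin (d + 1)) → ℝ, ContDiff ℝ 1 φ → HasCompactSupport φ →
        tsupport φ ⊆ Metric.ball x₀ (q * r) → (∀ x, 0 ≤ φ x) →
        ∫ x in Metric.ball x₀ (q * r),
          inner ℝ (Matrix.toEuclideanLin (a x) (DV x)) (gradient φ x) ≤ 0) →
      ∀ S : ℝ, 0 < S → ∫⁻ x, truncSq V c r 0 x ≤ ENNReal.ofReal S →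
      ∀ᵐ x, x ∈ openCube c (r / 2) →
        V x ≤ D * (Λ / ν) ^ (χ / (2 * (χ - 1))) * (S / r ^ (d + 1)) ^ (1 / 2 : ℝ) := by
  obtain ⟨Cs, hCs, hsob⟩ := exists_lintegral_sliceMap_le hd hχ hdχ
  obtain ⟨D, hD, hlev⟩ := exists_level_constant d hχ hCs hq
  refine ⟨D, hD, fun x₀ c r hr hcB ν Λ a hν hνΛ ha V DV hV hVs hDVs hVm hDVm hV0 hDV0 hsub S hS
    hVS => ?_⟩
  have hL : 0 < Λ / ν := div_pos (hν.trans_le hνΛ) hν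
  have hcomp : ∀ η : EuclideanSpace ℝ (Fin (d + 1)) → ℝ, tsupport η ⊆ {x | ∀ i, |x i - c i| ≤ r} →
      HasCompactSupport η := fun η h =>
    Metric.isCompact_of_isClosed_isBounded (isClosed_tsupport η)
      (Metric.isBounded_ball.subset (h.trans hcB))
  refine ae_le_of_energy_of_sobolev (C₁ := Cs * (q * r) ^ (2 * χ + d - d * χ))
    (L := Λ / ν) (H := 40960 * (d + 1) * (Λ / ν) * S / r ^ 2) hχ (by positivity) hL hr
    (by positivity) hS hVs hDVs hVm c (fun η k h1 h2 h3 h4 => ?_)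
    (fun η k h1 h2 h3 h4 i => ?_) hVS (le_of_eq ?_) (hlev _ S r hL hS hr)
  · exact caccioppoli Metric.isOpen_ball hν hνΛ ha hV hVs hDVs hVm hDVm hV0 hDV0 hsub h1
      (hcomp η h3) (h3.trans hcB) h4
  · exact hsob x₀ (q * r) (by positivity) _ _
      (h1.continuous.stronglyMeasurable.mul
        ((hVs.measurable.sub_const k).max measurable_const).stronglyMeasurable)
      (stronglyMeasurable_truncGrad hVs hDVs k h1)
      (isW12Limit_mul_posPart Metric.isOpen_ball hV hVs hDVs hVm hDVm hV0 hDV0 h1 (hcomp η h3)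
        (h3.trans hcB) h2 h4) i
  · field_simp
    ring

lemma closedCube_subset_ball {x₀ c : EuclideanSpace ℝ (Fin (d + 1))} {r : ℝ} (hr : 0 < r)
    (hc : c ∈ Metric.ball x₀ (4 * (d + 1) * r / 2)) :
    {x : EuclideanSpace ℝ (Fin (d + 1)) | ∀ i, |x i - c i| ≤ r} ⊆
      Metric.ball x₀ (4 * (d + 1) * r) := by
  intro x hx
  have h1 : ‖x - c‖ ≤ (d + 1) * r := by
    refine le_of_sq_le_sq ?_ (by positivity)
    rw [EuclideanSpace.norm_sq_eq]
    calc ∑ i, ‖(x - c) i‖ ^ 2 ≤ ∑ _i : Fin (d + 1), r ^ 2 := by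
          refine Finset.sum_le_sum fun i _ => ?_
          have : ‖(x - c) i‖ ≤ r := hx i
          gcongr
      _ = (d + 1) * r ^ 2 := by simp
      _ ≤ ((d + 1) * r) ^ 2 := by
          rw [mul_pow]
          have : (1 : ℝ) ≤ d + 1 := by simp
          gcongr
          nlinarith
  rw [Metric.mem_ball] at hc ⊢
  have h2 := dist_triangle x c x₀
  rw [dist_eq_norm x c] at h2
  have : 0 < (d + 1 : ℝ) * r := by positivity
  linarith

/-- The upper bound: the estimate holds with the exponent `χ / (2 (χ - 1))` whenever the Sobolev
embedding `W^{1,2} ⊆ L^{2χ}` holds on hyperplanes. -/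
lemma exists_supEstimate {χ : ℝ} (hd : 2 ≤ d) (hχ : 1 < χ)
    (hdχ : 1 / 2 ≤ 1 / (d : ℝ) + 1 / (2 * χ)) :
    ∃ C : ℝ, ∀ (x₀ : EuclideanSpace ℝ (Fin (d + 1))) (R : ℝ), 0 < R →
      SupEstimate (d + 1) x₀ R (χ / (2 * (χ - 1))) C := by
  set q : ℝ := 4 * (d + 1) with hq
  have hq0 : 0 < q := by positivity
  obtain ⟨D, hD, hcube⟩ := exists_ae_le_openCube hd hχ hdχ hq0
  set τ : ℝ := volume.real (Metric.ball (0 : EuclideanSpace ℝ (Fin (d + 1))) 1) with hτ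
  refine ⟨D * (τ * q ^ (d + 1)) ^ (1 / 2 : ℝ), fun x₀ R hR ν Λ a v hν hνΛ ha hv => ?_⟩
  obtain ⟨Dv, hvD, hsub⟩ := hv
  set B := Metric.ball x₀ R with hB
  have hBm : MeasurableSet B := measurableSet_ball
  have hτB : volume.real B = R ^ (d + 1) * τ := by
    rw [hτ, hB, Measure.real, Measure.addHaar_ball_of_pos _ _ hR, ENNReal.toReal_mul,
      ENNReal.toReal_ofReal (by positivity)]
    simp [Measure.real]
  have hτ0 : 0 < τ :=
    ENNReal.toReal_pos (Metric.measure_ball_pos _ _ one_pos).ne' measure_ball_lt_top.ne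
  obtain ⟨V, DV, hVs, hDVs, hVm, hDVm, hV0, hDV0, hvV, hDvDV, hV⟩ :=
    hvD.exists_stronglyMeasurable hBm
  have hsub' : ∀ φ : EuclideanSpace ℝ (Fin (d + 1)) → ℝ, ContDiff ℝ 1 φ → HasCompactSupport φ →
      tsupport φ ⊆ B → (∀ x, 0 ≤ φ x) →
      ∫ x in B, inner ℝ (Matrix.toEuclideanLin (a x) (DV x)) (gradient φ x) ≤ 0 := by
    intro φ h1 h2 h3 h4
    refine le_trans (le_of_eq (integral_congr_ae ?_)) (hsub φ h1 h2 h3 h4)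
    filter_upwards [hDvDV] with x hx
    rw [hx]
  set S : ℝ := ∫ x in B, max (V x) 0 ^ 2 with hS
  have hVint : Integrable (fun x => max (V x) 0 ^ 2) (volume.restrict B) := by
    refine (hVm.integrable_sq.restrict (s := B)).mono
      ((hVs.measurable.max measurable_const).pow_const 2).aestronglyMeasurable
      (Eventually.of_forall fun x => ?_)
    rw [Real.norm_of_nonneg (sq_nonneg _), Real.norm_of_nonneg (sq_nonneg _)]
    rcases le_total (V x) 0 with h | h
    · rw [max_eq_right h]; simp [sq_nonneg]
    · rw [max_eq_left h]
  have hSv : ⨍ x in B, max (v x) 0 ^ 2 = S / (R ^ (d + 1) * τ) := by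
    rw [setAverage_eq, hτB, smul_eq_mul, hS, div_eq_inv_mul]
    congr 1
    refine integral_congr_ae ?_
    filter_upwards [hvV] with x hx
    rw [hx]
  have hS0 : 0 ≤ S := integral_nonneg fun x => sq_nonneg _
  rw [hSv]
  refine essSup_le_of_ae_le _ ?_
  have hsubB : Metric.ball x₀ (R / 2) ⊆ B := Metric.ball_subset_ball (by linarith)
  have hvV' : v =ᵐ[volume.restrict (Metric.ball x₀ (R / 2))] V :=
    ae_restrict_of_ae_restrict_of_subset hsubB hvV
  suffices h : ∀ᵐ x ∂(volume.restrict (Metric.ball x₀ (R / 2))), V x ≤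
      D * (τ * q ^ (d + 1)) ^ (1 / 2 : ℝ) * (Λ / ν) ^ (χ / (2 * (χ - 1))) *
        √(S / (R ^ (d + 1) * τ)) by
    filter_upwards [h, hvV'] with x hx hx'
    rw [hx']
    exact EReal.coe_le_coe_iff.2 hx
  rcases hS0.eq_or_lt with h0 | hSpos
  · have h1 := (integral_eq_zero_iff_of_nonneg (fun x => sq_nonneg _) hVint).1 h0.symm
    filter_upwards [ae_restrict_of_ae_restrict_of_subset hsubB h1] with x hx
    have h2 : max (V x) 0 = 0 := by simpa using hx
    have h3 : 0 ≤ Λ / ν := div_nonneg (hν.le.trans hνΛ) hν.le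
    exact (max_eq_right_iff.1 h2).trans (by positivity)
  · set r : ℝ := R / q with hr
    have hr0 : 0 < r := by positivity
    have hqr : q * r = R := mul_div_cancel₀ _ hq0.ne'
    have hlint : ∫⁻ x in B, ENNReal.ofReal (max (V x) 0 ^ 2) = ENNReal.ofReal S :=
      (ofReal_integral_eq_lintegral_ofReal hVint (Eventually.of_forall fun x => sq_nonneg _)).symm
    have hK : D * (τ * q ^ (d + 1)) ^ (1 / 2 : ℝ) * (Λ / ν) ^ (χ / (2 * (χ - 1))) *
        √(S / (R ^ (d + 1) * τ))
        = D * (Λ / ν) ^ (χ / (2 * (χ - 1))) * (S / r ^ (d + 1)) ^ (1 / 2 : ℝ) := by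
      rw [Real.sqrt_eq_rpow, show S / r ^ (d + 1) = τ * q ^ (d + 1) * (S / (R ^ (d + 1) * τ)) by
        rw [hr, div_pow]; field_simp,
        Real.mul_rpow (x := τ * q ^ (d + 1)) (by positivity) (by positivity)]
      ring
    rw [hK]
    have hloc : ∀ c ∈ Metric.ball x₀ (R / 2), ∀ᵐ x, x ∈ openCube c (r / 2) →
        V x ≤ D * (Λ / ν) ^ (χ / (2 * (χ - 1))) * (S / r ^ (d + 1)) ^ (1 / 2 : ℝ) := by
      intro c hc
      have hcB : {x : EuclideanSpace ℝ (Fin (d + 1)) | ∀ i, |x i - c i| ≤ r} ⊆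
          Metric.ball x₀ (q * r) :=
        closedCube_subset_ball hr0 (by rwa [← hq, hqr])
      refine hcube x₀ c r hr0 hcB ν Λ a hν hνΛ (by rwa [hqr]) V DV (by rwa [hqr]) hVs hDVs hVm hDVm
        (by rwa [hqr]) (by rwa [hqr]) (by rwa [hqr]) S hSpos ?_
      rw [← hlint, ← lintegral_indicator hBm]
      refine lintegral_mono fun x => ?_
      have hsubset : openCube c r ⊆ B := by
        rw [hB, ← hqr]
        exact fun x hx => hcB fun i => (hx i).le
      simp only [truncSq, sub_zero]
      exact Set.indicator_le_indicator_of_subset hsubset (fun _ => zero_le) x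
    rw [ae_restrict_iff' measurableSet_ball, ae_iff]
    refine measure_null_of_locally_null _ fun c hc => ?_
    rw [Set.mem_ofPred_eq, Classical.not_imp] at hc
    refine ⟨_, inter_mem_nhdsWithin _ ((isOpen_openCube c (r / 2)).mem_nhds fun i => ?_), ?_⟩
    · rw [sub_self, abs_zero]; positivity
    · refine measure_mono_null (fun x hx => ?_) (ae_iff.1 (hloc c hc.1))
      rw [Set.mem_ofPred_eq]
      intro h
      exact hx.1 fun _ => h hx.2

end

/-! ### Subsolutions attaining the exponent -/

section Counterexample

variable {d : ℕ}

lemma hasDerivAt_max_zero_pow (m : ℕ) (t : ℝ) :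
    HasDerivAt (fun t : ℝ => max t 0 ^ (m + 2)) ((m + 2) * max t 0 ^ (m + 1)) t := by
  rcases lt_trichotomy t 0 with h | h | h
  · rw [max_eq_right h.le, zero_pow (by lia), mul_zero]
    refine (hasDerivAt_const t (0 : ℝ)).congr_of_eventuallyEq ?_
    filter_upwards [Iio_mem_nhds h] with s hs
    rw [max_eq_right (Set.mem_Iio.1 hs).le, zero_pow (by lia)]
  · subst h
    rw [max_self, zero_pow (by lia), mul_zero, ← hasDerivWithinAt_univ,
      ← Set.Iic_union_Ici (a := 0)]
    refine HasDerivWithinAt.union ?_ ?_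
    · refine (hasDerivWithinAt_const _ _ (0 : ℝ)).congr (fun s hs => ?_) (by simp)
      rw [max_eq_right hs, zero_pow (by lia)]
    · have h1 := (hasDerivAt_pow (m + 2) (0 : ℝ)).hasDerivWithinAt (s := Set.Ici 0)
      rw [show m + 2 - 1 = m + 1 by lia, zero_pow (by lia), mul_zero] at h1
      refine h1.congr (fun s hs => ?_) (by simp)
      rw [max_eq_left hs]
  · rw [max_eq_left h.le]
    have h1 := hasDerivAt_pow (m + 2) t
    rw [show m + 2 - 1 = m + 1 by lia] at h1
    push_cast at h1
    refine h1.congr_of_eventuallyEq ?_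
    filter_upwards [Ioi_mem_nhds h] with s hs
    rw [max_eq_left (Set.mem_Ioi.1 hs).le]

/-- The function `μ |x' - c'|²`, where `x = (x₀, x')`. -/
def tailSq (c : EuclideanSpace ℝ (Fin (d + 1))) (μ : ℝ) (x : EuclideanSpace ℝ (Fin (d + 1))) : ℝ :=
  μ * ∑ j : Fin d, (x j.succ - c j.succ) ^ 2

/-- The functions `e^{κ (x₀ - c₀)} (1 - μ |x' - c'|²)₊^m`, where `x = (x₀, x')`. The subsolution is
the one with `m = 3`; the smaller powers occur in its derivatives. -/
noncomputable def expBump (c : EuclideanSpace ℝ (Fin (d + 1))) (κ μ : ℝ) (m : ℕ)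
    (x : EuclideanSpace ℝ (Fin (d + 1))) : ℝ :=
  Real.exp (κ * (x 0 - c 0)) * max (1 - tailSq c μ x) 0 ^ m

@[fun_prop]
lemma continuous_expBump (c : EuclideanSpace ℝ (Fin (d + 1))) (κ μ : ℝ) (m : ℕ) :
    Continuous (expBump c κ μ m) := by
  unfold expBump tailSq
  fun_prop

lemma hasLineDerivAt_expBump_zero (c : EuclideanSpace ℝ (Fin (d + 1))) (κ μ : ℝ) (m : ℕ)
    (x : EuclideanSpace ℝ (Fin (d + 1))) :
    HasLineDerivAt ℝ (expBump c κ μ m) (κ * expBump c κ μ m x) x (EuclideanSpace.single 0 1) := by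
  unfold HasLineDerivAt
  have h1 : (fun t : ℝ => expBump c κ μ m (x + t • EuclideanSpace.single 0 1))
      = fun t => Real.exp (κ * (x 0 + t - c 0)) * max (1 - tailSq c μ x) 0 ^ m := by
    ext t
    simp [expBump, tailSq]
  rw [h1]
  have h2 : HasDerivAt (fun t : ℝ => κ * (x 0 + t - c 0)) (κ * 1) 0 :=
    (((hasDerivAt_id (0 : ℝ)).const_add (x 0)).sub_const (c 0)).const_mul κ
  refine (h2.exp.mul_const _).congr_deriv ?_
  simp only [expBump, add_zero]
  ring

lemma hasLineDerivAt_expBump_succ (c : EuclideanSpace ℝ (Fin (d + 1))) (κ μ : ℝ) (m : ℕ)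
    (x : EuclideanSpace ℝ (Fin (d + 1))) (i : Fin d) :
    HasLineDerivAt ℝ (expBump c κ μ (m + 2))
      (-(2 * (m + 2) * μ) * (x i.succ - c i.succ) * expBump c κ μ (m + 1) x) x
      (EuclideanSpace.single i.succ 1) := by
  unfold HasLineDerivAt
  have h1 : (fun t : ℝ => expBump c κ μ (m + 2) (x + t • EuclideanSpace.single i.succ 1))
      = fun t => Real.exp (κ * (x 0 - c 0)) * max (1 - μ * ∑ j : Fin d,
        (x j.succ + t * (if j = i then 1 else 0) - c j.succ) ^ 2) 0 ^ (m + 2) := by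
    ext t
    simp [expBump, tailSq]
  rw [h1]
  have h2 : HasDerivAt (fun t : ℝ => ∑ j : Fin d,
      (x j.succ + t * (if j = i then 1 else 0) - c j.succ) ^ 2)
      (∑ j : Fin d, 2 * (x j.succ - c j.succ) * (if j = i then 1 else 0)) 0 := by
    refine HasDerivAt.fun_sum fun j _ => ?_
    have := ((((hasDerivAt_id (0 : ℝ)).mul_const (if j = i then (1 : ℝ) else 0)).const_add
      (x j.succ)).sub_const (c j.succ)).fun_pow 2
    exact this.congr_deriv (by simp)
  have h3 : HasDerivAt (fun t : ℝ => 1 - μ * ∑ j : Fin d,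
      (x j.succ + t * (if j = i then 1 else 0) - c j.succ) ^ 2)
      (-(μ * (2 * (x i.succ - c i.succ)))) 0 := by
    exact ((h2.const_mul μ).const_sub 1).congr_deriv (by simp)
  have h4 := (hasDerivAt_max_zero_pow m _).comp (0 : ℝ) h3
  refine (h4.const_mul (Real.exp (κ * (x 0 - c 0)))).congr_deriv ?_
  simp only [expBump, tailSq, zero_mul, add_zero]
  ring

/-- The gradient of `expBump c κ μ 3`. -/
noncomputable def expBumpGrad (c : EuclideanSpace ℝ (Fin (d + 1))) (κ μ : ℝ)
    (x : EuclideanSpace ℝ (Fin (d + 1))) : EuclideanSpace ℝ (Fin (d + 1)) :=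
  WithLp.toLp 2 (Fin.cons (κ * expBump c κ μ 3 x)
    fun i => -(6 * μ) * (x i.succ - c i.succ) * expBump c κ μ 2 x)

lemma continuous_expBumpGrad (c : EuclideanSpace ℝ (Fin (d + 1))) (κ μ : ℝ) :
    Continuous (expBumpGrad c κ μ) := by
  refine (PiLp.continuous_toLp 2 _).comp (continuous_pi fun i => ?_)
  refine Fin.cases ?_ (fun i => ?_) i
  · simp only [Fin.cons_zero]
    fun_prop
  · simp only [Fin.cons_succ]
    fun_prop

/-- Integration by parts against a compactly supported `C¹` function. -/
lemma integral_mul_fderiv_eq_of_hasLineDerivAt {n : ℕ} {F G φ : EuclideanSpace ℝ (Fin n) → ℝ}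
    {e : EuclideanSpace ℝ (Fin n)} (hF : Continuous F) (hG : Continuous G)
    (hFG : ∀ x, HasLineDerivAt ℝ F (G x) x e) (hφ : ContDiff ℝ 1 φ) (hφc : HasCompactSupport φ) :
    ∫ x, F x * fderiv ℝ φ x e = -∫ x, G x * φ x := by
  have hφ' : Continuous fun x => fderiv ℝ φ x e :=
    (hφ.continuous_fderiv (by norm_num)).clm_apply continuous_const
  refine integral_bilinear_hasLineDerivAt_right_eq_neg_left_of_integrable
    (B := ContinuousLinearMap.mul ℝ ℝ) ?_ ?_ ?_ (fun x _ => hFG x) fun x _ =>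
      (hφ.differentiable (by norm_num) x).hasFDerivAt.hasLineDerivAt e
  · exact (hG.mul hφ.continuous).integrable_of_hasCompactSupport hφc.mul_left
  · exact (hF.mul hφ').integrable_of_hasCompactSupport
      (hφc.fderiv_apply (𝕜 := ℝ) e).mul_left
  · exact (hF.mul hφ.continuous).integrable_of_hasCompactSupport hφc.mul_left

lemma hasLineDerivAt_expBump_three (c : EuclideanSpace ℝ (Fin (d + 1))) (κ μ : ℝ)
    (x : EuclideanSpace ℝ (Fin (d + 1))) (i : Fin (d + 1)) :
    HasLineDerivAt ℝ (expBump c κ μ 3) (expBumpGrad c κ μ x i) x (EuclideanSpace.single i 1) := by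
  refine Fin.cases ?_ (fun i => ?_) i
  · exact hasLineDerivAt_expBump_zero c κ μ 3 x
  · convert hasLineDerivAt_expBump_succ c κ μ 1 x i using 1
    simp only [expBumpGrad, Fin.cons_succ]
    norm_num

lemma memLp_two_restrict_ball {n : ℕ} {F : Type*} [NormedAddCommGroup F]
    {f : EuclideanSpace ℝ (Fin n) → F} (hf : Continuous f) (x₀ : EuclideanSpace ℝ (Fin n)) (R : ℝ) :
    MemLp f 2 (volume.restrict (Metric.ball x₀ R)) := by
  obtain ⟨C, hC⟩ := (isCompact_closedBall x₀ R).exists_bound_of_continuousOn hf.continuousOn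
  have : IsFiniteMeasure (volume.restrict (Metric.ball x₀ R)) :=
    ⟨by rw [Measure.restrict_apply_univ]; exact measure_ball_lt_top⟩
  refine MemLp.of_bound hf.aestronglyMeasurable C ?_
  filter_upwards [ae_restrict_mem measurableSet_ball] with x hx
  exact hC x (Metric.ball_subset_closedBall hx)

lemma hasW12Gradient_expBump (c x₀ : EuclideanSpace ℝ (Fin (d + 1))) (κ μ R : ℝ) :
    HasW12Gradient (Metric.ball x₀ R) (expBump c κ μ 3) (expBumpGrad c κ μ) := by
  refine ⟨?_, ?_, fun φ h1 h2 h3 i => ?_⟩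
  · exact memLp_two_restrict_ball (continuous_expBump c κ μ 3) x₀ R
  · exact memLp_two_restrict_ball (continuous_expBumpGrad c κ μ) x₀ R
  · have hφ0 : ∀ x ∉ Metric.ball x₀ R, φ x = 0 := fun x hx =>
      image_eq_zero_of_notMem_tsupport fun h => hx (h3 h)
    have hφ'0 : ∀ x ∉ Metric.ball x₀ R, fderiv ℝ φ x = 0 := fun x hx =>
      image_eq_zero_of_notMem_tsupport fun h => hx (h3 (tsupport_fderiv_subset ℝ h))
    rw [setIntegral_eq_integral_of_forall_compl_eq_zero fun x hx => by simp [hφ'0 x hx],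
      setIntegral_eq_integral_of_forall_compl_eq_zero fun x hx => by simp [hφ0 x hx]]
    exact integral_mul_fderiv_eq_of_hasLineDerivAt (continuous_expBump c κ μ 3)
      (by have := continuous_expBumpGrad c κ μ; fun_prop)
      (fun x => hasLineDerivAt_expBump_three c κ μ x i) (h1.of_le (by norm_num)) h2

/-- The coefficient matrix `diag (Λ, 1, …, 1)`. -/
def diagCoeff (d : ℕ) (Λ : ℝ) : Matrix (Fin (d + 1)) (Fin (d + 1)) ℝ :=
  Matrix.diagonal (Fin.cons Λ fun _ => 1)

lemma inner_diagCoeff (Λ : ℝ) (y z : EuclideanSpace ℝ (Fin (d + 1))) :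
    inner ℝ (Matrix.toEuclideanLin (diagCoeff d Λ) y) z
      = Λ * y 0 * z 0 + ∑ j : Fin d, y j.succ * z j.succ := by
  simp only [PiLp.inner_apply, Matrix.toLpLin_apply, diagCoeff, Matrix.mulVec_diagonal]
  rw [Fin.sum_univ_succ]
  simp only [Fin.cons_zero, Fin.cons_succ, RCLike.inner_apply, conj_trivial, one_mul]
  congr 1
  · ring
  · exact Finset.sum_congr rfl fun j _ => by ring

lemma isEllipticCoefficient_diagCoeff {Λ : ℝ} (hΛ : 1 ≤ Λ) (x₀ : EuclideanSpace ℝ (Fin (d + 1)))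
    (R : ℝ) : IsEllipticCoefficient (Metric.ball x₀ R) 1 Λ fun _ => diagCoeff d Λ := by
  refine ⟨fun i j => ?_, Eventually.of_forall fun x => Matrix.isSymm_diagonal _,
    Eventually.of_forall fun x z => ?_⟩
  · have : IsFiniteMeasure (volume.restrict (Metric.ball x₀ R)) :=
      ⟨by rw [Measure.restrict_apply_univ]; exact measure_ball_lt_top⟩
    exact memLp_const _
  · rw [inner_diagCoeff, EuclideanSpace.norm_sq_eq, Fin.sum_univ_succ, mul_add, mul_add,
      Finset.mul_sum, Finset.mul_sum]
    simp only [Real.norm_eq_abs, sq_abs]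
    constructor
    · refine add_le_add (by nlinarith [sq_nonneg (z 0)]) (le_of_eq ?_)
      exact Finset.sum_congr rfl fun j _ => by ring
    · refine add_le_add (by nlinarith [sq_nonneg (z 0)]) (Finset.sum_le_sum fun j _ => ?_)
      nlinarith [sq_nonneg (z j.succ)]

/-- `expBump c κ μ 3` is a subsolution for `diag (Λ, 1, …, 1)` and this `κ`: close to the
boundary of the support the second derivatives in `x'` are positive, elsewhere `Λ ∂₀²` wins. -/
lemma isSubsolution_expBump (c x₀ : EuclideanSpace ℝ (Fin (d + 1))) {κ μ Λ R : ℝ} (hμ : 0 ≤ μ)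
    (hκ : Λ * κ ^ 2 = μ * (6 * d + 24) ^ 2) :
    IsSubsolution (Metric.ball x₀ R) (fun _ => diagCoeff d Λ) (expBump c κ μ 3) := by
  refine ⟨_, hasW12Gradient_expBump c x₀ κ μ R, fun φ h1 h2 h3 h4 => ?_⟩
  have hφ'0 : ∀ x ∉ Metric.ball x₀ R, gradient φ x = 0 := fun x hx => by
    rw [← norm_eq_zero, norm_gradient_eq, norm_eq_zero]
    exact image_eq_zero_of_notMem_tsupport fun h => hx (h3 (tsupport_fderiv_subset ℝ h))
  rw [setIntegral_eq_integral_of_forall_compl_eq_zero fun x hx => by simp [hφ'0 x hx]]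
  have hgrad : ∀ x i, gradient φ x i = fderiv ℝ φ x (EuclideanSpace.single i 1) := fun x i => by
    rw [← inner_gradient_left, EuclideanSpace.inner_single_right]
    simp
  -- the second derivatives of the subsolution
  set G : Fin d → EuclideanSpace ℝ (Fin (d + 1)) → ℝ := fun j x => -(6 * μ) * expBump c κ μ 2 x
    + 24 * μ ^ 2 * (x j.succ - c j.succ) ^ 2 * expBump c κ μ 1 x with hG
  have hGc : ∀ j, Continuous (G j) := fun j => by simp only [hG]; fun_prop
  have hG' : ∀ j x, HasLineDerivAt ℝ (fun x => -(6 * μ) * (x j.succ - c j.succ) *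
      expBump c κ μ 2 x) (G j x) x (EuclideanSpace.single j.succ 1) := by
    intro j x
    have e1 : HasDerivAt (fun t : ℝ => -(6 * μ) *
        ((x + t • EuclideanSpace.single j.succ (1 : ℝ) : EuclideanSpace ℝ (Fin (d + 1))) j.succ
          - c j.succ)) (-(6 * μ)) 0 := by
      have : HasDerivAt (fun t : ℝ => -(6 * μ) * (x j.succ + t - c j.succ)) (-(6 * μ) * 1) 0 :=
        (((hasDerivAt_id (0 : ℝ)).const_add _).sub_const _).const_mul _
      simpa using this
    have e2 := hasLineDerivAt_expBump_succ c κ μ 0 x j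
    unfold HasLineDerivAt at e2 ⊢
    refine (e1.mul e2).congr_deriv ?_
    simp only [hG, zero_smul, add_zero, zero_add]
    push_cast
    ring
  have hint : ∀ (F : EuclideanSpace ℝ (Fin (d + 1)) → ℝ) (e : EuclideanSpace ℝ (Fin (d + 1))),
      Continuous F → Integrable (fun x => F x * fderiv ℝ φ x e) := fun F e hF =>
    (hF.mul ((h1.continuous_fderiv (by norm_num)).clm_apply
      continuous_const)).integrable_of_hasCompactSupport (h2.fderiv_apply (𝕜 := ℝ) e).mul_left
  have hint' : ∀ (F : EuclideanSpace ℝ (Fin (d + 1)) → ℝ), Continuous F →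
      Integrable (fun x => F x * φ x) := fun F hF =>
    (hF.mul h1.continuous).integrable_of_hasCompactSupport h2.mul_left
  have hF : ∀ j : Fin d, Continuous fun x : EuclideanSpace ℝ (Fin (d + 1)) =>
      -(6 * μ) * (x j.succ - c j.succ) * expBump c κ μ 2 x := fun j => by fun_prop
  have hmain : ∫ x, inner ℝ (Matrix.toEuclideanLin (diagCoeff d Λ) (expBumpGrad c κ μ x))
      (gradient φ x) = -∫ x, (Λ * κ ^ 2 * expBump c κ μ 3 x + ∑ j, G j x) * φ x := by
    simp_rw [inner_diagCoeff, hgrad]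
    simp only [expBumpGrad, Fin.cons_zero, Fin.cons_succ]
    rw [integral_add (hint (fun x => Λ * (κ * expBump c κ μ 3 x)) _ (by fun_prop))
      (integrable_finsetSum _ fun j _ => hint _ _ (hF j)),
      integral_finsetSum _ fun j _ => hint _ _ (hF j)]
    simp_rw [add_mul, Finset.sum_mul]
    rw [integral_add (hint' (fun x => Λ * κ ^ 2 * expBump c κ μ 3 x) (by fun_prop))
      (integrable_finsetSum _ fun j _ => hint' _ (hGc j)),
      integral_finsetSum _ fun j _ => hint' _ (hGc j), neg_add, ← Finset.sum_neg_distrib]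
    congr 1
    · refine integral_mul_fderiv_eq_of_hasLineDerivAt (by fun_prop) (by fun_prop) (fun x => ?_)
        h1 h2
      have e1 := hasLineDerivAt_expBump_zero c κ μ 3 x
      unfold HasLineDerivAt at e1 ⊢
      refine ((e1.const_mul κ).const_mul Λ).congr_deriv ?_
      ring
    · exact Finset.sum_congr rfl fun j _ =>
        integral_mul_fderiv_eq_of_hasLineDerivAt (hF j) (hGc j) (hG' j) h1 h2
  rw [hmain, neg_nonpos]
  refine integral_nonneg fun x => mul_nonneg ?_ (h4 x)
  set w := max (1 - tailSq c μ x) 0 with hw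
  have hb : ∀ m, expBump c κ μ m x = Real.exp (κ * (x 0 - c 0)) * w ^ m := fun _ => rfl
  have hsum : ∑ j, G j x = Real.exp (κ * (x 0 - c 0)) * μ *
      (-(6 * d) * w ^ 2 + 24 * tailSq c μ x * w) := by
    simp only [hG, hb, Finset.sum_add_distrib, ← Finset.sum_mul, ← Finset.mul_sum,
      tailSq, Finset.sum_const, Finset.card_univ, Fintype.card_fin, nsmul_eq_mul]
    ring
  have hw0 : 0 ≤ w := le_max_right _ _
  have htw : tailSq c μ x * w = (1 - w) * w := by
    rcases le_total (1 - tailSq c μ x) 0 with h | h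
    · rw [hw, max_eq_right h]; ring
    · rw [hw, max_eq_left h]; ring
  rw [hsum, hκ, show ∀ y : ℝ, 24 * tailSq c μ x * y = 24 * (tailSq c μ x * y) from fun y => by ring,
    htw]
  have hfin : μ * (6 * d + 24) ^ 2 * expBump c κ μ 3 x + Real.exp (κ * (x 0 - c 0)) * μ *
      (-(6 * d) * w ^ 2 + 24 * ((1 - w) * w))
      = Real.exp (κ * (x 0 - c 0)) * μ * w * (((6 * d + 24) * w) ^ 2 - (6 * d + 24) * w + 24) := by
    rw [hb]
    ring
  change 0 ≤ _
  rw [hfin]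
  refine mul_nonneg (by positivity) ?_
  nlinarith [sq_nonneg ((6 * d + 24) * w - 1)]

/-- On the ball, the subsolution is concentrated on a box whose sides in the directions `x'` are
proportional to `μ^{-1/2}`. -/
lemma integral_expBump_sq_le (c : EuclideanSpace ℝ (Fin (d + 1))) {κ μ R : ℝ} (hκ : 0 ≤ κ)
    (hμ : 0 < μ) (hR : 0 < R) :
    ∫ x in Metric.ball c R, max (expBump c κ μ 3 x) 0 ^ 2
      ≤ Real.exp (2 * (κ * R)) * (2 * R * (2 * (1 / √μ)) ^ d) := by
  set b : Fin (d + 1) → ℝ := Fin.cons R fun _ => 1 / √μ with hb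
  set e := (MeasurableEquiv.toLp 2 (Fin (d + 1) → ℝ)).symm with he
  set Q : Set (EuclideanSpace ℝ (Fin (d + 1))) :=
    e ⁻¹' Set.Icc (fun i => c i - b i) (fun i => c i + b i) with hQ
  have hQm : MeasurableSet Q := e.measurable measurableSet_Icc
  have hQv : volume Q = ENNReal.ofReal (2 * R * (2 * (1 / √μ)) ^ d) := by
    rw [hQ, (EuclideanSpace.volume_preserving_symm_measurableEquiv_toLp
      (Fin (d + 1))).measure_preimage measurableSet_Icc.nullMeasurableSet, Real.volume_Icc_pi,
      Fin.prod_univ_succ, ENNReal.ofReal_mul (by positivity), ENNReal.ofReal_pow (by positivity)]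
    simp only [hb, Fin.cons_zero, Fin.cons_succ, Finset.prod_const, Finset.card_univ,
      Fintype.card_fin, add_sub_sub_cancel]
    congr 2
    · ring
    · congr 1
      ring
  have hle : ∀ x ∈ Metric.ball c R, max (expBump c κ μ 3 x) 0 ^ 2
      ≤ Q.indicator (fun _ => Real.exp (2 * (κ * R))) x := by
    intro x hx
    have hx' : ∀ i, |x i - c i| ≤ R := fun i => by
      rw [Metric.mem_ball, dist_eq_norm] at hx
      exact (PiLp.norm_apply_le (x - c) i).trans hx.le
    rw [max_eq_left (by unfold expBump; positivity)]
    by_cases hxQ : x ∈ Q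
    · rw [Set.indicator_of_mem hxQ, two_mul, Real.exp_add, ← sq]
      have h1 : max (1 - tailSq c μ x) 0 ≤ 1 := by
        refine max_le (sub_le_self _ ?_) zero_le_one
        unfold tailSq
        positivity
      have h2 : Real.exp (κ * (x 0 - c 0)) ≤ Real.exp (κ * R) := by
        gcongr
        exact (le_abs_self _).trans (hx' 0)
      refine pow_le_pow_left₀ (by unfold expBump; positivity) ?_ 2
      exact (mul_le_of_le_one_right (Real.exp_nonneg _)
        (pow_le_one₀ (le_max_right _ _) h1)).trans h2
    · rw [Set.indicator_of_notMem hxQ]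
      have h1 : ∃ j : Fin d, 1 / √μ < |x j.succ - c j.succ| := by
        by_contra! h
        refine hxQ ⟨fun i => ?_, fun i => ?_⟩
        · refine Fin.cases ?_ (fun j => ?_) i
          · have := abs_le.1 (hx' 0)
            change c 0 - R ≤ x 0
            linarith
          · have := abs_le.1 (h j)
            change c j.succ - 1 / √μ ≤ x j.succ
            linarith
        · refine Fin.cases ?_ (fun j => ?_) i
          · have := abs_le.1 (hx' 0)
            change x 0 ≤ c 0 + R
            linarith
          · have := abs_le.1 (h j)
            change x j.succ ≤ c j.succ + 1 / √μ
            linarith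
      obtain ⟨j, hj⟩ := h1
      have h2 : 1 ≤ tailSq c μ x := by
        have h3 : (1 / √μ) ^ 2 ≤ (x j.succ - c j.succ) ^ 2 := by
          rw [← sq_abs (x j.succ - c j.succ)]
          gcongr
        calc (1 : ℝ) = μ * (1 / √μ) ^ 2 := by
              rw [div_pow, Real.sq_sqrt hμ.le]
              field_simp
          _ ≤ μ * (x j.succ - c j.succ) ^ 2 := by gcongr
          _ ≤ _ := by
            unfold tailSq
            gcongr
            exact Finset.single_le_sum (f := fun j : Fin d => (x j.succ - c j.succ) ^ 2)
              (fun _ _ => sq_nonneg _) (Finset.mem_univ j)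
      rw [expBump, max_eq_right (by linarith)]
      simp
  have hint : Integrable (Q.indicator fun _ => Real.exp (2 * (κ * R))) :=
    (integrable_indicator_iff hQm).2 (integrableOn_const (by rw [hQv]; exact ENNReal.ofReal_ne_top))
  calc ∫ x in Metric.ball c R, max (expBump c κ μ 3 x) 0 ^ 2
      ≤ ∫ x in Metric.ball c R, Q.indicator (fun _ => Real.exp (2 * (κ * R))) x := by
        refine integral_mono_of_nonneg (Eventually.of_forall fun x => sq_nonneg _) hint.restrict ?_
        filter_upwards [ae_restrict_mem measurableSet_ball] with x hx using hle x hx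
    _ ≤ ∫ x, Q.indicator (fun _ => Real.exp (2 * (κ * R))) x :=
        setIntegral_le_integral hint (Eventually.of_forall fun x =>
          Set.indicator_nonneg (fun _ _ => (Real.exp_nonneg _)) x)
    _ = _ := by
        rw [integral_indicator hQm, setIntegral_const, Measure.real, hQv,
          ENNReal.toReal_ofReal (by positivity), smul_eq_mul, mul_comm]

/-- An estimate with exponent `m < d / 4` fails: the subsolution equals `1` at the centre, while
its mean square is of order `Λ^{-d/2}`. -/
lemma not_supEstimate {m : ℝ} (hm : m < (d : ℝ) / 4) (x₀ : EuclideanSpace ℝ (Fin (d + 1))) {R : ℝ}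
    (hR : 0 < R) (C : ℝ) : ¬ SupEstimate (d + 1) x₀ R m C := by
  intro h
  set k : ℝ := 6 * d + 24 with hk
  set τ : ℝ := volume.real (Metric.ball x₀ R) with hτ
  have hτ0 : 0 < τ :=
    ENNReal.toReal_pos (Metric.measure_ball_pos _ _ hR).ne' measure_ball_lt_top.ne
  set A : ℝ := Real.exp (2 * k) * (2 * R * (2 * R) ^ d) / τ with hA
  have hbound : ∀ Λ : ℝ, 1 ≤ Λ → 1 ≤ |C| * √A * Λ ^ (-((d : ℝ) / 4 - m)) := by
    intro Λ hΛ
    have hΛ0 : 0 < Λ := by linarith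
    set μ : ℝ := Λ / R ^ 2 with hμ
    have hμ0 : 0 < μ := by positivity
    set v := expBump x₀ (k / R) μ 3 with hv
    have hest := h 1 Λ (fun _ => diagCoeff d Λ) v one_pos hΛ
      (isEllipticCoefficient_diagCoeff hΛ x₀ R)
      (isSubsolution_expBump x₀ x₀ hμ0.le (by rw [div_pow, hμ]; ring))
    set M : ℝ := C * (Λ / 1) ^ m * √(⨍ x in Metric.ball x₀ R, max (v x) 0 ^ 2) with hM
    have h1 : 1 ≤ M := by
      by_contra! hlt
      have hae : ∀ᵐ x ∂(volume.restrict (Metric.ball x₀ (R / 2))), v x ≤ M := by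
        filter_upwards [ae_le_essSup (f := fun x => (v x : EReal))
          (μ := volume.restrict (Metric.ball x₀ (R / 2)))] with x hx
        exact EReal.coe_le_coe_iff.1 (hx.trans hest)
      rw [ae_restrict_iff' measurableSet_ball, ae_iff] at hae
      have hopen : IsOpen (Metric.ball x₀ (R / 2) ∩ {x | M < v x}) :=
        Metric.isOpen_ball.inter (isOpen_lt continuous_const (continuous_expBump _ _ _ _))
      have hne : (Metric.ball x₀ (R / 2) ∩ {x | M < v x}).Nonempty := by
        refine ⟨x₀, Metric.mem_ball_self (by positivity), ?_⟩
        rw [Set.mem_ofPred_eq, hv]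
        simpa [expBump, tailSq] using hlt
      refine (hopen.measure_pos volume hne).ne' (measure_mono_null (fun x hx => ?_) hae)
      rw [Set.mem_ofPred_eq]
      exact fun h => not_le.2 hx.2 (h hx.1)
    have h2 : ⨍ x in Metric.ball x₀ R, max (v x) 0 ^ 2 ≤ A * Λ ^ (-((d : ℝ) / 2)) := by
      rw [setAverage_eq, smul_eq_mul, ← hτ]
      refine (mul_le_mul_of_nonneg_left (integral_expBump_sq_le x₀ (by positivity) hμ0 hR)
        (by positivity)).trans (le_of_eq ?_)
      have h3 : (1 / √μ) ^ d = R ^ d * Λ ^ (-((d : ℝ) / 2)) := by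
        rw [hμ, Real.sqrt_div hΛ0.le, Real.sqrt_sq hR.le, one_div_div, div_pow,
          Real.rpow_neg hΛ0.le,
          Real.sqrt_eq_rpow, ← Real.rpow_natCast (Λ ^ (1 / 2 : ℝ)), ← Real.rpow_mul hΛ0.le,
          div_eq_mul_inv]
        congr 3
        ring
      rw [mul_pow, h3, div_mul_cancel₀ _ hR.ne', hA, mul_pow]
      field_simp
    calc (1 : ℝ) ≤ M := h1
      _ ≤ |C| * Λ ^ m * √(A * Λ ^ (-((d : ℝ) / 2))) := by
        rw [hM, div_one]
        gcongr
        exact le_abs_self C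
      _ = |C| * √A * Λ ^ (-((d : ℝ) / 4 - m)) := by
        rw [Real.sqrt_mul (by positivity), Real.sqrt_eq_rpow (Λ ^ (-((d : ℝ) / 2))),
          ← Real.rpow_mul hΛ0.le,
          show -((d : ℝ) / 4 - m) = m + -((d : ℝ) / 2) * (1 / 2) by ring, Real.rpow_add hΛ0]
        ring
  have hlim : Tendsto (fun Λ : ℝ => |C| * √A * Λ ^ (-((d : ℝ) / 4 - m))) atTop
      (𝓝 (|C| * √A * 0)) :=
    (tendsto_rpow_neg_atTop (sub_pos.2 hm)).const_mul _
  rw [mul_zero] at hlim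
  have := ge_of_tendsto hlim ((eventually_ge_atTop 1).mono hbound)
  linarith

end Counterexample

/-! ### The range of exponents -/

theorem proposition2 :
    -- the estimate for `n ≥ 4`, with a constant depending only on `n`
    (∀ n : ℕ, 4 ≤ n → ∃ c : ℝ, ∀ (x₀ : EuclideanSpace ℝ (Fin n)) (R : ℝ), 0 < R →
      SupEstimate n x₀ R (((n : ℝ) - 1) / 4) c) ∧
    -- the estimate for `n = 3`, with a constant depending only on `κ`
    (∀ κ : ℝ, 0 < κ → κ < 1 / 2 → ∃ c : ℝ, ∀ (x₀ : EuclideanSpace ℝ (Fin 3)) (R : ℝ), 0 < R →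
      SupEstimate 3 x₀ R ((1 + κ) / 2) c) ∧
    -- for `n ≥ 4` no smaller exponent is possible, on any ball and with any constant
    (∀ n : ℕ, 4 ≤ n → ∀ m : ℝ, m < ((n : ℝ) - 1) / 4 →
      ∀ (x₀ : EuclideanSpace ℝ (Fin n)) (R : ℝ), 0 < R → ∀ c : ℝ, ¬ SupEstimate n x₀ R m c) ∧
    -- for `n = 3` no exponent below `1 / 2` is possible, on any ball and with any constant
    (∀ m : ℝ, m < 1 / 2 →
      ∀ (x₀ : EuclideanSpace ℝ (Fin 3)) (R : ℝ), 0 < R → ∀ c : ℝ, ¬ SupEstimate 3 x₀ R m c) := by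
  refine ⟨fun n hn => ?_, fun κ hκ _ => ?_, fun n hn m hm x₀ R hR c => ?_,
    fun m hm x₀ R hR c => ?_⟩
  · -- `χ = d / (d - 2)` is the critical Sobolev exponent in dimension `d = n - 1`
    obtain ⟨d, rfl⟩ : ∃ d, n = d + 1 := ⟨n - 1, by lia⟩
    have hd : (3 : ℝ) ≤ d := by exact_mod_cast (by lia : 3 ≤ d)
    have hd2 : (0 : ℝ) < d - 2 := by linarith
    have h := exists_supEstimate (d := d) (χ := (d : ℝ) / (d - 2)) (by lia)
      (by rw [lt_div_iff₀ hd2]; linarith)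
      (le_of_eq (by field_simp; ring))
    have he : (d : ℝ) / (d - 2) / (2 * ((d : ℝ) / (d - 2) - 1)) = (((d + 1 : ℕ) : ℝ) - 1) / 4 := by
      push_cast
      field_simp
      ring
    rwa [he] at h
  · -- in dimension two every finite Sobolev exponent is admissible
    have h := exists_supEstimate (d := 2) (χ := 1 + 1 / κ) le_rfl
      (by have : 0 < 1 / κ := by positivity
          linarith)
      (by have : 0 < 1 / (2 * (1 + 1 / κ)) := by positivity
          norm_num at this ⊢
          exact this.le)
    have he : (1 + 1 / κ) / (2 * (1 + 1 / κ - 1)) = (1 + κ) / 2 := by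
      field_simp
      ring
    rwa [he] at h
  · obtain ⟨d, rfl⟩ : ∃ d, n = d + 1 := ⟨n - 1, by lia⟩
    push_cast at hm
    exact not_supEstimate (by linarith) x₀ hR c
  · exact not_supEstimate (d := 2) (by norm_num at hm ⊢; linarith) x₀ hR c
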